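/- Let $M$ be a smooth manifold of dimension $n+1$ and let $\mathscr{L}\colon TM\setminus 0\to\mathbb{R}$ be a Lorentz--Finsler Lagrangian (of class $C^4$ at least): $\mathscr{L}(x,sv)=s^2\mathscr{L}(x,v)$ for $s>0$, and the fibre Hessian $g_{\mu\nu}(x,v)=\partial^2\mathscr{L}/\partial v^\mu\partial v^\nu$, also denoted $g_v$, has signature $(-,+,\dots,+)$ for every $v\neq 0$. Let $G^\alpha$ be the spray coefficients, $$2G^\alpha=g^{\alpha\delta}\Big(\frac{\partial^2\mathscr{L}}{\partial x^\gamma\partial v^\delta}v^\gamma-\frac{\partial\mathscr{L}}{\partial x^\delta}\Big),$$ let $N^\mu_\alpha=\partial G^\mu/\partial v^\alpha$, $\frac{\delta}{\delta x^\mu}=\frac{\partial}{\partial x^\mu}-N^\nu_\mu\frac{\partial}{\partial v^\nu}$, $R^\mu_{\alpha\beta}=\frac{\delta N^\mu_\beta}{\delta x^\alpha}-\frac{\delta N^\mu_\alpha}{\delta x^\beta}$, and let $R_v\colon T_xM\to T_xM$, $R_v(X)^\mu=R^\mu_{\alpha\beta}(x,v)X^\alpha v^\beta$, $Ric(v)=\mathrm{tr}\,R_v$.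 For vector fields put $(D_\xi s)^\alpha=\partial_\xi s^\alpha+N^\alpha_\mu(x,s)\xi^\mu$ and $(\tilde D_\xi s)^\alpha=\partial_\xi s^\alpha+N^\alpha_\mu(x,\xi)s^\mu$. Let $H$ be an (immersed) $C^2$ null hypersurface of $M$ and let $\mathsf n$ be a $C^1$, nowhere zero vector field on $H$, tangent to $H$ and lightlike, $g_{\mathsf n}(\mathsf n,\mathsf n)=0$, with $T_pH=\ker g_{\mathsf n}(\mathsf n,\cdot)$ for every $p\in H$ and $D_{\mathsf n}\mathsf n=\kappa\,\mathsf n$ for a function $\kappa$ on $H$. Its integral curves are called the generators of $H$. Let $V=TH/\langle\mathsf n\rangle$, a bundle with fibres of dimension $n-1$, and let $\overline{X}\in V$ be the class of $X\in TH$. Then $D_X\mathsf n$ and $R_{\mathsf n}(X)$ are tangent to $H$ for every $X\in TH$, and $b(\overline X):=\overline{D_X\mathsf n}$ (the null Weingarten map) and $\bar R(\overline X):=\overline{R_{\mathsf n}(X)}$ are well-defined endomorphisms of the fibres of $V$. Along each generator the derivative $\overline X':=\overline{\tilde D_{\mathsf n}X}$ of sections of $V$ is well defined, and for fields $A$ of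 endomorphisms of $V$ one puts $A'(\overline X):=(A(\overline X))'-A(\overline X')$. Let $$\theta=\mathrm{tr}\,b,\quad \bar\sigma=b-\tfrac{1}{n-1}\theta\,\mathrm{Id},\quad \sigma^2=\mathrm{tr}\,\bar\sigma^2,\quad \bar C=\bar R-\tfrac1{n-1}(\mathrm{tr}\,\bar R)\,\mathrm{Id}$$ (when $n=1$ the fibres of $V$ are zero and the factors $\tfrac1{n-1}$ are read as $0$). Then $b$, $\theta$ and $\bar\sigma$ are differentiable along each generator of $H$, and $$b'=-\bar R-b^2+\kappa\,b,$$ $$\theta'=-Ric(\mathsf n)-\sigma^2-\frac{1}{n-1}\,\theta^2+\kappa\,\theta,$$ $$\bar\sigma'=-\bar C-\Big(\bar\sigma^2-\frac1{n-1}(\mathrm{tr}\,\bar\sigma^2)\,\mathrm{Id}\Big)-\frac{2}{n-1}\,\theta\,\bar\sigma+\kappa\,\bar\sigma .$$ -/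

import Mathlib

open scoped Manifold ContDiff Topology

noncomputable section

namespace LorentzFinsler

/-! ### Expressions in a chart

`f : E × E → ℝ` is the coordinate expression `(x, v) ↦ 𝓛(x, v)` of a Finsler Lagrangian. -/

section Local

variable {E : Type*} [NormedAddCommGroup E] [NormedSpace ℝ E]

/-- The Finsler metric `g_{μν}(x, v) = ∂²𝓛 / ∂v^μ ∂v^ν`. -/
def localMetric (f : E × E → ℝ) (z : E × E) : E →L[ℝ] E →L[ℝ] ℝ :=
  fderiv ℝ (fun w => fderiv ℝ (fun u => f (z.1, u)) w) z.2

/-- The covector `w^δ ↦ (∂²𝓛 / ∂x^γ ∂v^δ v^γ - ∂𝓛 / ∂x^δ) w^δ`. -/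
def localForce (f : E × E → ℝ) (z : E × E) : E →L[ℝ] ℝ :=
  fderiv ℝ (fun y => fderiv ℝ (fun u => f (y, u)) z.2) z.1 z.2 - fderiv ℝ (fun y => f (y, z.2)) z.1

/-- The spray coefficients `G^α`, `2 G^α = g^{αδ} (∂²𝓛 / ∂x^γ ∂v^δ v^γ - ∂𝓛 / ∂x^δ)`. -/
def localSpray (f : E × E → ℝ) (z : E × E) : E :=
  (1 / 2 : ℝ) • (localMetric f z).inverse (localForce f z)

/-- The non-linear connection `X^α ↦ N^μ_α(x, v) X^α`, `N^μ_α = ∂G^μ / ∂v^α`. -/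
def localConn (f : E × E → ℝ) (z : E × E) : E →L[ℝ] E :=
  fderiv ℝ (fun w => localSpray f (z.1, w)) z.2

/-- `(X, Y) ↦ X^α (δN^μ_β / δx^α) Y^β`, where `δ/δx^α = ∂/∂x^α - N^ν_α(x, v) ∂/∂v^ν`. -/
def localHorizDerivConn (f : E × E → ℝ) (z : E × E) : E →L[ℝ] E →L[ℝ] E :=
  fderiv ℝ (fun y => localConn f (y, z.2)) z.1
    - (fderiv ℝ (fun w => localConn f (z.1, w)) z.2).comp (localConn f z)

/-- The curvature of the non-linear connection contracted with `v`:
`R_v(X)^μ = (δN^μ_β / δx^α - δN^μ_α / δx^β) X^α v^β`. -/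
def localCurvature (f : E × E → ℝ) (z : E × E) : E →L[ℝ] E :=
  (localHorizDerivConn f z).flip z.2 - localHorizDerivConn f z z.2

end Local

/-- A bilinear form of signature `(-, +, …, +)`: some vector is negative, and the form is positive
definite on the orthogonal complement of that vector. -/
def IsLorentzian {E : Type*} [NormedAddCommGroup E] [NormedSpace ℝ E]
    (B : E →L[ℝ] E →L[ℝ] ℝ) : Prop :=
  ∃ u : E, B u u < 0 ∧ ∀ w : E, w ≠ 0 → B u w = 0 → 0 < B w w

/-! ### Lorentz–Finsler manifolds -/

section Manifold

variable {E : Type*} [NormedAddCommGroup E] [NormedSpace ℝ E]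
  {M : Type*} [TopologicalSpace M] [ChartedSpace E M] [IsManifold 𝓘(ℝ, E) ∞ M]

/-- The metric `g_v` on `T_p M`: the Hessian at `v` of the restriction of `𝓛` to `T_p M`. -/
def metric (L : TangentBundle 𝓘(ℝ, E) M → ℝ) (p : M) (v : TangentSpace 𝓘(ℝ, E) p) :
    E →L[ℝ] E →L[ℝ] ℝ :=
  fderiv ℝ (fun w : E => fderiv ℝ (fun u : E => L ⟨p, u⟩) w) v

/-- `L` (its values on the zero section are irrelevant) is a Lorentz–Finsler Lagrangian on the slit
tangent bundle. -/
structure IsLorentzFinsler (L : TangentBundle 𝓘(ℝ, E) M → ℝ) : Prop where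
  contMDiffOn : ContMDiffOn 𝓘(ℝ, E).tangent 𝓘(ℝ, ℝ) 4 L {z | z.2 ≠ 0}
  homogeneous : ∀ (p : M) (v : TangentSpace 𝓘(ℝ, E) p), v ≠ 0 → ∀ s : ℝ, 0 < s →
    L ⟨p, s • v⟩ = s ^ 2 * L ⟨p, v⟩
  lorentzian : ∀ (p : M) (v : TangentSpace 𝓘(ℝ, E) p), v ≠ 0 → IsLorentzian (metric L p v)

/-- The expression of `L` in the chart of `TM` induced by the preferred chart of `M` at `p`.
In this chart `T_p M` is identified with `E` as in the definition of `TangentSpace`. -/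
def inChart (L : TangentBundle 𝓘(ℝ, E) M → ℝ) (p : M) : E × E → ℝ :=
  fun z => L ((extChartAt 𝓘(ℝ, E).tangent (⟨p, 0⟩ : TangentBundle 𝓘(ℝ, E) M)).symm z)

/-- The velocity components of a tangent vector in the chart of `TM` induced by the preferred chart
of `M` at `p`. -/
def components (p : M) (z : TangentBundle 𝓘(ℝ, E) M) : E :=
  (extChartAt 𝓘(ℝ, E).tangent (⟨p, 0⟩ : TangentBundle 𝓘(ℝ, E) M) z).2

/-- The coefficients `N^α_μ(p, v)` of the non-linear connection in the preferred chart at `p`. -/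
def conn (L : TangentBundle 𝓘(ℝ, E) M → ℝ) (p : M) (v : TangentSpace 𝓘(ℝ, E) p) :
    TangentSpace 𝓘(ℝ, E) p →L[ℝ] TangentSpace 𝓘(ℝ, E) p :=
  (localConn (inChart L p) (extChartAt 𝓘(ℝ, E) p p, v) : E →L[ℝ] E)

/-- The curvature endomorphism `R_v : T_p M → T_p M`, computed in the preferred chart at `p`. -/
def curvature (L : TangentBundle 𝓘(ℝ, E) M → ℝ) (p : M) (v : TangentSpace 𝓘(ℝ, E) p) :
    TangentSpace 𝓘(ℝ, E) p →L[ℝ] TangentSpace 𝓘(ℝ, E) p :=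
  (localCurvature (inChart L p) (extChartAt 𝓘(ℝ, E) p p, v) : E →L[ℝ] E)

/-- `Ric(v) = tr R_v`. -/
def ricci (L : TangentBundle 𝓘(ℝ, E) M → ℝ) (p : M) (v : TangentSpace 𝓘(ℝ, E) p) : ℝ :=
  LinearMap.trace ℝ (TangentSpace 𝓘(ℝ, E) p) (curvature L p v).toLinearMap

/-- `W = D̃_u Z` at `t₀`, where `Z` is a vector field along the curve `c` and `u` is the velocity
of `c` at `t₀`: in coordinates, `Z` is differentiable at `t₀` and `W^α = dZ^α/dt + N^α_μ(u) Z^μ`. -/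
def HasFlippedDerivAt (L : TangentBundle 𝓘(ℝ, E) M → ℝ) (c : ℝ → M) (t₀ : ℝ)
    (u : TangentSpace 𝓘(ℝ, E) (c t₀)) (Z : ∀ t, TangentSpace 𝓘(ℝ, E) (c t))
    (W : TangentSpace 𝓘(ℝ, E) (c t₀)) : Prop :=
  HasDerivAt (F := E) (fun t => components (c t₀) (⟨c t, Z t⟩ : TangentBundle 𝓘(ℝ, E) M))
    (W - conn L (c t₀) u (Z t₀)) t₀

end Manifold

/-- The endomorphism of `T / ⟨v⟩` induced by the map `A : T → T'`, where `T` is regarded as a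
subspace of `T'` through the injection `J`: the class of `X` goes to the class of `A X`.
It is well defined if `A` takes values in `T` and maps `v` to a multiple of `v`; otherwise it is
given the value `0`. -/
def inducedEnd {T T' : Type*} [AddCommGroup T] [Module ℝ T] [AddCommGroup T'] [Module ℝ T']
    (J A : T →ₗ[ℝ] T') (v : T) :
    (T ⧸ Submodule.span ℝ {v}) →ₗ[ℝ] (T ⧸ Submodule.span ℝ {v}) :=
  open Classical in
  if h : ∃ B : T →ₗ[ℝ] T, J ∘ₗ B = A ∧
      Submodule.span ℝ {v} ≤ (Submodule.span ℝ {v}).comap B then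
    Submodule.mapQ _ _ h.choose h.choose_spec.2
  else 0

/-! ### Null hypersurfaces

A hypersurface is an immersion `ι : S → M` of a manifold `S` of one dimension less, and `T_s S` is
regarded as a subspace of `T_{ι s} M` through `dι`. -/

section Hypersurface

variable {E : Type*} [NormedAddCommGroup E] [NormedSpace ℝ E]
  {M : Type*} [TopologicalSpace M] [ChartedSpace E M] [IsManifold 𝓘(ℝ, E) ∞ M]
  {F : Type*} [NormedAddCommGroup F] [NormedSpace ℝ F]
  {S : Type*} [TopologicalSpace S] [ChartedSpace F S] [IsManifold 𝓘(ℝ, F) 2 S]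

/-- The vector field `n = dι(N)` along `ι`, for a vector field `N` on `S`. -/
def push (ι : S → M) (N : ∀ s : S, TangentSpace 𝓘(ℝ, F) s) (s : S) :
    TangentSpace 𝓘(ℝ, E) (ι s) :=
  mfderiv 𝓘(ℝ, F) 𝓘(ℝ, E) ι s (N s)

/-- The covariant derivative `T_s S → T_{ι s} M`, `X ↦ D_X n`, of a vector field `n` along `ι`:
`(D_X n)^α = ∂_X n^α + N^α_μ(n) X^μ` in the preferred chart of `M` at `ι s`. -/
def covDeriv (L : TangentBundle 𝓘(ℝ, E) M → ℝ) (ι : S → M)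
    (n : ∀ s : S, TangentSpace 𝓘(ℝ, E) (ι s)) (s : S) :
    TangentSpace 𝓘(ℝ, F) s →L[ℝ] TangentSpace 𝓘(ℝ, E) (ι s) :=
  let dn : TangentSpace 𝓘(ℝ, F) s →L[ℝ] TangentSpace 𝓘(ℝ, E) (ι s) :=
    mfderiv 𝓘(ℝ, F) 𝓘(ℝ, E)
      (fun s' => components (ι s) (⟨ι s', n s'⟩ : TangentBundle 𝓘(ℝ, E) M)) s
  dn + (conn L (ι s) (n s)).comp (mfderiv 𝓘(ℝ, F) 𝓘(ℝ, E) ι s)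

/-- `ι` is a `C²` null hypersurface and `N` is a `C¹` vector field on it which is nowhere zero and
lightlike: with `n = dι(N)`, `g_n(n, n) = 0` and `T_s S = ker g_n(n, ·)`. -/
structure IsNullHypersurface (L : TangentBundle 𝓘(ℝ, E) M → ℝ) (ι : S → M)
    (N : ∀ s : S, TangentSpace 𝓘(ℝ, F) s) : Prop where
  contMDiff : ContMDiff 𝓘(ℝ, F) 𝓘(ℝ, E) 2 ι
  immersion : ∀ s, Function.Injective (mfderiv 𝓘(ℝ, F) 𝓘(ℝ, E) ι s)
  contMDiff_field : ContMDiff 𝓘(ℝ, F) 𝓘(ℝ, F).tangent 1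
    (fun s => (⟨s, N s⟩ : TangentBundle 𝓘(ℝ, F) S))
  ne_zero : ∀ s, N s ≠ 0
  lightlike : ∀ s, metric L (ι s) (push (E := E) ι N s) (push (E := E) ι N s)
    (push (E := E) ι N s) = 0
  tangent : ∀ (s : S) (w : TangentSpace 𝓘(ℝ, E) (ι s)),
    w ∈ Set.range (mfderiv 𝓘(ℝ, F) 𝓘(ℝ, E) ι s) ↔
      metric L (ι s) (push (E := E) ι N s) (push (E := E) ι N s) w = 0

/-- The fibre `V_s = T_s S / ⟨N⟩`. -/
abbrev Fibre (N : ∀ s : S, TangentSpace 𝓘(ℝ, F) s) (s : S) : Type _ :=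
  TangentSpace 𝓘(ℝ, F) s ⧸ Submodule.span ℝ {N s}

/-- The class `X̄` in `V_s` of a vector `X ∈ T_s S`. -/
def toFibre (N : ∀ s : S, TangentSpace 𝓘(ℝ, F) s) (s : S) (X : TangentSpace 𝓘(ℝ, F) s) :
    Fibre N s :=
  Submodule.Quotient.mk X

/-- The null Weingarten map `b : V_s → V_s`, the class of `X` going to the class of `D_X n`. -/
def weingarten (L : TangentBundle 𝓘(ℝ, E) M → ℝ) (ι : S → M)
    (N : ∀ s : S, TangentSpace 𝓘(ℝ, F) s) (s : S) : Fibre N s →ₗ[ℝ] Fibre N s :=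
  inducedEnd (mfderiv 𝓘(ℝ, F) 𝓘(ℝ, E) ι s).toLinearMap (covDeriv L ι (push ι N) s).toLinearMap (N s)

/-- `R̄ : V_s → V_s`, the class of `X` going to the class of `R_n(X)`. -/
def curvatureBar (L : TangentBundle 𝓘(ℝ, E) M → ℝ) (ι : S → M)
    (N : ∀ s : S, TangentSpace 𝓘(ℝ, F) s) (s : S) : Fibre N s →ₗ[ℝ] Fibre N s :=
  inducedEnd (mfderiv 𝓘(ℝ, F) 𝓘(ℝ, E) ι s).toLinearMap
    ((curvature L (ι s) (push ι N s)).comp (mfderiv 𝓘(ℝ, F) 𝓘(ℝ, E) ι s)).toLinearMap (N s)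

/-- `C̄ = R̄ - (1 / k) (tr R̄) Id`, with `k` the dimension of the fibres of `V`. -/
def weylBar (L : TangentBundle 𝓘(ℝ, E) M → ℝ) (ι : S → M)
    (N : ∀ s : S, TangentSpace 𝓘(ℝ, F) s) (k : ℝ) (s : S) : Fibre N s →ₗ[ℝ] Fibre N s :=
  curvatureBar L ι N s
    - (1 / k * LinearMap.trace ℝ (Fibre N s) (curvatureBar L ι N s)) • LinearMap.id

/-- The expansion `θ = tr b`. -/
def expansion (L : TangentBundle 𝓘(ℝ, E) M → ℝ) (ι : S → M)
    (N : ∀ s : S, TangentSpace 𝓘(ℝ, F) s) (s : S) : ℝ :=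
  LinearMap.trace ℝ (Fibre N s) (weingarten L ι N s)

/-- The shear `σ̄ = b - (1 / k) θ Id`, with `k` the dimension of the fibres of `V`. -/
def shear (L : TangentBundle 𝓘(ℝ, E) M → ℝ) (ι : S → M)
    (N : ∀ s : S, TangentSpace 𝓘(ℝ, F) s) (k : ℝ) (s : S) : Fibre N s →ₗ[ℝ] Fibre N s :=
  weingarten L ι N s - (1 / k * expansion L ι N s) • LinearMap.id

/-- `σ² = tr σ̄²`. -/
def shearSq (L : TangentBundle 𝓘(ℝ, E) M → ℝ) (ι : S → M)
    (N : ∀ s : S, TangentSpace 𝓘(ℝ, F) s) (k : ℝ) (s : S) : ℝ :=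
  LinearMap.trace ℝ (Fibre N s) (shear L ι N k s ∘ₗ shear L ι N k s)

/-- `X̄' = Z` at `t₀`, for a section `X̄` of `V` along the generator `γ`: the section lifts, near
`t₀`, to a vector field `X` along `γ` tangent to `S`, differentiable at `t₀`, such that `D̃_n X` is
tangent to `S` and of class `Z`. -/
def HasSectionDerivAt (L : TangentBundle 𝓘(ℝ, E) M → ℝ) (ι : S → M)
    (N : ∀ s : S, TangentSpace 𝓘(ℝ, F) s) (γ : ℝ → S) (t₀ : ℝ)
    (Xbar : ∀ t, Fibre N (γ t)) (Z : Fibre N (γ t₀)) : Prop :=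
  ∃ (X : ∀ t, TangentSpace 𝓘(ℝ, F) (γ t)) (Y : TangentSpace 𝓘(ℝ, F) (γ t₀)),
    (∀ᶠ t in 𝓝 t₀, toFibre N (γ t) (X t) = Xbar t) ∧ toFibre N (γ t₀) Y = Z ∧
    HasFlippedDerivAt L (fun t => ι (γ t)) t₀ (push ι N (γ t₀))
      (fun t => mfderiv 𝓘(ℝ, F) 𝓘(ℝ, E) ι (γ t) (X t)) (mfderiv 𝓘(ℝ, F) 𝓘(ℝ, E) ι (γ t₀) Y)

/-- `B' = B₁` at `t₀` along the generator `γ`, for a field `B` of endomorphisms of `V`: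
`B'(X̄) = (B(X̄))' - B(X̄')` for every section `X̄` of `V` along `γ` differentiable at `t₀`; the
existence of `(B(X̄))'` is part of the assertion. -/
def HasEndDerivAt (L : TangentBundle 𝓘(ℝ, E) M → ℝ) (ι : S → M)
    (N : ∀ s : S, TangentSpace 𝓘(ℝ, F) s) (γ : ℝ → S) (t₀ : ℝ)
    (B : ∀ s, Fibre N s →ₗ[ℝ] Fibre N s) (B₁ : Fibre N (γ t₀) →ₗ[ℝ] Fibre N (γ t₀)) : Prop :=
  ∀ (Xbar : ∀ t, Fibre N (γ t)) (Z : Fibre N (γ t₀)),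
    HasSectionDerivAt L ι N γ t₀ Xbar Z →
    HasSectionDerivAt L ι N γ t₀ (fun t => B (γ t) (Xbar t))
      (B₁ (Xbar t₀) + B (γ t₀) Z)

end Hypersurface

end LorentzFinsler

end

open LorentzFinsler

open scoped Manifold ContDiff Topology
noncomputable section
namespace LorentzFinsler

/-! ### Partial derivatives on a product -/

section Partial

variable {E : Type*} [NormedAddCommGroup E] [NormedSpace ℝ E]
  {X : Type*} [NormedAddCommGroup X] [NormedSpace ℝ X]

/-! Formally the Riccati equation is a commutation identity: differentiating `D n` along `n` and
using `D_n n = κ n` produces `-R_n - (D n)² + κ D n` modulo `n`. The difficulty is regularity. The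
field `n` is only C¹, so `D n` is merely continuous and cannot be differentiated outright.

The remedy is to normalize. With a fixed covector `α` such that `α(n) = 1` at the base point, let
`n̂ = n / α(n)`. Applying `α` to the geodesic equation eliminates `κ` and expresses the derivative
of `n̂` along `n` through `n`, `n̂` and the spray alone (`normalizedAccel_eq`), so that this
derivative is again C¹. If a C¹ map has a C¹ derivative along a C¹ vector field, its differential is
differentiable along the integral curves of that field (`hasDerivAt_fderiv_apply_of_integralCurve`).
Hence `α(n) D n̂` is differentiable along generators. By homogeneity of the connection it agrees
with `D n` modulo `n`, so it induces the same Weingarten map, and its derivative is computed in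
`deriv_normalizedCovDeriv` and `exists_riccati`.

Two orthogonality facts keep everything tangent to the hypersurface: the Lagrangian is horizontally
constant (`fderiv_horizontal`), and `R_v` takes values orthogonal to `v`
(`localMomentum_localCurvature`).

To pass to `V`, the bundle is written along a generator as a quotient of a fixed space `F` by a
moving line. There the derivative of sections becomes `ξ' + D ξ` with `D = β(t₀) - dN`, where `β`
induces `b`, and the derivative of `b` is induced by `β' + [D, β]`. Traces on the quotient are
traces on `F` minus the eigenvalue on the line (`hasDerivAt_trace`). This gives the Raychaudhuri
equation as the trace of the Riccati equation, and the shear equation as its trace-free part.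
Transformation laws under changes of charts are needed because `covDeriv` is defined at each point
in the preferred chart of that point. -/

theorem fderiv_partial_snd {g : E × E → X} {z : E × E} (hg : DifferentiableAt ℝ g z) :
    fderiv ℝ (fun u => g (z.1, u)) z.2 = (fderiv ℝ g z).comp (ContinuousLinearMap.inr ℝ E E) :=
  (HasFDerivAt.comp z.2 (g := g) (f := fun u => (z.1, u)) hg.hasFDerivAt
    (hasFDerivAt_prodMk_right z.1 z.2)).fderiv

theorem fderiv_partial_fst {g : E × E → X} {z : E × E} (hg : DifferentiableAt ℝ g z) :
    fderiv ℝ (fun y => g (y, z.2)) z.1 = (fderiv ℝ g z).comp (ContinuousLinearMap.inl ℝ E E) :=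
  (HasFDerivAt.comp z.1 (g := g) (f := fun y => (y, z.2)) hg.hasFDerivAt
    (hasFDerivAt_prodMk_left z.1 z.2)).fderiv

theorem differentiableAt_partial_snd {g : E × E → X} {z : E × E} (hg : DifferentiableAt ℝ g z) :
    DifferentiableAt ℝ (fun u => g (z.1, u)) z.2 :=
  DifferentiableAt.comp z.2 (g := g) (f := fun u => (z.1, u)) hg
    (hasFDerivAt_prodMk_right z.1 z.2).differentiableAt

theorem differentiableAt_partial_fst {g : E × E → X} {z : E × E} (hg : DifferentiableAt ℝ g z) :
    DifferentiableAt ℝ (fun y => g (y, z.2)) z.1 :=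
  DifferentiableAt.comp z.1 (g := g) (f := fun y => (y, z.2)) hg
    (hasFDerivAt_prodMk_left z.1 z.2).differentiableAt

/-- Euler's theorem for positively homogeneous functions. -/
theorem fderiv_apply_self_of_homogeneous {h : E → X} {v : E} {k : ℕ} (hd : DifferentiableAt ℝ h v)
    (hh : ∀ s : ℝ, 0 < s → h (s • v) = s ^ k • h v) : fderiv ℝ h v v = (k : ℝ) • h v := by
  have h1 : HasDerivAt (fun s : ℝ => h (s • v)) (fderiv ℝ h v v) 1 := by
    have hs : HasDerivAt (fun s : ℝ => s • v) v 1 := by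
      simpa using (hasDerivAt_id (1 : ℝ)).smul_const v
    have hd' : HasFDerivAt h (fderiv ℝ h v) ((1 : ℝ) • v) := by
      rw [one_smul]; exact hd.hasFDerivAt
    exact hd'.comp_hasDerivAt (1 : ℝ) hs
  have h2 : HasDerivAt (fun s : ℝ => s ^ k • h v) ((k : ℝ) • h v) 1 := by
    simpa using (hasDerivAt_pow k (1 : ℝ)).smul_const (h v)
  refine h1.unique (h2.congr_of_eventuallyEq ?_)
  filter_upwards [lt_mem_nhds (zero_lt_one : (0 : ℝ) < 1)] with s h0 using hh s h0

/-- The derivative of a homogeneous function is homogeneous, of one degree less. -/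
theorem fderiv_smul_of_homogeneous {h h' : E → X} {v : E} {c s : ℝ}
    (hh : ∀ᶠ w in 𝓝 v, h (s • w) = c • h' w) (hd' : DifferentiableAt ℝ h' v) :
    s • fderiv ℝ h (s • v) = c • fderiv ℝ h' v := by
  rw [← fderiv_comp_smul, ← fderiv_const_smul hd']
  exact Filter.EventuallyEq.fderiv_eq hh

end Partial

/-! ### Local Finsler geometry -/

section Local

variable {E : Type*} [NormedAddCommGroup E] [NormedSpace ℝ E]

/-- `f` is the coordinate expression of a non-degenerate Finsler Lagrangian over the open set `U` of
a chart. -/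
structure IsLocalFinsler (f : E × E → ℝ) (U : Set E) : Prop where
  isOpen : IsOpen U
  contDiffOn : ContDiffOn ℝ 4 f (U ×ˢ {0}ᶜ)
  homogeneous : ∀ x ∈ U, ∀ v : E, v ≠ 0 → ∀ s : ℝ, 0 < s → f (x, s • v) = s ^ 2 * f (x, v)
  invertible : ∀ z ∈ U ×ˢ {(0 : E)}ᶜ, (localMetric f z).IsInvertible

/-- The fibre derivative `∂𝓛 / ∂v^μ`. -/
def localMomentum (f : E × E → ℝ) (z : E × E) : E →L[ℝ] ℝ :=
  (fderiv ℝ f z).comp (ContinuousLinearMap.inr ℝ E E)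

theorem mem_slit_smul {U : Set E} {z : E × E} (hz : z ∈ U ×ˢ ({0}ᶜ : Set E)) {s : ℝ} (hs : 0 < s) :
    (z.1, s • z.2) ∈ U ×ˢ ({0}ᶜ : Set E) :=
  ⟨hz.1, smul_ne_zero hs.ne' hz.2⟩

namespace IsLocalFinsler

variable {f : E × E → ℝ} {U : Set E} (hf : IsLocalFinsler f U) {z : E × E}
include hf

theorem isOpen_slit : IsOpen (U ×ˢ ({0}ᶜ : Set E)) :=
  hf.isOpen.prod isOpen_compl_singleton

theorem eventually_mem (hz : z ∈ U ×ˢ ({0}ᶜ : Set E)) : ∀ᶠ z' in 𝓝 z, z' ∈ U ×ˢ ({0}ᶜ : Set E) :=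
  hf.isOpen_slit.mem_nhds hz

theorem contDiffAt (hz : z ∈ U ×ˢ ({0}ᶜ : Set E)) : ContDiffAt ℝ 4 f z :=
  hf.contDiffOn.contDiffAt (hf.isOpen_slit.mem_nhds hz)

theorem differentiableAt (hz : z ∈ U ×ˢ ({0}ᶜ : Set E)) : DifferentiableAt ℝ f z :=
  (hf.contDiffAt hz).differentiableAt (by norm_num)

theorem contDiffAt_momentum (hz : z ∈ U ×ˢ ({0}ᶜ : Set E)) :
    ContDiffAt ℝ 3 (localMomentum f) z :=
  ((hf.contDiffAt hz).fderiv_right (m := 3) (by norm_num)).clm_comp contDiffAt_const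

theorem differentiableAt_momentum (hz : z ∈ U ×ˢ ({0}ᶜ : Set E)) :
    DifferentiableAt ℝ (localMomentum f) z :=
  (hf.contDiffAt_momentum hz).differentiableAt (by norm_num)

theorem fderiv_snd (hz : z ∈ U ×ˢ ({0}ᶜ : Set E)) :
    fderiv ℝ (fun u => f (z.1, u)) z.2 = localMomentum f z :=
  fderiv_partial_snd (hf.differentiableAt hz)

theorem localMetric_eq (hz : z ∈ U ×ˢ ({0}ᶜ : Set E)) :
    localMetric f z = (fderiv ℝ (localMomentum f) z).comp (ContinuousLinearMap.inr ℝ E E) := by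
  rw [localMetric, ← fderiv_partial_snd (hf.differentiableAt_momentum hz)]
  apply Filter.EventuallyEq.fderiv_eq
  filter_upwards [isOpen_compl_singleton.mem_nhds hz.2] with w hw
  exact hf.fderiv_snd (z := (z.1, w)) ⟨hz.1, hw⟩

theorem localForce_eq (hz : z ∈ U ×ˢ ({0}ᶜ : Set E)) :
    localForce f z = fderiv ℝ (localMomentum f) z (z.2, 0)
      - (fderiv ℝ f z).comp (ContinuousLinearMap.inl ℝ E E) := by
  have h : fderiv ℝ (fun y => fderiv ℝ (fun u => f (y, u)) z.2) z.1
      = fderiv ℝ (fun y => localMomentum f (y, z.2)) z.1 := by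
    apply Filter.EventuallyEq.fderiv_eq
    filter_upwards [hf.isOpen.mem_nhds hz.1] with y hy
    exact hf.fderiv_snd (z := (y, z.2)) ⟨hy, hz.2⟩
  rw [localForce, fderiv_partial_fst (hf.differentiableAt hz), h,
    fderiv_partial_fst (hf.differentiableAt_momentum hz)]
  rfl

theorem contDiffAt_localMetric (hz : z ∈ U ×ˢ ({0}ᶜ : Set E)) :
    ContDiffAt ℝ 2 (localMetric f) z := by
  refine (((hf.contDiffAt_momentum hz).fderiv_right (m := 2) (by norm_num)).clm_comp
    contDiffAt_const).congr_of_eventuallyEq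
      (f := fun z => (fderiv ℝ (localMomentum f) z).comp (ContinuousLinearMap.inr ℝ E E)) ?_
  filter_upwards [hf.eventually_mem hz] with z' hz' using hf.localMetric_eq hz'

theorem contDiffAt_localForce (hz : z ∈ U ×ˢ ({0}ᶜ : Set E)) :
    ContDiffAt ℝ 2 (localForce f) z := by
  have h1 : ContDiffAt ℝ 2 (fun z : E × E => fderiv ℝ (localMomentum f) z (z.2, 0)) z :=
    ((hf.contDiffAt_momentum hz).fderiv_right (m := 2) (by norm_num)).clm_apply
      (contDiffAt_snd.prodMk contDiffAt_const)
  have h2 : ContDiffAt ℝ 2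
      (fun z : E × E => (fderiv ℝ f z).comp (ContinuousLinearMap.inl ℝ E E)) z :=
    ((hf.contDiffAt hz).fderiv_right (m := 2) (by norm_num)).clm_comp contDiffAt_const
  refine (h1.sub h2).congr_of_eventuallyEq ?_
  filter_upwards [hf.eventually_mem hz] with z' hz' using hf.localForce_eq hz'

/-- Two derivatives of the C⁴ Lagrangian are spent on the metric and the force, and inversion is
smooth at invertible operators. The connection is then C¹ and can be differentiated once more, as
the curvature requires. -/
theorem contDiffAt_localSpray [CompleteSpace E] (hz : z ∈ U ×ˢ ({0}ᶜ : Set E)) :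
    ContDiffAt ℝ 2 (localSpray f) z := by
  have h : ContDiffAt ℝ 2 (fun z => (localMetric f z).inverse) z :=
    ((hf.invertible z hz).contDiffAt_map_inverse (n := 2)).comp z (hf.contDiffAt_localMetric hz)
  exact contDiffAt_const.smul (h.clm_apply (hf.contDiffAt_localForce hz))

theorem localConn_eq [CompleteSpace E] (hz : z ∈ U ×ˢ ({0}ᶜ : Set E)) :
    localConn f z = (fderiv ℝ (localSpray f) z).comp (ContinuousLinearMap.inr ℝ E E) :=
  fderiv_partial_snd ((hf.contDiffAt_localSpray hz).differentiableAt (by norm_num))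

theorem contDiffAt_localConn [CompleteSpace E] (hz : z ∈ U ×ˢ ({0}ᶜ : Set E)) :
    ContDiffAt ℝ 1 (localConn f) z := by
  refine (((hf.contDiffAt_localSpray hz).fderiv_right (m := 1) (by norm_num)).clm_comp
    contDiffAt_const).congr_of_eventuallyEq
      (f := fun z => (fderiv ℝ (localSpray f) z).comp (ContinuousLinearMap.inr ℝ E E)) ?_
  filter_upwards [hf.eventually_mem hz] with z' hz' using hf.localConn_eq hz'

theorem differentiableAt_localSpray [CompleteSpace E] (hz : z ∈ U ×ˢ ({0}ᶜ : Set E)) :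
    DifferentiableAt ℝ (localSpray f) z :=
  (hf.contDiffAt_localSpray hz).differentiableAt (by norm_num)

theorem differentiableAt_localConn [CompleteSpace E] (hz : z ∈ U ×ˢ ({0}ᶜ : Set E)) :
    DifferentiableAt ℝ (localConn f) z :=
  (hf.contDiffAt_localConn hz).differentiableAt (by norm_num)

/-- Makes `δ/δx` a single total derivative in the horizontal direction `(X, -N X)`, so that the
chain rule and the symmetry of second derivatives on `E × E` become available. -/
theorem localHorizDerivConn_apply [CompleteSpace E] (hz : z ∈ U ×ˢ ({0}ᶜ : Set E)) (X : E) :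
    localHorizDerivConn f z X = fderiv ℝ (localConn f) z (X, - localConn f z X) := by
  rw [localHorizDerivConn, fderiv_partial_fst (hf.differentiableAt_localConn hz),
    fderiv_partial_snd (hf.differentiableAt_localConn hz)]
  have : (X, - localConn f z X) = (X, (0 : E)) - (0, localConn f z X) := by simp
  rw [this, map_sub]
  rfl

/-! ### Homogeneity -/

/-- Each fibre derivative lowers the degree by one: 2 for `f`, 1 for the momentum, 0 for the metric;
then 2 for the spray and 1 for the connection. -/
theorem localMomentum_smul (hz : z ∈ U ×ˢ ({0}ᶜ : Set E)) {s : ℝ} (hs : 0 < s) :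
    localMomentum f (z.1, s • z.2) = s • localMomentum f z := by
  have h := fderiv_smul_of_homogeneous (h := fun u => f (z.1, u)) (h' := fun u => f (z.1, u))
    (v := z.2) (c := s ^ 2) (by
      filter_upwards [isOpen_compl_singleton.mem_nhds hz.2] with w hw
      simpa using hf.homogeneous z.1 hz.1 w hw s hs)
    (differentiableAt_partial_snd (hf.differentiableAt hz))
  rw [hf.fderiv_snd hz, hf.fderiv_snd (mem_slit_smul hz hs), sq, mul_smul] at h
  exact smul_right_injective _ hs.ne' h

theorem localMetric_smul (hz : z ∈ U ×ˢ ({0}ᶜ : Set E)) {s : ℝ} (hs : 0 < s) :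
    localMetric f (z.1, s • z.2) = localMetric f z := by
  have h := fderiv_smul_of_homogeneous (h := fun u => localMomentum f (z.1, u))
    (h' := fun u => localMomentum f (z.1, u)) (v := z.2) (c := s) (by
      filter_upwards [isOpen_compl_singleton.mem_nhds hz.2] with w hw
      exact hf.localMomentum_smul (z := (z.1, w)) ⟨hz.1, hw⟩ hs)
    (differentiableAt_partial_snd (hf.differentiableAt_momentum hz))
  have h' := fderiv_partial_snd (hf.differentiableAt_momentum (mem_slit_smul hz hs))
  rw [fderiv_partial_snd (hf.differentiableAt_momentum hz), h', ← hf.localMetric_eq hz,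
    ← hf.localMetric_eq (mem_slit_smul hz hs)] at h
  exact smul_right_injective _ hs.ne' h

theorem localForce_smul (hz : z ∈ U ×ˢ ({0}ᶜ : Set E)) {s : ℝ} (hs : 0 < s) :
    localForce f (z.1, s • z.2) = s ^ 2 • localForce f z := by
  have h1 : fderiv ℝ (fun y => f (y, s • z.2)) z.1 = s ^ 2 • fderiv ℝ (fun y => f (y, z.2)) z.1 := by
    rw [← fderiv_const_smul (differentiableAt_partial_fst (hf.differentiableAt hz))]
    apply Filter.EventuallyEq.fderiv_eq
    filter_upwards [hf.isOpen.mem_nhds hz.1] with y hy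
    exact hf.homogeneous y hy z.2 hz.2 s hs
  have h2 : fderiv ℝ (fun y => localMomentum f (y, s • z.2)) z.1
      = s • fderiv ℝ (fun y => localMomentum f (y, z.2)) z.1 := by
    rw [← fderiv_const_smul (differentiableAt_partial_fst (hf.differentiableAt_momentum hz))]
    apply Filter.EventuallyEq.fderiv_eq
    filter_upwards [hf.isOpen.mem_nhds hz.1] with y hy
    exact hf.localMomentum_smul (z := (y, z.2)) ⟨hy, hz.2⟩ hs
  have h3 : ∀ w ∈ ({0}ᶜ : Set E), fderiv ℝ (fun y => fderiv ℝ (fun u => f (y, u)) w) z.1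
      = fderiv ℝ (fun y => localMomentum f (y, w)) z.1 := by
    intro w hw
    apply Filter.EventuallyEq.fderiv_eq
    filter_upwards [hf.isOpen.mem_nhds hz.1] with y hy
    exact hf.fderiv_snd (z := (y, w)) ⟨hy, hw⟩
  simp only [localForce]
  rw [h3 _ hz.2, h3 _ (smul_ne_zero hs.ne' hz.2), h1, h2, smul_sub, sq, mul_smul, mul_smul]
  simp

theorem localSpray_smul (hz : z ∈ U ×ˢ ({0}ᶜ : Set E)) {s : ℝ} (hs : 0 < s) :
    localSpray f (z.1, s • z.2) = s ^ 2 • localSpray f z := by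
  rw [localSpray, localSpray, hf.localMetric_smul hz hs, hf.localForce_smul hz hs, map_smul,
    smul_comm]

theorem localConn_smul [CompleteSpace E] (hz : z ∈ U ×ˢ ({0}ᶜ : Set E)) {s : ℝ} (hs : 0 < s) :
    localConn f (z.1, s • z.2) = s • localConn f z := by
  have h := fderiv_smul_of_homogeneous (h := fun u => localSpray f (z.1, u))
    (h' := fun u => localSpray f (z.1, u)) (v := z.2) (c := s ^ 2) (by
      filter_upwards [isOpen_compl_singleton.mem_nhds hz.2] with w hw
      exact hf.localSpray_smul (z := (z.1, w)) ⟨hz.1, hw⟩ hs)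
    (differentiableAt_partial_snd (hf.differentiableAt_localSpray hz))
  rw [sq, mul_smul] at h
  exact smul_right_injective _ hs.ne' h

theorem localMomentum_self (hz : z ∈ U ×ˢ ({0}ᶜ : Set E)) :
    localMomentum f z z.2 = 2 * f z := by
  have h := fderiv_apply_self_of_homogeneous (h := fun u => f (z.1, u)) (v := z.2) (k := 2)
    (differentiableAt_partial_snd (hf.differentiableAt hz))
    (fun s hs => hf.homogeneous z.1 hz.1 z.2 hz.2 s hs)
  rw [hf.fderiv_snd hz] at h
  simpa using h

/-- Euler's relation in degree one. It replaces `ker g_v(v, ·)` by the kernel of the momentum, the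
form in which tangency is used in charts. -/
theorem localMetric_self (hz : z ∈ U ×ˢ ({0}ᶜ : Set E)) :
    localMetric f z z.2 = localMomentum f z := by
  have h := fderiv_apply_self_of_homogeneous (h := fun u => localMomentum f (z.1, u)) (v := z.2)
    (k := 1) (differentiableAt_partial_snd (hf.differentiableAt_momentum hz))
    (fun s hs => by simpa using hf.localMomentum_smul hz hs)
  rw [fderiv_partial_snd (hf.differentiableAt_momentum hz), ← hf.localMetric_eq hz] at h
  simpa using h

theorem localConn_self [CompleteSpace E] (hz : z ∈ U ×ˢ ({0}ᶜ : Set E)) :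
    localConn f z z.2 = (2 : ℝ) • localSpray f z := by
  have h := fderiv_apply_self_of_homogeneous (h := fun u => localSpray f (z.1, u)) (v := z.2)
    (k := 2) (differentiableAt_partial_snd (hf.differentiableAt_localSpray hz))
    (fun s hs => hf.localSpray_smul hz hs)
  exact_mod_cast h

/-- `N(x, v) v = 2 G(x, v)`, differentiated. -/
theorem fderiv_localConn_self [CompleteSpace E] (hz : z ∈ U ×ˢ ({0}ᶜ : Set E)) (ζ : E × E) :
    fderiv ℝ (localConn f) z ζ z.2 = (2 : ℝ) • fderiv ℝ (localSpray f) z ζ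
      - localConn f z ζ.2 := by
  have h1 : HasFDerivAt (fun z : E × E => localConn f z z.2) _ z :=
    (hf.differentiableAt_localConn hz).hasFDerivAt.clm_apply hasFDerivAt_snd
  have h2 := ((hf.differentiableAt_localSpray hz).hasFDerivAt).const_smul (2 : ℝ)
  have h3 := h1.unique (h2.congr_of_eventuallyEq (by
    filter_upwards [hf.eventually_mem hz] with z' hz' using hf.localConn_self hz'))
  have h4 := congrArg (fun l => l ζ) h3
  simp only [add_apply, ContinuousLinearMap.comp_apply,
    ContinuousLinearMap.coe_snd', ContinuousLinearMap.flip_apply,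
    smul_apply] at h4
  rw [← h4]
  abel

theorem fderiv_localSpray_inr [CompleteSpace E] (hz : z ∈ U ×ˢ ({0}ᶜ : Set E)) (w : E) :
    fderiv ℝ (localSpray f) z (0, w) = localConn f z w := by
  rw [hf.localConn_eq hz]; rfl

/-- `∂N^α_μ / ∂v^ν` is symmetric in the lower indices. -/
theorem fderiv_localConn_symm [CompleteSpace E] (hz : z ∈ U ×ˢ ({0}ᶜ : Set E)) (v w : E) :
    fderiv ℝ (localConn f) z (0, v) w = fderiv ℝ (localConn f) z (0, w) v := by
  have hs := (hf.contDiffAt_localSpray hz).isSymmSndFDerivAt (by simp)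
  have hd : DifferentiableAt ℝ (fderiv ℝ (localSpray f)) z :=
    ((hf.contDiffAt_localSpray hz).fderiv_right (m := 1) (by norm_num)).differentiableAt
      (by norm_num)
  have h : ∀ v w : E, fderiv ℝ (localConn f) z (0, v) w
      = fderiv ℝ (fderiv ℝ (localSpray f)) z (0, v) (0, w) := by
    intro v w
    have h1 := (hd.hasFDerivAt.clm_comp
      (hasFDerivAt_const (ContinuousLinearMap.inr ℝ E E) z)).congr_of_eventuallyEq
      (f₁ := localConn f) (by
        filter_upwards [hf.eventually_mem hz] with z' hz' using hf.localConn_eq hz')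
    rw [h1.fderiv]
    simp
  rw [h, h, hs.eq]

/-! ### Second derivatives: metric, horizontal constancy, curvature -/

theorem isSymmSndFDerivAt (hz : z ∈ U ×ˢ ({0}ᶜ : Set E)) : IsSymmSndFDerivAt ℝ f z :=
  ((hf.contDiffAt hz).of_le (m := 2) (by norm_num)).isSymmSndFDerivAt (by simp)

theorem differentiableAt_fderiv (hz : z ∈ U ×ˢ ({0}ᶜ : Set E)) :
    DifferentiableAt ℝ (fderiv ℝ f) z :=
  ((hf.contDiffAt hz).fderiv_right (m := 3) (by norm_num)).differentiableAt (by norm_num)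

theorem fderiv_localMomentum (hz : z ∈ U ×ˢ ({0}ᶜ : Set E)) (ζ : E × E) (w : E) :
    fderiv ℝ (localMomentum f) z ζ w = fderiv ℝ (fderiv ℝ f) z ζ (0, w) := by
  have h : HasFDerivAt (localMomentum f) _ z := (hf.differentiableAt_fderiv hz).hasFDerivAt.clm_comp
    (hasFDerivAt_const (ContinuousLinearMap.inr ℝ E E) z)
  rw [h.fderiv]
  simp

theorem localMetric_symm (hz : z ∈ U ×ˢ ({0}ᶜ : Set E)) (v w : E) :
    localMetric f z v w = localMetric f z w v := by
  rw [hf.localMetric_eq hz]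
  simp only [ContinuousLinearMap.comp_apply, ContinuousLinearMap.inr_apply]
  rw [hf.fderiv_localMomentum hz, hf.fderiv_localMomentum hz, (hf.isSymmSndFDerivAt hz).eq]

theorem localMetric_localSpray (hz : z ∈ U ×ˢ ({0}ᶜ : Set E)) :
    localMetric f z ((2 : ℝ) • localSpray f z) = localForce f z := by
  rw [localSpray, smul_smul]
  norm_num
  exact (hf.invertible z hz).self_apply_inverse _

/-- The force contracted with the velocity. -/
theorem localMomentum_localSpray (hz : z ∈ U ×ˢ ({0}ᶜ : Set E)) :
    localMomentum f z ((2 : ℝ) • localSpray f z) = fderiv ℝ f z (z.2, 0) := by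
  have h1 : HasFDerivAt (fun z : E × E => localMomentum f z z.2) _ z :=
    (hf.differentiableAt_momentum hz).hasFDerivAt.clm_apply hasFDerivAt_snd
  have h2 := h1.unique (((hf.differentiableAt hz).hasFDerivAt.const_mul 2).congr_of_eventuallyEq (by
    filter_upwards [hf.eventually_mem hz] with z' hz' using hf.localMomentum_self hz'))
  -- Euler's relation `p(v) = 2 f` differentiated in the direction `(v, 0)`: the mixed term of the
  -- force, paired with `v`, is twice `∂ₓf(v)`, and the other term removes one copy.
  have h3 := congrArg (fun l => l (z.2, 0)) h2
  simp at h3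
  rw [← hf.localMetric_self hz, hf.localMetric_symm hz, hf.localMetric_localSpray hz,
    hf.localForce_eq hz]
  simp [h3]
  ring

/-- The Lagrangian is horizontally constant, `δ𝓛 / δx^μ = 0`. -/
theorem fderiv_horizontal [CompleteSpace E] (hz : z ∈ U ×ˢ ({0}ᶜ : Set E)) (w : E) :
    fderiv ℝ f z (w, - localConn f z w) = 0 := by
  have h1 : HasFDerivAt (fun z : E × E => localMomentum f z ((2 : ℝ) • localSpray f z)) _ z :=
    (hf.differentiableAt_momentum hz).hasFDerivAt.clm_apply
      ((hf.differentiableAt_localSpray hz).hasFDerivAt.const_smul (2 : ℝ))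
  have h2 : HasFDerivAt (fun z : E × E => fderiv ℝ f z (z.2, 0)) _ z :=
    (hf.differentiableAt_fderiv hz).hasFDerivAt.clm_apply
      (hasFDerivAt_snd.prodMk (hasFDerivAt_const (0 : E) z))
  -- Fibre derivative of `p(2G) = ∂ₓf(v)`. It contains `g(w, 2G)`, which is the force by the
  -- definition of `G`; what remains is `2 p(N w) = 2 ∂ₓf(w)`.
  have h3 := congrArg (fun l => l (0, w)) (h1.unique (h2.congr_of_eventuallyEq (by
    filter_upwards [hf.eventually_mem hz] with z' hz' using hf.localMomentum_localSpray hz')))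
  have h4 := hf.localMetric_localSpray hz
  have h5 : localMetric f z w ((2 : ℝ) • localSpray f z)
      = fderiv ℝ (fderiv ℝ f) z (z.2, 0) (0, w) - fderiv ℝ f z (w, 0) := by
    rw [hf.localMetric_symm hz, h4, hf.localForce_eq hz]
    simp [hf.fderiv_localMomentum hz]
  have h6 : localMetric f z w ((2 : ℝ) • localSpray f z)
      = fderiv ℝ (localMomentum f) z (0, w) ((2 : ℝ) • localSpray f z) := by
    rw [hf.localMetric_eq hz]; rfl
  have h7 : fderiv ℝ f z (w, - localConn f z w)
      = fderiv ℝ f z (w, 0) - localMomentum f z (localConn f z w) := by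
    have : (w, - localConn f z w) = (w, (0 : E)) - (0, localConn f z w) := by simp
    rw [this, map_sub]; rfl
  rw [h6, map_smul, smul_eq_mul] at h5
  simp only [add_apply, ContinuousLinearMap.comp_apply, ContinuousLinearMap.flip_apply,
    smul_apply, hf.fderiv_localSpray_inr hz, ContinuousLinearMap.prod_apply,
    ContinuousLinearMap.coe_snd', zero_apply, (hf.isSymmSndFDerivAt hz).eq (0, w),
    map_smul, smul_eq_mul] at h3
  rw [h7]
  linarith

/-- Comes from differentiating `δf/δx = 0` in a horizontal direction. The result is a second
derivative on two horizontal vectors, hence symmetric in `u` and `w`, which makes the curvature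
orthogonal to `v`. -/
theorem localMomentum_localHorizDerivConn [CompleteSpace E] (hz : z ∈ U ×ˢ ({0}ᶜ : Set E))
    (u w : E) : localMomentum f z (localHorizDerivConn f z u w)
      = fderiv ℝ (fderiv ℝ f) z (u, - localConn f z u) (w, - localConn f z w) := by
  have h1 : HasFDerivAt (fun z : E × E => fderiv ℝ f z (w, - localConn f z w)) _ z :=
    (hf.differentiableAt_fderiv hz).hasFDerivAt.clm_apply ((hasFDerivAt_const w z).prodMk
      ((hf.differentiableAt_localConn hz).hasFDerivAt.clm_apply (hasFDerivAt_const w z)).neg)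
  have h3 := congrArg (fun l => l (u, - localConn f z u)) (h1.unique
    ((hasFDerivAt_const (0 : ℝ) z).congr_of_eventuallyEq (by
      filter_upwards [hf.eventually_mem hz] with z' hz' using hf.fderiv_horizontal hz' w)))
  have h4 : ∀ y : E, fderiv ℝ f z (0, - y) = - localMomentum f z y := by
    intro y
    rw [← map_neg]; rfl
  rw [hf.localHorizDerivConn_apply hz]
  simp only [add_apply, ContinuousLinearMap.comp_apply, ContinuousLinearMap.flip_apply,
    ContinuousLinearMap.prod_apply, zero_apply, neg_apply, map_zero, h4, zero_add] at h3
  linarith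

/-- The curvature endomorphism takes values in the orthogonal complement of `v`. -/
theorem localMomentum_localCurvature [CompleteSpace E] (hz : z ∈ U ×ˢ ({0}ᶜ : Set E)) (w : E) :
    localMomentum f z (localCurvature f z w) = 0 := by
  have : localCurvature f z w
    = localHorizDerivConn f z w z.2 - localHorizDerivConn f z z.2 w := rfl
  rw [this, map_sub, hf.localMomentum_localHorizDerivConn hz,
    hf.localMomentum_localHorizDerivConn hz, (hf.isSymmSndFDerivAt hz).eq, sub_self]

omit hf in
theorem localCurvature_self : localCurvature f z z.2 = 0 := by
  have : localCurvature f z z.2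
    = localHorizDerivConn f z z.2 z.2 - localHorizDerivConn f z z.2 z.2 := rfl
  rw [this, sub_self]

/-- The curvature endomorphism in terms of the spray coefficients and the connection. -/
theorem localCurvature_apply [CompleteSpace E] (hz : z ∈ U ×ˢ ({0}ᶜ : Set E)) (w : E) :
    localCurvature f z w = (2 : ℝ) • fderiv ℝ (localSpray f) z (w, 0)
      - localConn f z (localConn f z w)
      - fderiv ℝ (localConn f) z (z.2, - (2 : ℝ) • localSpray f z) w := by
  have h : localCurvature f z w
    = localHorizDerivConn f z w z.2 - localHorizDerivConn f z z.2 w := rfl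
  have h2 : (w, - localConn f z w) = (w, (0 : E)) - (0, localConn f z w) := by simp
  -- In the term contracted with `v`, the differentiated relation `N v = 2G` removes the derivative
  -- of `N`; such a derivative survives only along the spray direction `(v, -2G)`.
  rw [h, hf.localHorizDerivConn_apply hz, hf.localHorizDerivConn_apply hz, hf.localConn_self hz,
    hf.fderiv_localConn_self hz, h2, map_sub, hf.fderiv_localSpray_inr hz, neg_smul]
  simp only [Prod.snd_sub, zero_sub, map_neg, smul_sub]
  module

end IsLocalFinsler
end Local

/-! ### Change of coordinates -/

section ChangeOfCoordinates

variable {E : Type*} [NormedAddCommGroup E] [NormedSpace ℝ E]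

/-- The prolongation of a map to tangent vectors. -/
def prolong (φ : E → E) (z : E × E) : E × E := (φ z.1, fderiv ℝ φ z.1 z.2)

/-- `f₁` is the expression of the Lagrangian `f` after the coordinate change `φ`, defined on `U₁`
with values in `U`. -/
structure IsCoordChange (f f₁ : E × E → ℝ) (U U₁ : Set E) (φ : E → E) : Prop where
  contDiffAt : ∀ x ∈ U₁, ContDiffAt ℝ 3 φ x
  mapsTo : Set.MapsTo φ U₁ U
  invertible : ∀ x ∈ U₁, (fderiv ℝ φ x).IsInvertible
  comp : ∀ x ∈ U₁, ∀ v, f₁ (x, v) = f (prolong φ (x, v))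

namespace IsCoordChange

variable {f f₁ : E × E → ℝ} {U U₁ : Set E} {φ : E → E}
  (h : IsCoordChange f f₁ U U₁ φ) (hf : IsLocalFinsler f U) (hf₁ : IsLocalFinsler f₁ U₁) {z : E × E}
include h

theorem prolong_mem (hz : z ∈ U₁ ×ˢ ({0}ᶜ : Set E)) : prolong φ z ∈ U ×ˢ ({0}ᶜ : Set E) :=
  ⟨h.mapsTo hz.1, fun h0 => hz.2 ((h.invertible z.1 hz.1).injective (by simpa [prolong] using h0))⟩

theorem hasFDerivAt_fst (hz : z.1 ∈ U₁) :
    HasFDerivAt (fun z : E × E => φ z.1)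
      ((fderiv ℝ φ z.1).comp (ContinuousLinearMap.fst ℝ E E)) z :=
  ((h.contDiffAt z.1 hz).differentiableAt (by norm_num)).hasFDerivAt.comp z
    (f := Prod.fst) _root_.hasFDerivAt_fst

theorem hasFDerivAt_fderiv_fst (hz : z.1 ∈ U₁) :
    HasFDerivAt (fun z : E × E => fderiv ℝ φ z.1)
      ((fderiv ℝ (fderiv ℝ φ) z.1).comp (ContinuousLinearMap.fst ℝ E E)) z :=
  (((h.contDiffAt z.1 hz).fderiv_right (m := 2)
    (by norm_num)).differentiableAt (by norm_num)).hasFDerivAt.comp z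
    (f := Prod.fst) _root_.hasFDerivAt_fst

theorem hasFDerivAt_prolong (hz : z.1 ∈ U₁) :
    HasFDerivAt (prolong φ) (((fderiv ℝ φ z.1).comp (ContinuousLinearMap.fst ℝ E E)).prod
      ((fderiv ℝ φ z.1).comp (ContinuousLinearMap.snd ℝ E E)
        + ((fderiv ℝ (fderiv ℝ φ) z.1).comp (ContinuousLinearMap.fst ℝ E E)).flip z.2)) z :=
  (h.hasFDerivAt_fst hz).prodMk ((h.hasFDerivAt_fderiv_fst hz).clm_apply hasFDerivAt_snd)

theorem fderiv_symm {x : E} (hx : x ∈ U₁) (v w : E) :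
    fderiv ℝ (fderiv ℝ φ) x v w = fderiv ℝ (fderiv ℝ φ) x w v :=
  (((h.contDiffAt x hx).of_le (m := 2) (by norm_num)).isSymmSndFDerivAt (by simp)).eq v w

include hf hf₁

theorem fderiv_comp (hz : z ∈ U₁ ×ˢ ({0}ᶜ : Set E)) (ζ : E × E) :
    fderiv ℝ f₁ z ζ = fderiv ℝ f (prolong φ z)
      (fderiv ℝ φ z.1 ζ.1, fderiv ℝ φ z.1 ζ.2 + fderiv ℝ (fderiv ℝ φ) z.1 ζ.1 z.2) := by
  have h1 := ((hf.differentiableAt (h.prolong_mem hz)).hasFDerivAt.comp z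
    (h.hasFDerivAt_prolong hz.1)).congr_of_eventuallyEq (f₁ := f₁) (by
      filter_upwards [hf₁.eventually_mem hz] with z' hz' using h.comp z'.1 hz'.1 z'.2)
  rw [h1.fderiv]
  simp

theorem localMomentum_comp (hz : z ∈ U₁ ×ˢ ({0}ᶜ : Set E)) (w : E) :
    localMomentum f₁ z w = localMomentum f (prolong φ z) (fderiv ℝ φ z.1 w) := by
  have := h.fderiv_comp hf hf₁ hz (0, w)
  simpa [localMomentum] using this

theorem fderiv_localMomentum_comp (hz : z ∈ U₁ ×ˢ ({0}ᶜ : Set E)) (ζ : E × E) (w : E) :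
    fderiv ℝ (localMomentum f₁) z ζ w = fderiv ℝ (localMomentum f) (prolong φ z)
      (fderiv ℝ φ z.1 ζ.1, fderiv ℝ φ z.1 ζ.2 + fderiv ℝ (fderiv ℝ φ) z.1 ζ.1 z.2)
        (fderiv ℝ φ z.1 w)
      + localMomentum f (prolong φ z) (fderiv ℝ (fderiv ℝ φ) z.1 ζ.1 w) := by
  have h1 := ((hf₁.differentiableAt_momentum hz).hasFDerivAt.clm_apply (hasFDerivAt_const w z))
  have h2 := ((hf.differentiableAt_momentum (h.prolong_mem hz)).hasFDerivAt.comp z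
    (h.hasFDerivAt_prolong hz.1)).clm_apply
      ((h.hasFDerivAt_fderiv_fst hz.1).clm_apply (hasFDerivAt_const w z))
  have h3 := congrArg (fun l => l ζ) (h1.unique (h2.congr_of_eventuallyEq (by
    filter_upwards [hf₁.eventually_mem hz] with z' hz' using h.localMomentum_comp hf hf₁ hz' w)))
  simp at h3
  rw [h3, add_comm]

theorem localMetric_comp (hz : z ∈ U₁ ×ˢ ({0}ᶜ : Set E)) (v w : E) :
    localMetric f₁ z v w
      = localMetric f (prolong φ z) (fderiv ℝ φ z.1 v) (fderiv ℝ φ z.1 w) := by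
  rw [hf₁.localMetric_eq hz, hf.localMetric_eq (h.prolong_mem hz)]
  have := h.fderiv_localMomentum_comp hf hf₁ hz (0, v) w
  simpa using this

/-- The force is not a tensor: `d²φ` enters through the mixed term and through `∂ₓf`. Its two
pairings with the momentum cancel by symmetry of `d²φ`, and the metric term left over becomes the
inhomogeneous part of the law for the spray. -/
theorem localForce_comp (hz : z ∈ U₁ ×ˢ ({0}ᶜ : Set E)) (w : E) :
    localForce f₁ z w = localForce f (prolong φ z) (fderiv ℝ φ z.1 w)
      + localMetric f (prolong φ z) (fderiv ℝ (fderiv ℝ φ) z.1 z.2 z.2) (fderiv ℝ φ z.1 w) := by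
  have hadd : ∀ a b : E, (a, b) = (a, (0 : E)) + (0, b) := by simp
  rw [hf₁.localForce_eq hz, hf.localForce_eq (h.prolong_mem hz),
    hf.localMetric_eq (h.prolong_mem hz)]
  simp only [sub_apply, ContinuousLinearMap.comp_apply, ContinuousLinearMap.inl_apply,
    ContinuousLinearMap.inr_apply]
  rw [h.fderiv_localMomentum_comp hf hf₁ hz, h.fderiv_comp hf hf₁ hz, h.fderiv_symm hz.1 w z.2]
  simp only [map_zero, zero_add]
  rw [hadd (fderiv ℝ φ z.1 z.2) (fderiv ℝ (fderiv ℝ φ) z.1 z.2 z.2),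
    hadd (fderiv ℝ φ z.1 w) (fderiv ℝ (fderiv ℝ φ) z.1 z.2 w), map_add, map_add, add_apply]
  simp only [localMomentum, prolong, ContinuousLinearMap.comp_apply, ContinuousLinearMap.inr_apply]
  ring

/-- The transformation law of the spray coefficients. -/
theorem localSpray_comp (hz : z ∈ U₁ ×ˢ ({0}ᶜ : Set E)) :
    (2 : ℝ) • localSpray f (prolong φ z)
      = (2 : ℝ) • fderiv ℝ φ z.1 (localSpray f₁ z) - fderiv ℝ (fderiv ℝ φ) z.1 z.2 z.2 := by
  apply (hf.invertible _ (h.prolong_mem hz)).injective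
  ext w
  obtain ⟨w, rfl⟩ := (h.invertible z.1 hz.1).surjective w
  have h1 := h.localForce_comp hf hf₁ hz w
  rw [← hf₁.localMetric_localSpray hz, h.localMetric_comp hf hf₁ hz] at h1
  rw [hf.localMetric_localSpray (h.prolong_mem hz), map_sub, sub_apply, ← map_smul, h1]
  ring

/-- The transformation law of the non-linear connection. -/
theorem localConn_comp [CompleteSpace E] (hz : z ∈ U₁ ×ˢ ({0}ᶜ : Set E)) (w : E) :
    localConn f (prolong φ z) (fderiv ℝ φ z.1 w)
      = fderiv ℝ φ z.1 (localConn f₁ z w) - fderiv ℝ (fderiv ℝ φ) z.1 w z.2 := by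
  have h1 := ((hf.differentiableAt_localSpray (h.prolong_mem hz)).hasFDerivAt.comp z
    (h.hasFDerivAt_prolong hz.1)).const_smul (2 : ℝ)
  have h2 := ((h.hasFDerivAt_fderiv_fst hz.1).clm_apply
    (hf₁.differentiableAt_localSpray hz).hasFDerivAt).const_smul (2 : ℝ)
  have hd : DifferentiableAt ℝ (fderiv ℝ (fderiv ℝ φ)) z.1 :=
    (((h.contDiffAt z.1 hz.1).fderiv_right (m := 2) (by norm_num)).fderiv_right (m := 1)
      (by norm_num)).differentiableAt (by norm_num)
  have h3 := ((hd.hasFDerivAt.comp z (f := Prod.fst) _root_.hasFDerivAt_fst).clm_apply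
    (hasFDerivAt_snd (p := z))).clm_apply (hasFDerivAt_snd (p := z))
  -- Fibre derivative of the law for the spray. The term quadratic in the velocity contributes two
  -- equal parts, so a common factor 2 cancels at the end.
  have h4 := congrArg (fun l => l (0, w)) (h1.unique ((h2.sub h3).congr_of_eventuallyEq (by
    filter_upwards [hf₁.eventually_mem hz] with z' hz' using h.localSpray_comp hf hf₁ hz')))
  simp [hf.fderiv_localSpray_inr (h.prolong_mem hz), hf₁.fderiv_localSpray_inr hz,
    h.fderiv_symm hz.1 z.2 w] at h4
  apply smul_right_injective E (two_ne_zero (α := ℝ))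
  simp only [h4, smul_sub, two_smul]

end IsCoordChange
end ChangeOfCoordinates

/-! ### Derivatives along integral curves -/

section IntegralCurve

variable {F : Type*} [NormedAddCommGroup F] [NormedSpace ℝ F]
  {X : Type*} [NormedAddCommGroup X] [NormedSpace ℝ X]

open Filter

/-- Strict differentiability is what permits the base point `u a` of the difference quotient to move
with the limit. -/
theorem tendsto_slope_of_hasStrictFDerivAt {α : Type*} {k : F → X} {k' : F →L[ℝ] X} {y₀ ξ : F}
    (hk : HasStrictFDerivAt k k' y₀) {l : Filter α} {u : α → F} {s : α → ℝ}
    (hu : Tendsto u l (𝓝 y₀)) (hs : Tendsto s l (𝓝[≠] 0)) :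
    Tendsto (fun a => (s a)⁻¹ • (k (u a + s a • ξ) - k (u a))) l (𝓝 (k' ξ)) := by
  have hs0 : Tendsto s l (𝓝 0) := hs.mono_right nhdsWithin_le_nhds
  have h1 : Tendsto (fun a => (u a + s a • ξ, u a)) l (𝓝 (y₀, y₀)) := by
    refine Tendsto.prodMk_nhds ?_ hu
    simpa using hu.add (hs0.smul_const ξ)
  have h2 := hk.isLittleO.comp_tendsto h1
  have h3 : (fun a => k (u a + s a • ξ) - k (u a) - k' (s a • ξ)) =o[l] s := by
    refine (h2.congr_left (fun a => by simp)).trans_isBigO ?_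
    refine Asymptotics.IsBigO.of_bound ‖ξ‖ (Eventually.of_forall fun a => ?_)
    simp [norm_smul, mul_comm]
  have hne : ∀ᶠ a in l, s a ≠ 0 := hs.eventually self_mem_nhdsWithin
  have h4 : Tendsto (fun a => (s a)⁻¹ • (k (u a + s a • ξ) - k (u a) - k' (s a • ξ))) l (𝓝 0) := by
    rw [tendsto_zero_iff_norm_tendsto_zero]
    refine (h3.norm_norm.tendsto_div_nhds_zero).congr fun a => ?_
    rw [norm_smul, norm_inv, div_eq_inv_mul]
  have h5 := h4.add_const (k' ξ)
  rw [zero_add] at h5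
  refine h5.congr' ?_
  filter_upwards [hne] with a ha
  rw [smul_sub, map_smul, smul_smul, inv_mul_cancel₀ ha, one_smul, sub_add_cancel]

/-- If `h` and its derivative `k` in the direction of the vector field `N` are both of class `C¹`,
then `dh` is differentiable along the integral curves of `N`. -/
theorem hasDerivAt_fderiv_apply_of_integralCurve {N : F → F} {h k : F → X} {u : ℝ → F} {t₀ : ℝ}
    (hh : ContDiffAt ℝ 1 h (u t₀)) (hN : ContDiffAt ℝ 1 N (u t₀)) (hk : ContDiffAt ℝ 1 k (u t₀))
    (hhk : ∀ᶠ y in 𝓝 (u t₀), fderiv ℝ h y (N y) = k y)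
    (hu : ∀ᶠ t in 𝓝 t₀, HasDerivAt u (N (u t)) t) (ξ : F) :
    HasDerivAt (fun t => fderiv ℝ h (u t) ξ)
      (fderiv ℝ k (u t₀) ξ - fderiv ℝ h (u t₀) (fderiv ℝ N (u t₀) ξ)) t₀ := by
  have huc : ContinuousAt u t₀ := hu.self_of_nhds.continuousAt
  have hsnd : Tendsto (fun p : ℝ × ℝ => u p.2) (𝓝[≠] 0 ×ˢ 𝓝 t₀) (𝓝 (u t₀)) :=
    huc.tendsto.comp tendsto_snd
  have hfst : Tendsto (fun p : ℝ × ℝ => p.1) (𝓝[≠] 0 ×ˢ 𝓝 t₀) (𝓝[≠] 0) := tendsto_fst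
  have hsum : Tendsto (fun p : ℝ × ℝ => u p.2 + p.1 • ξ) (𝓝[≠] 0 ×ˢ 𝓝 t₀) (𝓝 (u t₀)) := by
    simpa using hsnd.add ((hfst.mono_right nhdsWithin_le_nhds).smul_const ξ)
  have hdiff : ∀ᶠ y in 𝓝 (u t₀), DifferentiableAt ℝ h y := by
    filter_upwards [hh.eventually (by simp)] with y hy using hy.differentiableAt (by simp)
  have hcont : Tendsto (fun p : ℝ × ℝ => fderiv ℝ h (u p.2 + p.1 • ξ)) (𝓝[≠] 0 ×ˢ 𝓝 t₀)
      (𝓝 (fderiv ℝ h (u t₀))) :=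
    (hh.fderiv_right (m := 0) (by simp)).continuousAt.tendsto.comp hsum
  -- Interchange of limits, since `h` has no second derivative: the difference quotients of `h` in
  -- the direction `ξ` are differentiable in `t`, and their `t`-derivatives converge uniformly near
  -- `t₀` as `s → 0`.
  refine hasDerivAt_of_tendstoUniformlyOnFilter (l := 𝓝[≠] (0 : ℝ))
    (f := fun s t => s⁻¹ • (h (u t + s • ξ) - h (u t)))
    (f' := fun s t => s⁻¹ • (fderiv ℝ h (u t + s • ξ) (N (u t)) - k (u t)))
    (g' := fun _ => fderiv ℝ k (u t₀) ξ - fderiv ℝ h (u t₀) (fderiv ℝ N (u t₀) ξ)) ?_ ?_ ?_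
  · rw [← tendsto_prod_filter_iff]
    -- As `k = dh(N)`, one has `dh(u+sξ)(N(u)) = k(u+sξ) - dh(u+sξ)(N(u+sξ) - N(u))`: the quotient
    -- splits into one of `k` and one of `N`, and both converge.
    have h1 := (tendsto_slope_of_hasStrictFDerivAt (ξ := ξ)
      (hk.hasStrictFDerivAt (by simp)) hsnd hfst).sub
        ((isBoundedBilinearMap_apply.continuous.tendsto _).comp (hcont.prodMk_nhds
          (tendsto_slope_of_hasStrictFDerivAt (ξ := ξ)
            (hN.hasStrictFDerivAt (by simp)) hsnd hfst)))
    refine h1.congr' ?_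
    filter_upwards [hsum.eventually hhk] with p hp
    simp only [Function.HasUncurry.uncurry, id, Function.comp_apply, ← hp, map_smul, map_sub, smul_sub]
    abel
  · filter_upwards [hsum.eventually hdiff, hsnd.eventually hdiff, hsnd.eventually hhk,
      (tendsto_snd (f := 𝓝[≠] (0 : ℝ))).eventually hu] with p h1 h2 h3 h4
    have h5 := h1.hasFDerivAt.comp_hasDerivAt p.2 (h4.add_const (p.1 • ξ))
    have h6 := h2.hasFDerivAt.comp_hasDerivAt p.2 h4
    rw [h3] at h6
    exact (h5.sub h6).const_smul p.1⁻¹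
  · filter_upwards [huc.eventually hdiff] with t ht
    exact (ht.hasFDerivAt.hasLineDerivAt ξ).tendsto_slope_zero

/-- An operator on a finite-dimensional space is a fixed linear expression in its values on a basis.
-/
theorem HasDerivAt.clm_of_pointwise [FiniteDimensional ℝ F] {Φ : ℝ → F →L[ℝ] X}
    {Φ' : F →L[ℝ] X} {t₀ : ℝ} (h : ∀ ξ, HasDerivAt (fun t => Φ t ξ) (Φ' ξ) t₀) :
    HasDerivAt Φ Φ' t₀ := by
  let b := Module.finBasis ℝ F
  have h1 : ∀ Ψ : F →L[ℝ] X, Ψ = ∑ i, ContinuousLinearMap.smulRightL ℝ F X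
      (LinearMap.toContinuousLinearMap (b.coord i)) (Ψ (b i)) := by
    intro Ψ
    ext ξ
    conv_lhs => rw [← b.sum_repr ξ, map_sum]
    simp
  have h2 : HasDerivAt (fun t => ∑ i, ContinuousLinearMap.smulRightL ℝ F X
      (LinearMap.toContinuousLinearMap (b.coord i)) (Φ t (b i)))
      (∑ i, ContinuousLinearMap.smulRightL ℝ F X
      (LinearMap.toContinuousLinearMap (b.coord i)) (Φ' (b i))) t₀ :=
    HasDerivAt.fun_sum fun i _ =>
      ((ContinuousLinearMap.smulRightL ℝ F X _).hasFDerivAt).comp_hasDerivAt t₀ (h (b i))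
  rw [← h1] at h2
  exact h2.congr_of_eventuallyEq (Eventually.of_forall fun t => h1 (Φ t))

end IntegralCurve

/-! ### Null hypersurfaces in a chart -/

section LocalNull

open Filter

variable {E : Type*} [NormedAddCommGroup E] [NormedSpace ℝ E]
  {F : Type*} [NormedAddCommGroup F] [NormedSpace ℝ F]

/-- The vector field `n = dj(N)` along the parametrized hypersurface `j`. -/
def localPush (j : F → E) (N : F → F) (y : F) : E := fderiv ℝ j y (N y)

/-- `ξ ↦ D_ξ n`, for a vector field `n` along `j`. -/
def localCovDeriv (f : E × E → ℝ) (j n : F → E) (y : F) : F →L[ℝ] E :=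
  fderiv ℝ n y + (localConn f (j y, n y)).comp (fderiv ℝ j y)

/-- `j` parametrizes, near `y₀`, a null hypersurface with lightlike tangent field `N`. -/
structure IsLocalNull (f : E × E → ℝ) (U : Set E) (j : F → E) (N : F → F) (y₀ : F) : Prop where
  isLocalFinsler : IsLocalFinsler f U
  mem : j y₀ ∈ U
  contDiffAt : ContDiffAt ℝ 2 j y₀
  contDiffAt_field : ContDiffAt ℝ 1 N y₀
  injective : ∀ᶠ y in 𝓝 y₀, Function.Injective (fderiv ℝ j y)
  ne_zero : ∀ᶠ y in 𝓝 y₀, N y ≠ 0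
  lightlike : ∀ᶠ y in 𝓝 y₀, f (j y, localPush j N y) = 0
  tangent : ∀ᶠ y in 𝓝 y₀, ∀ w,
    w ∈ Set.range (fderiv ℝ j y) ↔ localMomentum f (j y, localPush j N y) w = 0

namespace IsLocalNull

variable {f : E × E → ℝ} {U : Set E} {j : F → E} {N : F → F} {y₀ : F}
  (h : IsLocalNull f U j N y₀)
include h

theorem contDiffAt_fderiv : ContDiffAt ℝ 1 (fderiv ℝ j) y₀ :=
  h.contDiffAt.fderiv_right (m := 1) (by norm_num)

theorem contDiffAt_push : ContDiffAt ℝ 1 (localPush j N) y₀ :=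
  h.contDiffAt_fderiv.clm_apply h.contDiffAt_field

theorem eventually_differentiableAt : ∀ᶠ y in 𝓝 y₀, DifferentiableAt ℝ j y := by
  filter_upwards [h.contDiffAt.eventually (by simp)] with y hy using hy.differentiableAt (by simp)

theorem eventually_differentiableAt_push :
    ∀ᶠ y in 𝓝 y₀, DifferentiableAt ℝ (localPush j N) y := by
  filter_upwards [h.contDiffAt_push.eventually (by simp)] with y hy
    using hy.differentiableAt (by simp)

theorem push_ne_zero : ∀ᶠ y in 𝓝 y₀, localPush j N y ≠ 0 := by
  filter_upwards [h.injective, h.ne_zero] with y h1 h2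
  exact fun h0 => h2 (h1 (by rw [map_zero]; exact h0))

theorem eventually_mem_base : ∀ᶠ y in 𝓝 y₀, j y ∈ U :=
  h.contDiffAt.continuousAt.eventually (h.isLocalFinsler.isOpen.mem_nhds h.mem)

theorem eventually_mem :
    ∀ᶠ y in 𝓝 y₀, (j y, localPush j N y) ∈ U ×ˢ ({0}ᶜ : Set E) := by
  filter_upwards [h.eventually_mem_base, h.push_ne_zero] with y h1 h2 using ⟨h1, h2⟩

/-- `D_ξ n` is tangent to the hypersurface. -/
theorem localCovDeriv_mem_range [CompleteSpace E] : ∀ᶠ y in 𝓝 y₀, ∀ ξ,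
    localCovDeriv f j (localPush j N) y ξ ∈ Set.range (fderiv ℝ j y) := by
  filter_upwards [h.tangent, h.lightlike.eventually_nhds, h.eventually_mem,
    h.eventually_differentiableAt, h.eventually_differentiableAt_push] with y h1 h2 h3 h4 h5 ξ
  rw [h1]
  have hd : HasFDerivAt (fun y => f (j y, localPush j N y)) _ y :=
    (h.isLocalFinsler.differentiableAt h3).hasFDerivAt.comp y
      (h4.hasFDerivAt.prodMk h5.hasFDerivAt)
  -- The derivative of `f(j, n) = 0` in the direction `ξ`; subtracting the vanishing horizontal
  -- derivative along `dj ξ` leaves the momentum applied to `D_ξ n`.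
  have h6 := congrArg (fun l => l ξ) (hd.unique
    ((hasFDerivAt_const (0 : ℝ) y).congr_of_eventuallyEq h2))
  simp only [ContinuousLinearMap.comp_apply, ContinuousLinearMap.prod_apply, zero_apply] at h6
  have h7 := h.isLocalFinsler.fderiv_horizontal h3 (fderiv ℝ j y ξ)
  rw [← sub_eq_zero.2 (h6.trans h7.symm), ← map_sub]
  simp [localCovDeriv, localMomentum]

theorem localCurvature_mem_range [CompleteSpace E] : ∀ᶠ y in 𝓝 y₀, ∀ w,
    localCurvature f (j y, localPush j N y) w ∈ Set.range (fderiv ℝ j y) := by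
  filter_upwards [h.tangent, h.eventually_mem] with y h1 h2 w
  rw [h1, h.isLocalFinsler.localMomentum_localCurvature h2]

end IsLocalNull

/-! ### Normalization of the lightlike field -/

/-- The multiple `n̂` of `n` with `α(n̂) = 1`. -/
def normalized (α : E →L[ℝ] ℝ) (n : F → E) (y : F) : E := (α (n y))⁻¹ • n y

/-- `α(n) D n̂`. -/
def normalizedCovDeriv (f : E × E → ℝ) (j n : F → E) (α : E →L[ℝ] ℝ) (y : F) : F →L[ℝ] E :=
  α (n y) • localCovDeriv f j (normalized α n) y

/-- The derivative of `n̂` along `n`. -/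
def normalizedAccel (f : E × E → ℝ) (j n : F → E) (α : E →L[ℝ] ℝ) (y : F) : E :=
  α (n y) • ((2 * α (localSpray f (j y, normalized α n y))) • normalized α n y
    - (2 : ℝ) • localSpray f (j y, normalized α n y))

namespace IsLocalNull

variable {f : E × E → ℝ} {U : Set E} {j : F → E} {N : F → F} {y₀ : F}
  (h : IsLocalNull f U j N y₀) {α : E →L[ℝ] ℝ} (hα : α (localPush j N y₀) = 1)
include h hα

/-- Positivity, and not just non-vanishing, is required: the Lagrangian is only positively
homogeneous. -/
theorem eventually_pos : ∀ᶠ y in 𝓝 y₀, 0 < α (localPush j N y) := by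
  have : ContinuousAt (fun y => α (localPush j N y)) y₀ :=
    α.continuous.continuousAt.comp h.contDiffAt_push.continuousAt
  exact this.eventually (lt_mem_nhds (by simp [hα]))

omit h in
theorem normalized_base : normalized α (localPush j N) y₀ = localPush j N y₀ := by
  simp [normalized, hα]

theorem contDiffAt_normalized : ContDiffAt ℝ 1 (normalized α (localPush j N)) y₀ :=
  (((α.contDiff.contDiffAt).comp y₀ h.contDiffAt_push).inv (by simp [hα])).smul h.contDiffAt_push

theorem eventually_differentiableAt_normalized :
    ∀ᶠ y in 𝓝 y₀, DifferentiableAt ℝ (normalized α (localPush j N)) y := by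
  filter_upwards [(h.contDiffAt_normalized hα).eventually (by simp)] with y hy
    using hy.differentiableAt (by simp)

theorem eventually_mem_normalized :
    ∀ᶠ y in 𝓝 y₀, (j y, normalized α (localPush j N) y) ∈ U ×ˢ ({0}ᶜ : Set E) := by
  filter_upwards [h.eventually_mem, h.eventually_pos hα] with y h1 h2
  exact ⟨h1.1, smul_ne_zero (inv_ne_zero h2.ne') h1.2⟩

theorem fderiv_push : ∀ᶠ y in 𝓝 y₀, ∀ ξ, fderiv ℝ (localPush j N) y ξ
    = α (localPush j N y) • fderiv ℝ (normalized α (localPush j N)) y ξ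
      + α (fderiv ℝ (localPush j N) y ξ) • normalized α (localPush j N) y := by
  filter_upwards [(h.eventually_pos hα).eventually_nhds, h.eventually_differentiableAt_push,
    h.eventually_differentiableAt_normalized hα] with y h1 h2 h3 ξ
  have h4 := (α.hasFDerivAt.comp y h2.hasFDerivAt).smul h3.hasFDerivAt
  have h5 := h4.congr_of_eventuallyEq (f₁ := localPush j N) (by
    filter_upwards [h1] with y' hy'
    simp [normalized, smul_smul, mul_inv_cancel₀ hy'.ne'])
  have h6 := congrArg (fun l => l ξ) h5.fderiv
  simpa using h6

/-- Product rule for `n = α(n) n̂`, together with the degree-one homogeneity of the connection. The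
term along `n̂` carries the differential of `α(n)`, which is merely continuous, and it disappears in
the quotient `V`. -/
theorem localCovDeriv_eq [CompleteSpace E] : ∀ᶠ y in 𝓝 y₀, ∀ ξ,
    localCovDeriv f j (localPush j N) y ξ = normalizedCovDeriv f j (localPush j N) α y ξ
      + α (fderiv ℝ (localPush j N) y ξ) • normalized α (localPush j N) y := by
  filter_upwards [h.fderiv_push hα, h.eventually_pos hα, h.eventually_mem_normalized hα]
    with y h1 h2 h3 ξ
  have h4 := h.isLocalFinsler.localConn_smul h3 h2
  have h5 : α (localPush j N y) • normalized α (localPush j N) y = localPush j N y := by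
    simp [normalized, smul_smul, mul_inv_cancel₀ h2.ne']
  simp only [h5] at h4
  simp only [localCovDeriv, normalizedCovDeriv, add_apply, smul_apply,
    ContinuousLinearMap.comp_apply, h4]
  have h6 := h1 ξ
  set c := α (fderiv ℝ (localPush j N) y ξ)
  rw [h6]
  module

theorem normalizedCovDeriv_mem_range [CompleteSpace E] : ∀ᶠ y in 𝓝 y₀, ∀ ξ,
    normalizedCovDeriv f j (localPush j N) α y ξ ∈ Set.range (fderiv ℝ j y) := by
  filter_upwards [h.localCovDeriv_eq hα, h.localCovDeriv_mem_range] with y h1 h2 ξ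
  obtain ⟨η, hη⟩ := h2 ξ
  refine ⟨η - (α (fderiv ℝ (localPush j N) y ξ) * (α (localPush j N y))⁻¹) • N y, ?_⟩
  rw [map_sub, hη, h1, map_smul, normalized, smul_smul, add_sub_assoc]
  exact add_eq_left.2 (sub_self _)

theorem alpha_fderiv_normalized : ∀ᶠ y in 𝓝 y₀, ∀ ξ,
    α (fderiv ℝ (normalized α (localPush j N)) y ξ) = 0 := by
  filter_upwards [(h.eventually_pos hα).eventually_nhds,
    h.eventually_differentiableAt_normalized hα] with y h1 h2 ξ
  have h3 := (α.hasFDerivAt.comp y h2.hasFDerivAt).unique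
    ((hasFDerivAt_const (1 : ℝ) y).congr_of_eventuallyEq (by
      filter_upwards [h1] with y' hy'
      simp [normalized, inv_mul_cancel₀ hy'.ne']))
  simpa using congrArg (fun l => l ξ) h3

variable {κ : F → ℝ} (hκ : ∀ᶠ y in 𝓝 y₀,
  localCovDeriv f j (localPush j N) y (N y) = κ y • localPush j N y)
include hκ

/-- The normalized field satisfies a geodesic equation with smooth coefficients. -/
theorem normalizedAccel_eq [CompleteSpace E] : ∀ᶠ y in 𝓝 y₀,
    fderiv ℝ (normalized α (localPush j N)) y (N y) = normalizedAccel f j (localPush j N) α y ∧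
    κ y * α (localPush j N y) = α (fderiv ℝ (localPush j N) y (N y))
      + 2 * α (localPush j N y) ^ 2 * α (localSpray f (j y, normalized α (localPush j N) y)) := by
  filter_upwards [hκ, h.localCovDeriv_eq hα, h.alpha_fderiv_normalized hα, h.eventually_pos hα,
    h.eventually_mem_normalized hα] with y h1 h2 h3 h4 h5
  have h6 : α (localPush j N y) • normalized α (localPush j N) y = localPush j N y := by
    simp [normalized, smul_smul, mul_inv_cancel₀ h4.ne']
  have h7 : α (normalized α (localPush j N) y) = 1 := by
    simp [normalized, inv_mul_cancel₀ h4.ne']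
  have h8 : fderiv ℝ j y (N y) = α (localPush j N y) • normalized α (localPush j N) y := h6.symm
  have h9 := h.isLocalFinsler.localConn_self h5
  have h10 := h2 (N y)
  rw [h1] at h10
  have h11 := h3 (N y)
  set a := α (localPush j N y) with ha
  set v := normalized α (localPush j N) y
  set G := localSpray f (j y, v)
  simp only [normalizedCovDeriv, localCovDeriv, smul_apply, add_apply,
    ContinuousLinearMap.comp_apply, ← ha, h8, map_smul] at h10
  simp only at h9
  rw [h9, ← h6] at h10
  -- As `α(n̂) = 1`, applying `α` kills the derivative of `n̂`. This determines the factor of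
  -- proportionality and eliminates `κ`, on which no regularity is assumed.
  have h12 := congrArg α h10
  simp only [map_add, map_smul, h11, h7, smul_eq_mul] at h12
  have h13 : κ y * a = α (fderiv ℝ (localPush j N) y (N y)) + 2 * a ^ 2 * α G := by
    rw [← mul_one (κ y * a), mul_assoc, h12]; ring
  refine ⟨?_, h13⟩
  apply smul_right_injective E h4.ne'
  have h14 : a • fderiv ℝ (normalized α (localPush j N)) y (N y)
      = (κ y * a - α (fderiv ℝ (localPush j N) y (N y))) • v - (2 * a ^ 2) • G := by
    rw [sub_smul, mul_smul, h10]
    module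
  simp only [h14, h13, normalizedAccel]
  module

end IsLocalNull
end LocalNull

/-! ### The Riccati equation in a chart -/

section LocalRiccati

open Filter

variable {E : Type*} [NormedAddCommGroup E] [NormedSpace ℝ E]
  {F : Type*} [NormedAddCommGroup F] [NormedSpace ℝ F]

namespace IsLocalNull

variable {f : E × E → ℝ} {U : Set E} {j : F → E} {N : F → F} {y₀ : F}
  (h : IsLocalNull f U j N y₀)

section Normalized

variable {α : E →L[ℝ] ℝ} (hα : α (localPush j N y₀) = 1)
include h hα

/-- The gain of regularity: only `j`, `n`, `n̂` and the C² spray enter, and no derivative of `n`. -/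
theorem contDiffAt_normalizedAccel [CompleteSpace E] :
    ContDiffAt ℝ 1 (normalizedAccel f j (localPush j N) α) y₀ := by
  have h1 := h.contDiffAt_normalized hα
  have h2 : ContDiffAt ℝ 1 (fun y => localSpray f (j y, normalized α (localPush j N) y)) y₀ :=
    ContDiffAt.comp y₀ (g := localSpray f) ((h.isLocalFinsler.contDiffAt_localSpray
      (h.eventually_mem_normalized hα).self_of_nhds).of_le (by norm_num))
      ((h.contDiffAt.of_le (by norm_num)).prodMk h1)
  exact ((α.contDiff.contDiffAt).comp y₀ h.contDiffAt_push).smul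
    (((contDiffAt_const.mul ((α.contDiff.contDiffAt).comp y₀ h2)).smul h1).sub
      (contDiffAt_const.smul h2))

/-- The differential of the normalized acceleration, modulo `n`. -/
theorem fderiv_normalizedAccel [CompleteSpace E] (ξ : F) : ∃ c : ℝ,
    fderiv ℝ (normalizedAccel f j (localPush j N) α) y₀ ξ
      = (2 * α (localSpray f (j y₀, localPush j N y₀))) •
          fderiv ℝ (normalized α (localPush j N)) y₀ ξ
        - (2 * α (fderiv ℝ (localPush j N) y₀ ξ)) • localSpray f (j y₀, localPush j N y₀)
        - (2 : ℝ) • fderiv ℝ (localSpray f) (j y₀, localPush j N y₀)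
          (fderiv ℝ j y₀ ξ, fderiv ℝ (normalized α (localPush j N)) y₀ ξ)
        + c • localPush j N y₀ := by
  have hmem := h.eventually_mem.self_of_nhds
  have hn := normalized_base hα
  have hj := h.eventually_differentiableAt.self_of_nhds.hasFDerivAt
  have hp := h.eventually_differentiableAt_push.self_of_nhds.hasFDerivAt
  have hv := (h.eventually_differentiableAt_normalized hα).self_of_nhds.hasFDerivAt
  have hG0 := (h.isLocalFinsler.differentiableAt_localSpray hmem).hasFDerivAt
  rw [← hn] at hG0
  have hG := HasFDerivAt.comp y₀ (f := fun y => (j y, normalized α (localPush j N) y)) hG0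
    (hj.prodMk hv)
  have hd := (α.hasFDerivAt.comp y₀ hp).smul
    ((((α.hasFDerivAt.comp y₀ hG).const_mul 2).smul hv).sub (hG.const_smul (2 : ℝ)))
  have hd' := congrArg (fun l => l ξ) (HasFDerivAt.fderiv
    (f := normalizedAccel f j (localPush j N) α) hd)
  simp only [Function.comp_apply, hn, hα, add_apply, smul_apply, sub_apply,
    ContinuousLinearMap.comp_apply, ContinuousLinearMap.smulRight_apply,
    ContinuousLinearMap.prod_apply, one_smul, smul_eq_mul, Pi.sub_apply, Pi.smul_apply,
    Pi.smul_apply'] at hd'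
  refine ⟨2 * α (fderiv ℝ (localSpray f) (j y₀, localPush j N y₀)
      (fderiv ℝ j y₀ ξ, fderiv ℝ (normalized α (localPush j N)) y₀ ξ))
      + α (fderiv ℝ (localPush j N) y₀ ξ) * (2 * α (localSpray f (j y₀, localPush j N y₀))),
    hd'.trans ?_⟩
  module

variable {κ : F → ℝ} (hκ : ∀ᶠ y in 𝓝 y₀,
  localCovDeriv f j (localPush j N) y (N y) = κ y • localPush j N y)
  {u : ℝ → F} {t₀ : ℝ} (hu : ∀ᶠ t in 𝓝 t₀, HasDerivAt u (N (u t)) t) (hu₀ : u t₀ = y₀)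
include hκ hu hu₀

/-- The differential of `n̂` is handled by the commutation lemma, with `normalizedAccel` as the C¹
derivative along `N`; the factors `α(n)`, the connection and `dj` are C¹ and obey the chain rule.
The value is simplified in `deriv_normalizedCovDeriv`. -/
theorem hasDerivAt_normalizedCovDeriv [CompleteSpace E] [FiniteDimensional ℝ F] :
    HasDerivAt (fun t => normalizedCovDeriv f j (localPush j N) α (u t))
      (α (fderiv ℝ (localPush j N) y₀ (N y₀)) • normalizedCovDeriv f j (localPush j N) α y₀
        + (fderiv ℝ (normalizedAccel f j (localPush j N) α) y₀
          - (fderiv ℝ (normalized α (localPush j N)) y₀).comp (fderiv ℝ N y₀)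
          + ((fderiv ℝ (localConn f) (j y₀, localPush j N y₀)
              (localPush j N y₀, normalizedAccel f j (localPush j N) α y₀)).comp (fderiv ℝ j y₀)
            + (localConn f (j y₀, localPush j N y₀)).comp
              (fderiv ℝ (fderiv ℝ j) y₀ (N y₀))))) t₀ := by
  subst hu₀
  have hut := hu.self_of_nhds
  have hmem := h.eventually_mem.self_of_nhds
  have hn := normalized_base hα
  have hj := h.eventually_differentiableAt.self_of_nhds.hasFDerivAt
  have hp := h.eventually_differentiableAt_push.self_of_nhds.hasFDerivAt
  have hv := (h.eventually_differentiableAt_normalized hα).self_of_nhds.hasFDerivAt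
  have hdj := (h.contDiffAt_fderiv.differentiableAt (by simp)).hasFDerivAt
  have hacc := h.normalizedAccel_eq hα hκ
  have hN0 := (h.isLocalFinsler.differentiableAt_localConn hmem).hasFDerivAt
  rw [← hn] at hN0
  have h1 : HasDerivAt (fun t => fderiv ℝ (normalized α (localPush j N)) (u t)) _ t₀ :=
    HasDerivAt.clm_of_pointwise (Φ' := fderiv ℝ (normalizedAccel f j (localPush j N) α) (u t₀)
          - (fderiv ℝ (normalized α (localPush j N)) (u t₀)).comp (fderiv ℝ N (u t₀)))
      fun ξ => hasDerivAt_fderiv_apply_of_integralCurve (h.contDiffAt_normalized hα)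
        h.contDiffAt_field (h.contDiffAt_normalizedAccel hα) (hacc.mono fun y hy => hy.1) hu ξ
  have h2 := HasFDerivAt.comp_hasDerivAt t₀
    (f := fun t => (j (u t), normalized α (localPush j N) (u t))) hN0
    ((hj.comp_hasDerivAt t₀ hut).prodMk (hv.comp_hasDerivAt t₀ hut))
  have h3 := h1.add (h2.clm_comp (hdj.comp_hasDerivAt t₀ hut))
  have h4 := ((α.hasFDerivAt.comp_hasDerivAt t₀ (hp.comp_hasDerivAt t₀ hut))).smul h3
  refine h4.congr_deriv ?_
  ext ξ
  simp only [Function.comp_apply, hn, hacc.self_of_nhds.1, normalizedCovDeriv,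
    localCovDeriv, localPush, add_apply, smul_apply, sub_apply, ContinuousLinearMap.comp_apply,
    Pi.add_apply]
  simp only [localPush] at hα
  simp only [hα, one_smul]
  abel

omit hu hu₀ in
/-- The derivative of `D n̂` along the generator, modulo `n`. -/
theorem deriv_normalizedCovDeriv [CompleteSpace E] (ξ : F) : ∃ c : ℝ,
      (α (fderiv ℝ (localPush j N) y₀ (N y₀)) • normalizedCovDeriv f j (localPush j N) α y₀
        + (fderiv ℝ (normalizedAccel f j (localPush j N) α) y₀
          - (fderiv ℝ (normalized α (localPush j N)) y₀).comp (fderiv ℝ N y₀)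
          + ((fderiv ℝ (localConn f) (j y₀, localPush j N y₀)
              (localPush j N y₀, normalizedAccel f j (localPush j N) α y₀)).comp (fderiv ℝ j y₀)
            + (localConn f (j y₀, localPush j N y₀)).comp
              (fderiv ℝ (fderiv ℝ j) y₀ (N y₀))))) ξ
      = - localCurvature f (j y₀, localPush j N y₀) (fderiv ℝ j y₀ ξ)
        - localConn f (j y₀, localPush j N y₀) (normalizedCovDeriv f j (localPush j N) α y₀ ξ)
        - normalizedCovDeriv f j (localPush j N) α y₀ (fderiv ℝ N y₀ ξ)
        + κ y₀ • normalizedCovDeriv f j (localPush j N) α y₀ ξ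
        + c • localPush j N y₀ := by
  have hmem := h.eventually_mem.self_of_nhds
  have hn := normalized_base hα
  have hdj := (h.contDiffAt_fderiv.differentiableAt (by simp)).hasFDerivAt
  have hN := (h.contDiffAt_field.differentiableAt (by simp)).hasFDerivAt
  have hκ0 := (h.normalizedAccel_eq hα hκ).self_of_nhds.2
  have hsymm : ∀ v w, fderiv ℝ (fderiv ℝ j) y₀ v w = fderiv ℝ (fderiv ℝ j) y₀ w v :=
    (h.contDiffAt.isSymmSndFDerivAt (by simp)).eq
  have h1 := congrArg (fun l => l ξ) (HasFDerivAt.fderiv (f := localPush j N)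
    (hdj.clm_apply hN))
  simp only [add_apply, ContinuousLinearMap.comp_apply, ContinuousLinearMap.flip_apply] at h1
  have h2 := (h.fderiv_push hα).self_of_nhds ξ
  obtain ⟨c, hc⟩ := h.fderiv_normalizedAccel hα ξ
  have hR := h.isLocalFinsler.localCurvature_apply hmem (fderiv ℝ j y₀ ξ)
  have hself := h.isLocalFinsler.localConn_self hmem
  have hsplit : fderiv ℝ (localSpray f) (j y₀, localPush j N y₀)
      (fderiv ℝ j y₀ ξ, fderiv ℝ (normalized α (localPush j N)) y₀ ξ)
      = fderiv ℝ (localSpray f) (j y₀, localPush j N y₀) (fderiv ℝ j y₀ ξ, 0)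
        + localConn f (j y₀, localPush j N y₀)
          (fderiv ℝ (normalized α (localPush j N)) y₀ ξ) := by
    rw [← h.isLocalFinsler.fderiv_localSpray_inr hmem, ← map_add]
    simp
  -- Symmetry of `∂N/∂v` in its lower indices combined with homogeneity: the fibre derivative of the
  -- connection along `n` is the connection itself.
  have hconn : fderiv ℝ (localConn f) (j y₀, localPush j N y₀) (0, localPush j N y₀)
      (fderiv ℝ j y₀ ξ) = localConn f (j y₀, localPush j N y₀) (fderiv ℝ j y₀ ξ) := by
    have := h.isLocalFinsler.fderiv_localConn_self hmem (0, fderiv ℝ j y₀ ξ)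
    simp only [h.isLocalFinsler.fderiv_localSpray_inr hmem] at this
    rw [h.isLocalFinsler.fderiv_localConn_symm hmem, this]
    module
  simp only [hn, hα, one_smul, one_pow, mul_one] at h2 hκ0 
  -- The spray direction builds up the curvature through `localCurvature_apply`; the rest is a fibre
  -- multiple of `n`, to which `hconn` applies.
  have hacc : (localPush j N y₀, normalizedAccel f j (localPush j N) α y₀)
      = (localPush j N y₀, - (2 : ℝ) • localSpray f (j y₀, localPush j N y₀))
        + (2 * α (localSpray f (j y₀, localPush j N y₀))) • ((0 : E), localPush j N y₀) := by
    simp only [normalizedAccel, hn, hα, one_smul, Prod.smul_mk, Prod.mk_add_mk, smul_zero,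
      add_zero, Prod.mk.injEq, true_and]
    module
  rw [hacc]
  simp only [normalizedCovDeriv, localCovDeriv, hα, hn, one_smul, add_apply, sub_apply, smul_apply,
    ContinuousLinearMap.comp_apply, map_add, map_smul, hconn, hc, hsplit, hR, hκ0, hsymm (N y₀)]
  -- The second derivative of `j` is removed through `n = dj(N)`. The resulting multiple of `N(n) =
  -- 2G` cancels the spray term of the differentiated acceleration.
  have h3 : fderiv ℝ (fderiv ℝ j) y₀ ξ (N y₀) = fderiv ℝ (normalized α (localPush j N)) y₀ ξ
      + α (fderiv ℝ (localPush j N) y₀ ξ) • localPush j N y₀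
      - fderiv ℝ j y₀ (fderiv ℝ N y₀ ξ) := by
    rw [← h2, h1]; abel
  simp only at hself
  rw [h3]
  simp only [map_add, map_sub, map_smul, hself]
  refine ⟨c, ?_⟩
  module

end Normalized

variable {κ : F → ℝ} (hκ : ∀ᶠ y in 𝓝 y₀,
  localCovDeriv f j (localPush j N) y (N y) = κ y • localPush j N y)
  {u : ℝ → F} {t₀ : ℝ} (hu : ∀ᶠ t in 𝓝 t₀, HasDerivAt u (N (u t)) t) (hu₀ : u t₀ = y₀)
include h hκ hu hu₀

/-- In a chart, the null Weingarten map is induced by a differentiable field `β` of endomorphisms,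
which satisfies the Riccati equation. -/
theorem exists_riccati [FiniteDimensional ℝ E] [FiniteDimensional ℝ F] :
    ∃ (β : ℝ → F →L[ℝ] F) (β' : F →L[ℝ] F), HasDerivAt β β' t₀ ∧
      (∀ᶠ t in 𝓝 t₀, ∀ ξ, ∃ c : ℝ, localCovDeriv f j (localPush j N) (u t) ξ
        = fderiv ℝ j (u t) (β t ξ + c • N (u t))) ∧
      ∀ ξ, ∃ c : ℝ, fderiv ℝ j y₀ (β' ξ - fderiv ℝ N y₀ (β t₀ ξ) + β t₀ (fderiv ℝ N y₀ ξ)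
          + β t₀ (β t₀ ξ) - κ y₀ • β t₀ ξ + c • N y₀)
        = - localCurvature f (j y₀, localPush j N y₀) (fderiv ℝ j y₀ ξ) := by
  have : CompleteSpace E := FiniteDimensional.complete ℝ E
  have : CompleteSpace F := FiniteDimensional.complete ℝ F
  obtain ⟨α₀, hα₀⟩ : ∃ α : E →L[ℝ] ℝ, α (localPush j N y₀) ≠ 0 := by
    obtain ⟨α, -, h1⟩ := exists_dual_vector ℝ (localPush j N y₀)
      (norm_ne_zero_iff.2 h.push_ne_zero.self_of_nhds)
    exact ⟨α, by simpa [h1] using h.push_ne_zero.self_of_nhds⟩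
  obtain ⟨α, hα⟩ : ∃ α : E →L[ℝ] ℝ, α (localPush j N y₀) = 1 :=
    ⟨(α₀ (localPush j N y₀))⁻¹ • α₀, by simp [hα₀]⟩
  -- With a left inverse `Q` of `dj` at `y₀`, the operator `Q ∘ dj` stays invertible nearby. Then `β
  -- = (Q ∘ dj)⁻¹ ∘ Q ∘ (α(n) D n̂)` is differentiable and solves `dj ∘ β = α(n) D n̂`, whose right
  -- side is tangent.
  obtain ⟨Q, hQ⟩ : ∃ Q : E →L[ℝ] F, Q.comp (fderiv ℝ j y₀) = ContinuousLinearMap.id ℝ F := by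
    obtain ⟨Q, hQ⟩ := LinearMap.exists_leftInverse_of_injective (fderiv ℝ j y₀).toLinearMap
      (LinearMap.ker_eq_bot.2 h.injective.self_of_nhds)
    exact ⟨LinearMap.toContinuousLinearMap Q, ContinuousLinearMap.ext fun ξ =>
      LinearMap.congr_fun hQ ξ⟩
  have hut := hu.self_of_nhds
  have huc : Tendsto u (𝓝 t₀) (𝓝 y₀) := hu₀ ▸ hut.continuousAt.tendsto
  have hdj : HasFDerivAt (fderiv ℝ j) (fderiv ℝ (fderiv ℝ j) y₀) (u t₀) := by
    rw [hu₀]; exact (h.contDiffAt_fderiv.differentiableAt (by simp)).hasFDerivAt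
  have hJ : HasDerivAt (fun t => fderiv ℝ j (u t)) (fderiv ℝ (fderiv ℝ j) y₀ (N y₀)) t₀ := by
    have := hdj.comp_hasDerivAt t₀ hut
    rwa [hu₀] at this
  have hQJ : HasDerivAt (fun t => Q.comp (fderiv ℝ j (u t))) _ t₀ :=
    (hasDerivAt_const t₀ Q).clm_comp hJ
  have hinv : ∀ᶠ t in 𝓝 t₀, (Q.comp (fderiv ℝ j (u t))).IsInvertible := by
    have h1 := ContinuousLinearEquiv.nhds (ContinuousLinearEquiv.refl ℝ F)
    have h2 := hQJ.continuousAt.tendsto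
    simp only [hu₀, hQ] at h2
    filter_upwards [h2.eventually h1] with t ht
    exact ht
  have hK := h.hasDerivAt_normalizedCovDeriv hα hκ hu hu₀
  obtain ⟨I', hI'⟩ : ∃ I', HasDerivAt (fun t => (Q.comp (fderiv ℝ j (u t))).inverse) I' t₀ := by
    have h1 := (hinv.self_of_nhds.contDiffAt_map_inverse (n := 1)).differentiableAt (by simp)
    have h2 := h1.hasFDerivAt.comp_hasDerivAt t₀ hQJ
    exact ⟨_, h2⟩
  obtain ⟨β', hβ⟩ : ∃ β', HasDerivAt (fun t => (Q.comp (fderiv ℝ j (u t))).inverse.comp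
      (Q.comp (normalizedCovDeriv f j (localPush j N) α (u t)))) β' t₀ :=
    ⟨_, hI'.clm_comp ((hasDerivAt_const t₀ Q).clm_comp hK)⟩
  set β : ℝ → F →L[ℝ] F := fun t => (Q.comp (fderiv ℝ j (u t))).inverse.comp
      (Q.comp (normalizedCovDeriv f j (localPush j N) α (u t))) with hβdef
  have hJβ : ∀ᶠ t in 𝓝 t₀, (fderiv ℝ j (u t)).comp (β t)
      = normalizedCovDeriv f j (localPush j N) α (u t) := by
    filter_upwards [hinv, huc.eventually (h.normalizedCovDeriv_mem_range hα)] with t h1 h2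
    ext ξ
    obtain ⟨η, hη⟩ := h2 ξ
    have h3 : β t ξ = η := by
      simp only [hβdef, ContinuousLinearMap.comp_apply, ← hη]
      exact h1.inverse_apply_self η
    rw [ContinuousLinearMap.comp_apply, h3, hη]
  refine ⟨β, β', hβ, ?_, fun ξ => ?_⟩
  · filter_upwards [hJβ, huc.eventually (h.localCovDeriv_eq hα)] with t h1 h2 ξ
    refine ⟨α (fderiv ℝ (localPush j N) (u t) ξ) * (α (localPush j N (u t)))⁻¹, ?_⟩
    rw [h2, ← h1, map_add, map_smul, normalized, smul_smul]
    rfl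
  · obtain ⟨c, hc⟩ := h.deriv_normalizedCovDeriv hα hκ ξ
    have h1 := congrArg (fun l => l ξ) ((hJ.clm_comp hβ).unique
      (hK.congr_of_eventuallyEq hJβ))
    simp only [hc, hu₀] at h1
    have h2 : ∀ ζ, fderiv ℝ j y₀ (β t₀ ζ) = normalizedCovDeriv f j (localPush j N) α y₀ ζ := by
      intro ζ
      rw [← hu₀, ← hJβ.self_of_nhds]; rfl
    have hN := (h.contDiffAt_field.differentiableAt (by simp)).hasFDerivAt
    have hdj' := (h.contDiffAt_fderiv.differentiableAt (by simp)).hasFDerivAt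
    have h3 := congrArg (fun l => l (β t₀ ξ)) (HasFDerivAt.fderiv (f := localPush j N)
      (hdj'.clm_apply hN))
    simp only [add_apply, ContinuousLinearMap.comp_apply, ContinuousLinearMap.flip_apply] at h1 h3
    rw [(h.contDiffAt.isSymmSndFDerivAt (by simp)).eq (N y₀)] at h1
    have h4 := (h.fderiv_push hα).self_of_nhds (β t₀ ξ)
    have h5 : normalizedCovDeriv f j (localPush j N) α y₀ (β t₀ ξ)
      = fderiv ℝ (normalized α (localPush j N)) y₀ (β t₀ ξ)
        + localConn f (j y₀, localPush j N y₀) (normalizedCovDeriv f j (localPush j N) α y₀ ξ) := by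
      simp only [normalizedCovDeriv, localCovDeriv, hα, normalized_base hα, one_smul] at h2 ⊢
      simp [h2]
    simp only [hα, normalized_base hα, one_smul] at h4
    -- The first part is the multiple of `n` by which `dn(β ξ)` exceeds `dn̂(β ξ)`; `c` is the
    -- multiple of `n` left in the derivative of `α(n) D n̂`.
    refine ⟨α (fderiv ℝ (localPush j N) y₀ (β t₀ ξ)) - c, ?_⟩
    have h6 : fderiv ℝ j y₀ (N y₀) = localPush j N y₀ := rfl
    simp only [map_add, map_sub, map_smul, h2, h5, h6]
    rw [eq_sub_of_add_eq' h1, eq_sub_of_add_eq h3.symm]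
    generalize α (fderiv ℝ (localPush j N) y₀ (β t₀ ξ)) = c' at h4 ⊢
    rw [h4]
    module

end IsLocalNull
end LocalRiccati

/-! ### Traces on quotients by a line -/

section Trace

variable {F V : Type*} [AddCommGroup F] [Module ℝ F] [FiniteDimensional ℝ F]
  [AddCommGroup V] [Module ℝ V] {q : F →ₗ[ℝ] V} {v : F}

/-- For a section `r` of `q`, `β` factors as `(β ∘ r) ∘ q` because it kills the kernel, while `b = q
∘ (β ∘ r)`; the two composites have the same trace. -/
theorem trace_eq_of_apply_eq_zero (hq : Function.Surjective q)
    (hker : ∀ ξ, q ξ = 0 ↔ ∃ c : ℝ, ξ = c • v) {β : F →ₗ[ℝ] F} {b : V →ₗ[ℝ] V}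
    (hb : ∀ ξ, b (q ξ) = q (β ξ)) (hv : β v = 0) :
    LinearMap.trace ℝ F β = LinearMap.trace ℝ V b := by
  have : FiniteDimensional ℝ V := Module.Finite.of_surjective q hq
  obtain ⟨r, hr⟩ := q.exists_rightInverse_of_surjective (LinearMap.range_eq_top.2 hq)
  have hr' : ∀ w, q (r w) = w := fun w => LinearMap.congr_fun hr w
  have h1 : β = (β ∘ₗ r) ∘ₗ q := by
    ext ξ
    obtain ⟨c, hc⟩ := (hker (ξ - r (q ξ))).1 (by rw [map_sub, hr', sub_self])
    have : β (ξ - r (q ξ)) = 0 := by rw [hc, map_smul, hv, smul_zero]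
    simpa [sub_eq_zero] using this
  have h2 : b = q ∘ₗ (β ∘ₗ r) := by
    ext w
    simp [← hb, hr']
  rw [h1, LinearMap.trace_comp_comm', ← h2]

theorem finrank_quotient_line (hq : Function.Surjective q)
    (hker : ∀ ξ, q ξ = 0 ↔ ∃ c : ℝ, ξ = c • v) (hv : v ≠ 0) :
    (Module.finrank ℝ V : ℝ) = Module.finrank ℝ F - 1 := by
  have h1 := q.finrank_range_add_finrank_ker
  have h2 : q.ker = Submodule.span ℝ {v} := by
    ext ξ
    rw [LinearMap.mem_ker, hker, Submodule.mem_span_singleton]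
    exact exists_congr fun c => eq_comm
  rw [LinearMap.range_eq_top.2 hq, finrank_top, h2, finrank_span_singleton hv] at h1
  rw [← h1]
  push_cast
  ring

/-- Subtracting `l • id` on both sides reduces to the case of a killed line; the term `l` is the
difference of the two dimensions. -/
theorem trace_eq_sub_of_apply_eq_smul (hq : Function.Surjective q)
    (hker : ∀ ξ, q ξ = 0 ↔ ∃ c : ℝ, ξ = c • v) (hv0 : v ≠ 0) {β : F →ₗ[ℝ] F} {b : V →ₗ[ℝ] V}
    (hb : ∀ ξ, b (q ξ) = q (β ξ)) {l : ℝ} (hv : β v = l • v) :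
    LinearMap.trace ℝ V b = LinearMap.trace ℝ F β - l := by
  have : FiniteDimensional ℝ V := Module.Finite.of_surjective q hq
  have h := trace_eq_of_apply_eq_zero hq hker (β := β - l • LinearMap.id)
    (b := b - l • LinearMap.id) (fun ξ => by simp [hb]) (by simp [hv])
  simp only [map_sub, map_smul, LinearMap.trace_id, smul_eq_mul,
    finrank_quotient_line hq hker hv0] at h
  linarith

end Trace

/-- Shows that the default value in the definition is not taken. Injectivity of `J` makes the chosen
lift the only one. -/
theorem inducedEnd_mk {T T' : Type*} [AddCommGroup T] [Module ℝ T] [AddCommGroup T'] [Module ℝ T']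
    {J A : T →ₗ[ℝ] T'} {v : T} (hJ : Function.Injective J) (hA : ∀ X, ∃ Y, J Y = A X)
    (hv : ∃ c : ℝ, A v = c • J v) {X Y : T} (hXY : J Y = A X) :
    inducedEnd J A v (Submodule.Quotient.mk X) = Submodule.Quotient.mk Y := by
  have h : ∃ B : T →ₗ[ℝ] T, J ∘ₗ B = A ∧
      Submodule.span ℝ {v} ≤ (Submodule.span ℝ {v}).comap B := by
    let e := LinearEquiv.ofInjective J hJ
    have hA' : ∀ X, A X ∈ J.range := fun X => hA X
    refine ⟨e.symm.toLinearMap ∘ₗ A.codRestrict _ hA', ?_, ?_⟩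
    · ext X
      have := e.apply_symm_apply (A.codRestrict _ hA' X)
      exact congrArg Subtype.val this
    · rw [Submodule.span_singleton_le_iff_mem, Submodule.mem_comap,
        Submodule.mem_span_singleton]
      obtain ⟨c, hc⟩ := hv
      refine ⟨c, ?_⟩
      apply e.injective
      rw [LinearMap.comp_apply, LinearEquiv.coe_coe, e.apply_symm_apply]
      apply Subtype.ext
      rw [LinearMap.codRestrict_apply, hc, map_smul]
      rfl
  rw [inducedEnd, dif_pos h, Submodule.mapQ_apply]
  congr 1
  apply hJ
  exact (LinearMap.congr_fun h.choose_spec.1 X).trans hXY.symm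

/-! ### Sections of a quotient bundle along a curve -/

section Frame

open Filter

variable {F : Type*} [NormedAddCommGroup F] [NormedSpace ℝ F]
  {V : ℝ → Type*} [∀ t, AddCommGroup (V t)] [∀ t, Module ℝ (V t)]

/-- The maps `q t : F → V t` are, for `t` near `t₀`, quotient maps by the line spanned by `ν t`, and
this line is parallel at `t₀` for the derivative `ξ ↦ ξ' + D ξ`. -/
structure IsQuotientFrame (q : ∀ t, F →ₗ[ℝ] V t) (ν : ℝ → F) (D : F →L[ℝ] F) (t₀ : ℝ) : Prop where
  surjective : ∀ᶠ t in 𝓝 t₀, Function.Surjective (q t)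
  ker : ∀ᶠ t in 𝓝 t₀, ∀ ξ, q t ξ = 0 ↔ ∃ c : ℝ, ξ = c • ν t
  hasDerivAt : ∃ μ : ℝ, HasDerivAt ν (μ • ν t₀ - D (ν t₀)) t₀
  ne_zero : ∀ᶠ t in 𝓝 t₀, ν t ≠ 0

/-- The derivative at `t₀` of a section of `V`, induced by `ξ ↦ ξ' + D ξ`. -/
def HasFrameDerivAt (q : ∀ t, F →ₗ[ℝ] V t) (D : F →L[ℝ] F) (t₀ : ℝ) (X : ∀ t, V t) (Z : V t₀) :
    Prop :=
  ∃ (ξ : ℝ → F) (ξ' : F), HasDerivAt ξ ξ' t₀ ∧ (∀ᶠ t in 𝓝 t₀, X t = q t (ξ t)) ∧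
    Z = q t₀ (ξ' + D (ξ t₀))

variable {q : ∀ t, F →ₗ[ℝ] V t} {ν : ℝ → F} {D : F →L[ℝ] F} {t₀ : ℝ}

/-- Leibniz rule: `(β ξ)' + D β ξ = (β' + [D, β]) ξ + β (ξ' + D ξ)`. -/
theorem HasFrameDerivAt.apply_end {X : ∀ t, V t} {Z : V t₀} (h : HasFrameDerivAt q D t₀ X Z)
    {B : ∀ t, V t →ₗ[ℝ] V t} {β : ℝ → F →L[ℝ] F} {β' : F →L[ℝ] F} (hβ : HasDerivAt β β' t₀)
    (hB : ∀ᶠ t in 𝓝 t₀, ∀ ξ, B t (q t ξ) = q t (β t ξ)) {B₁ : V t₀ →ₗ[ℝ] V t₀}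
    (hB₁ : ∀ ξ, B₁ (q t₀ ξ) = q t₀ (β' ξ + D (β t₀ ξ) - β t₀ (D ξ))) :
    HasFrameDerivAt q D t₀ (fun t => B t (X t)) (B₁ (X t₀) + B t₀ Z) := by
  obtain ⟨ξ, ξ', h1, h2, h3⟩ := h
  refine ⟨fun t => β t (ξ t), _, hβ.clm_apply h1, ?_, ?_⟩
  · filter_upwards [h2, hB] with t h4 h5
    rw [h4, h5]
  · rw [h2.self_of_nhds, hB₁, h3, hB.self_of_nhds, ← map_add]
    congr 1
    simp only [map_add]
    abel

namespace IsQuotientFrame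

variable (h : IsQuotientFrame q ν D t₀)
include h

theorem exists_hasFrameDerivAt (Z₀ : V t₀) :
    ∃ X Z, X t₀ = Z₀ ∧ HasFrameDerivAt q D t₀ X Z := by
  obtain ⟨ξ, rfl⟩ := h.surjective.self_of_nhds Z₀
  exact ⟨fun t => q t ξ, _, rfl, fun _ => ξ, 0, hasDerivAt_const t₀ ξ,
    Eventually.of_forall fun _ => rfl, rfl⟩

/-- A function which is a multiple of `ν` has a differentiable coefficient. -/
theorem exists_hasDerivAt_coeff {η : ℝ → F} {η' : F} (hη : HasDerivAt η η' t₀) {c : ℝ → ℝ}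
    (hc : ∀ᶠ t in 𝓝 t₀, η t = c t • ν t) : ∃ c', HasDerivAt c c' t₀ := by
  obtain ⟨μ, hμ⟩ := h.hasDerivAt
  have hν0 := h.ne_zero.self_of_nhds
  obtain ⟨α, -, h1⟩ := exists_dual_vector ℝ (ν t₀) (norm_ne_zero_iff.2 hν0)
  have hα : α (ν t₀) ≠ 0 := by simpa [h1] using hν0
  have h2 : HasDerivAt (fun t => α (ν t)) _ t₀ := α.hasFDerivAt.comp_hasDerivAt t₀ hμ
  have h3 : HasDerivAt (fun t => α (η t)) _ t₀ := α.hasFDerivAt.comp_hasDerivAt t₀ hη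
  refine ⟨_, (h3.div h2 hα).congr_of_eventuallyEq ?_⟩
  filter_upwards [hc, h2.continuousAt.eventually_ne hα] with t h4 h5
  simp only [Pi.div_apply]
  rw [h4, map_smul, smul_eq_mul, mul_div_assoc, div_self h5, mul_one]

/-- Two lifts differ by `c ν` with `c` differentiable, and `(c ν)' + D (c ν) = (c' + c μ) ν`
vanishes in the quotient because the line is parallel. -/
theorem hasFrameDerivAt_unique {X : ∀ t, V t} {Z Z' : V t₀} (h1 : HasFrameDerivAt q D t₀ X Z)
    (h2 : HasFrameDerivAt q D t₀ X Z') : Z = Z' := by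
  obtain ⟨ξ, ξ', hξ, hX, rfl⟩ := h1
  obtain ⟨η, η', hη, hX', rfl⟩ := h2
  have h3 : ∀ᶠ t in 𝓝 t₀, ∃ c : ℝ, ξ t - η t = c • ν t := by
    filter_upwards [hX, hX', h.ker] with t h4 h5 h6
    rw [← h6, map_sub, ← h4, ← h5, sub_self]
  obtain ⟨c, hc⟩ : ∃ c : ℝ → ℝ, ∀ᶠ t in 𝓝 t₀, ξ t - η t = c t • ν t := by
    classical
    refine ⟨fun t => if ht : ∃ c : ℝ, ξ t - η t = c • ν t then ht.choose else 0, ?_⟩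
    filter_upwards [h3] with t ht
    rw [dif_pos ht]
    exact ht.choose_spec
  obtain ⟨c', hc'⟩ := h.exists_hasDerivAt_coeff (hξ.sub hη) hc
  obtain ⟨μ, hμ⟩ := h.hasDerivAt
  have h4 := (hξ.sub hη).unique ((hc'.smul hμ).congr_of_eventuallyEq hc)
  rw [← sub_eq_zero, ← map_sub, h.ker.self_of_nhds]
  have h5 : ξ t₀ = c t₀ • ν t₀ + η t₀ := sub_eq_iff_eq_add.1 hc.self_of_nhds
  have h6 := sub_eq_iff_eq_add.1 h4
  refine ⟨c t₀ * μ + c', ?_⟩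
  rw [h6, h5]
  simp only [map_add, map_smul]
  module

/-- Upstairs the trace is `tr β - l`, with `l` the eigenvalue of `β` on `ν`. Differentiating `β ν =
l ν` along the parallel line shows that `β' + [D, β]` has eigenvalue `l'` on `ν`, and commutators
are traceless. -/
theorem hasDerivAt_trace [FiniteDimensional ℝ F] {B : ∀ t, V t →ₗ[ℝ] V t} {β : ℝ → F →L[ℝ] F}
    {β' : F →L[ℝ] F} (hβ : HasDerivAt β β' t₀)
    (hB : ∀ᶠ t in 𝓝 t₀, ∀ ξ, B t (q t ξ) = q t (β t ξ)) {B₁ : V t₀ →ₗ[ℝ] V t₀}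
    (hB₁ : ∀ ξ, B₁ (q t₀ ξ) = q t₀ (β' ξ + D (β t₀ ξ) - β t₀ (D ξ))) :
    HasDerivAt (fun t => LinearMap.trace ℝ (V t) (B t)) (LinearMap.trace ℝ (V t₀) B₁) t₀ := by
  have h3 : ∀ᶠ t in 𝓝 t₀, ∃ c : ℝ, β t (ν t) = c • ν t := by
    filter_upwards [hB, h.ker] with t h4 h5
    rw [← h5, ← h4, (h5 _).2 ⟨1, (one_smul ℝ _).symm⟩, map_zero]
  obtain ⟨l, hl⟩ : ∃ l : ℝ → ℝ, ∀ᶠ t in 𝓝 t₀, β t (ν t) = l t • ν t := by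
    classical
    refine ⟨fun t => if ht : ∃ c : ℝ, β t (ν t) = c • ν t then ht.choose else 0, ?_⟩
    filter_upwards [h3] with t ht
    rw [dif_pos ht]
    exact ht.choose_spec
  obtain ⟨μ, hμ⟩ := h.hasDerivAt
  obtain ⟨l', hl'⟩ := h.exists_hasDerivAt_coeff (hβ.clm_apply hμ) hl
  have h4 := (hβ.clm_apply hμ).unique ((hl'.smul hμ).congr_of_eventuallyEq hl)
  have hl0 := hl.self_of_nhds
  have h5 : (β'.toLinearMap + D.toLinearMap ∘ₗ (β t₀).toLinearMap
      - (β t₀).toLinearMap ∘ₗ D.toLinearMap) (ν t₀) = l' • ν t₀ := by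
    simp only [LinearMap.sub_apply, LinearMap.add_apply, LinearMap.comp_apply,
      ContinuousLinearMap.coe_coe]
    simp only [map_sub, map_smul, hl0] at h4
    rw [hl0, map_smul, eq_sub_of_add_eq h4]
    module
  have h6 := trace_eq_sub_of_apply_eq_smul h.surjective.self_of_nhds h.ker.self_of_nhds
    h.ne_zero.self_of_nhds (b := B₁) hB₁ h5
  rw [map_sub, map_add, LinearMap.trace_comp_comm', add_sub_cancel_right] at h6
  rw [h6]
  let τ : (F →L[ℝ] F) →L[ℝ] ℝ :=
    LinearMap.toContinuousLinearMap (LinearMap.trace ℝ F ∘ₗ ContinuousLinearMap.coeLM ℝ)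
  refine ((τ.hasFDerivAt.comp_hasDerivAt t₀ hβ).sub hl').congr_of_eventuallyEq ?_
  filter_upwards [hB, h.surjective, h.ker, h.ne_zero, hl] with t h7 h8 h9 h10 h11
  exact trace_eq_sub_of_apply_eq_smul h8 h9 h10 h7 h11

end IsQuotientFrame
end Frame

/-! ### Tangent coordinate changes -/

section TangentCoordChange

variable {E : Type*} [NormedAddCommGroup E] [NormedSpace ℝ E]
  {M : Type*} [TopologicalSpace M] [ChartedSpace E M] [IsManifold 𝓘(ℝ, E) 1 M]

theorem tangentCoordChange_left_inv {p q : M} (hq : q ∈ (extChartAt 𝓘(ℝ, E) p).source) (v : E) :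
    tangentCoordChange 𝓘(ℝ, E) p q q (tangentCoordChange 𝓘(ℝ, E) q p q v) = v := by
  have hqq := mem_extChartAt_source (I := 𝓘(ℝ, E)) q
  rw [tangentCoordChange_comp ⟨⟨hqq, hq⟩, hqq⟩, tangentCoordChange_self hqq]

theorem tangentCoordChange_right_inv {p q : M} (hq : q ∈ (extChartAt 𝓘(ℝ, E) p).source) (v : E) :
    tangentCoordChange 𝓘(ℝ, E) q p q (tangentCoordChange 𝓘(ℝ, E) p q q v) = v := by
  have hqq := mem_extChartAt_source (I := 𝓘(ℝ, E)) q
  rw [tangentCoordChange_comp ⟨⟨hq, hqq⟩, hq⟩, tangentCoordChange_self hq]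

/-- The components in the preferred chart at `p` of a tangent vector at `q`. -/
def toChart (p q : M) : TangentSpace 𝓘(ℝ, E) q →L[ℝ] E :=
  (tangentCoordChange 𝓘(ℝ, E) q p q : E →L[ℝ] E)

/-- The tangent vector at `q` with given components in the preferred chart at `p`. -/
def ofChart (p q : M) : E →L[ℝ] TangentSpace 𝓘(ℝ, E) q :=
  (tangentCoordChange 𝓘(ℝ, E) p q q : E →L[ℝ] E)

theorem ofChart_toChart {p q : M} (hq : q ∈ (extChartAt 𝓘(ℝ, E) p).source)
    (v : TangentSpace 𝓘(ℝ, E) q) : ofChart p q (toChart p q v) = v :=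
  tangentCoordChange_left_inv hq v

theorem toChart_ofChart {p q : M} (hq : q ∈ (extChartAt 𝓘(ℝ, E) p).source) (v : E) :
    toChart p q (ofChart p q v) = v :=
  tangentCoordChange_right_inv hq v

theorem toChart_injective {p q : M} (hq : q ∈ (extChartAt 𝓘(ℝ, E) p).source) :
    Function.Injective (toChart (E := E) p q) :=
  Function.LeftInverse.injective (g := ofChart p q) (ofChart_toChart hq)

theorem ofChart_injective {p q : M} (hq : q ∈ (extChartAt 𝓘(ℝ, E) p).source) :
    Function.Injective (ofChart (E := E) p q) :=
  Function.LeftInverse.injective (g := toChart p q) (toChart_ofChart hq)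

theorem toChart_ne_zero {p q : M} (hq : q ∈ (extChartAt 𝓘(ℝ, E) p).source)
    {v : TangentSpace 𝓘(ℝ, E) q} (hv : v ≠ 0) : toChart p q v ≠ 0 := fun h0 =>
  hv (toChart_injective hq (h0.trans (map_zero _).symm))

theorem ofChart_ne_zero {p q : M} (hq : q ∈ (extChartAt 𝓘(ℝ, E) p).source)
    {v : E} (hv : v ≠ 0) : ofChart p q v ≠ 0 := fun h0 =>
  hv (ofChart_injective hq (h0.trans (map_zero _).symm))

theorem ofChart_self (p : M) (v : E) : ofChart (E := E) p p v = v := by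
  have h : tangentCoordChange 𝓘(ℝ, E) p p p v = v :=
    tangentCoordChange_self (mem_extChartAt_source p)
  exact h

theorem toChart_self (p : M) (v : E) : toChart (E := E) p p v = v :=
  ofChart_self p v

theorem tangentCoordChange_isInvertible {p q r : M} (hp : r ∈ (extChartAt 𝓘(ℝ, E) p).source)
    (hq : r ∈ (extChartAt 𝓘(ℝ, E) q).source) :
    (tangentCoordChange 𝓘(ℝ, E) p q r).IsInvertible := by
  refine ContinuousLinearMap.IsInvertible.of_inverse (g := tangentCoordChange 𝓘(ℝ, E) q p r)
    (ContinuousLinearMap.ext fun v => ?_) (ContinuousLinearMap.ext fun v => ?_)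
  · simp only [ContinuousLinearMap.comp_apply, ContinuousLinearMap.id_apply]
    rw [tangentCoordChange_comp ⟨⟨hq, hp⟩, hq⟩, tangentCoordChange_self hq]
  · simp only [ContinuousLinearMap.comp_apply, ContinuousLinearMap.id_apply]
    rw [tangentCoordChange_comp ⟨⟨hp, hq⟩, hp⟩, tangentCoordChange_self hp]

theorem hasFDerivAt_transition {p q r : M} (hp : r ∈ (extChartAt 𝓘(ℝ, E) p).source)
    (hq : r ∈ (extChartAt 𝓘(ℝ, E) q).source) :
    HasFDerivAt (extChartAt 𝓘(ℝ, E) q ∘ (extChartAt 𝓘(ℝ, E) p).symm)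
      (tangentCoordChange 𝓘(ℝ, E) p q r) (extChartAt 𝓘(ℝ, E) p r) := by
  have := hasFDerivWithinAt_tangentCoordChange (I := 𝓘(ℝ, E)) (x := p) (y := q) ⟨hp, hq⟩
  simpa using this

theorem hasMFDerivAt_extChartAt_toChart {p q : M}
    (hq : q ∈ (extChartAt 𝓘(ℝ, E) p).source) :
    HasMFDerivAt 𝓘(ℝ, E) 𝓘(ℝ, E) (extChartAt 𝓘(ℝ, E) p) q (toChart p q) := by
  rw [extChartAt_source] at hq
  have := hasMFDerivAt_extChartAt (I := 𝓘(ℝ, E)) hq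
  rwa [mfderiv_chartAt_eq_tangentCoordChange hq] at this

/-- The differential of a vector-valued map, computed in a chart. -/
theorem hasMFDerivAt_of_hasFDerivAt {X : Type*} [NormedAddCommGroup X] [NormedSpace ℝ X] {p q : M}
    (hq : q ∈ (extChartAt 𝓘(ℝ, E) p).source) {h : M → X} {h' : E →L[ℝ] X}
    (hd : HasFDerivAt (h ∘ (extChartAt 𝓘(ℝ, E) p).symm) h' (extChartAt 𝓘(ℝ, E) p q)) :
    HasMFDerivAt 𝓘(ℝ, E) 𝓘(ℝ, X) h q (h'.comp (toChart p q)) := by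
  have h1 := HasMFDerivAt.comp q hd.hasMFDerivAt (hasMFDerivAt_extChartAt_toChart hq)
  refine h1.congr_of_eventuallyEq ?_
  filter_upwards [extChartAt_source_mem_nhds' hq] with q' hq'
  rw [Function.comp_apply, Function.comp_apply, (extChartAt 𝓘(ℝ, E) p).left_inv hq']

/-- The differential of a map between manifolds, computed in charts. -/
theorem toChart_mfderiv {F : Type*} [NormedAddCommGroup F] [NormedSpace ℝ F]
    {S : Type*} [TopologicalSpace S] [ChartedSpace F S] [IsManifold 𝓘(ℝ, F) 1 S]
    {ι : S → M} {s₀ s : S} {p : M} (hs : s ∈ (extChartAt 𝓘(ℝ, F) s₀).source)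
    (hp : ι s ∈ (extChartAt 𝓘(ℝ, E) p).source) (hd : MDifferentiableAt 𝓘(ℝ, F) 𝓘(ℝ, E) ι s)
    {j : F → E} (hj : j = extChartAt 𝓘(ℝ, E) p ∘ ι ∘ (extChartAt 𝓘(ℝ, F) s₀).symm)
    (hjd : DifferentiableAt ℝ j (extChartAt 𝓘(ℝ, F) s₀ s)) (X : TangentSpace 𝓘(ℝ, F) s) :
    toChart p (ι s) (mfderiv 𝓘(ℝ, F) 𝓘(ℝ, E) ι s X)
      = fderiv ℝ j (extChartAt 𝓘(ℝ, F) s₀ s) (toChart s₀ s X) := by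
  subst hj
  have h1 := (hasMFDerivAt_extChartAt_toChart hp).comp s hd.hasMFDerivAt
  have h2 := hasMFDerivAt_of_hasFDerivAt (h := extChartAt 𝓘(ℝ, E) p ∘ ι) hs hjd.hasFDerivAt
  exact congrArg (fun l => l X) (hasMFDerivAt_unique h1 h2)

end TangentCoordChange

/-! ### The Lagrangian in a chart -/

section InChart

variable {E : Type*} [NormedAddCommGroup E] [NormedSpace ℝ E]
  {M : Type*} [TopologicalSpace M] [ChartedSpace E M] [IsManifold 𝓘(ℝ, E) ∞ M]
  {L : TangentBundle 𝓘(ℝ, E) M → ℝ}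

theorem inChart_apply (p : M) (x v : E) : inChart L p (x, v)
    = L ⟨(extChartAt 𝓘(ℝ, E) p).symm x, ofChart p ((extChartAt 𝓘(ℝ, E) p).symm x) v⟩ := by
  rw [inChart]
  congr 1

theorem inChart_extChartAt {p q : M} (hq : q ∈ (extChartAt 𝓘(ℝ, E) p).source) (v : E) :
    inChart L p (extChartAt 𝓘(ℝ, E) p q, v) = L ⟨q, ofChart p q v⟩ := by
  rw [inChart_apply, (extChartAt 𝓘(ℝ, E) p).left_inv hq]

theorem inChart_self (p : M) (v : E) : inChart L p (extChartAt 𝓘(ℝ, E) p p, v) = L ⟨p, v⟩ := by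
  rw [inChart_extChartAt (mem_extChartAt_source p), ofChart_self]

theorem metric_eq_localMetric (p : M) (v : TangentSpace 𝓘(ℝ, E) p) :
    metric L p v = localMetric (inChart L p) (extChartAt 𝓘(ℝ, E) p p, v) := by
  simp only [metric, localMetric, inChart_self]

/-- The change of fibre coordinates over a fixed point is linear, so Hessians transform as bilinear
forms. -/
theorem localMetric_inChart {p q : M} (hq : q ∈ (extChartAt 𝓘(ℝ, E) p).source) (v a b : E) :
    localMetric (inChart L p) (extChartAt 𝓘(ℝ, E) p q, v) a b
      = metric L q (ofChart p q v) (ofChart p q a) (ofChart p q b) := by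
  obtain ⟨C, hC⟩ := tangentCoordChange_isInvertible hq (mem_extChartAt_source (I := 𝓘(ℝ, E)) q)
  have h1 : (fun w => fderiv ℝ (fun u => inChart L p (extChartAt 𝓘(ℝ, E) p q, u)) w)
      = (ContinuousLinearEquiv.arrowCongr C.symm (ContinuousLinearEquiv.refl ℝ ℝ)) ∘
        (fun w => fderiv ℝ (fun u : E => L ⟨q, u⟩) w) ∘ C := by
    funext w
    have : (fun u => inChart L p (extChartAt 𝓘(ℝ, E) p q, u)) = (fun u : E => L ⟨q, u⟩) ∘ C := by
      funext u
      rw [inChart_extChartAt hq, ofChart, ← hC]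
      rfl
    rw [this, C.comp_right_fderiv]
    rfl
  rw [localMetric, h1, ContinuousLinearEquiv.comp_fderiv, C.comp_right_fderiv, ofChart, ← hC]
  rfl

theorem contDiffOn_inChart (hL : IsLorentzFinsler L) (p : M) :
    ContDiffOn ℝ 4 (inChart L p) ((extChartAt 𝓘(ℝ, E) p).target ×ˢ {0}ᶜ) := by
  have h1 := contMDiffOn_extChartAt_symm (I := 𝓘(ℝ, E).tangent) (n := 4)
    (⟨p, 0⟩ : TangentBundle 𝓘(ℝ, E) M)
  have h2 := hL.contMDiffOn.comp (h1.mono (t := (extChartAt 𝓘(ℝ, E) p).target ×ˢ {0}ᶜ) ?_) ?_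
  · exact contMDiffOn_iff_contDiffOn.1 h2
  · rintro ⟨x, v⟩ ⟨hx, -⟩
    rw [extChartAt_target]
    rw [extChartAt_target] at hx
    exact ⟨(TangentBundle.mem_chart_target_iff _ _).2 hx.1, ⟨(x, v), rfl⟩⟩
  · rintro ⟨x, v⟩ ⟨hx, hv⟩ h0
    exact ofChart_ne_zero ((extChartAt 𝓘(ℝ, E) p).map_target hx) hv h0

theorem isLocalFinsler_inChart [FiniteDimensional ℝ E] (hL : IsLorentzFinsler L) (p : M) :
    IsLocalFinsler (inChart L p) (extChartAt 𝓘(ℝ, E) p).target where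
  isOpen := isOpen_extChartAt_target p
  contDiffOn := contDiffOn_inChart hL p
  homogeneous := by
    intro x hx v hv s hs
    have hq := (extChartAt 𝓘(ℝ, E) p).map_target hx
    rw [inChart_apply, inChart_apply, map_smul]
    exact hL.homogeneous _ _ (ofChart_ne_zero hq hv) s hs
  invertible := by
    rintro ⟨x, v⟩ ⟨hx, hv⟩
    obtain ⟨q, hq, rfl⟩ : ∃ q ∈ (extChartAt 𝓘(ℝ, E) p).source, extChartAt 𝓘(ℝ, E) p q = x :=
      ⟨_, (extChartAt 𝓘(ℝ, E) p).map_target hx, (extChartAt 𝓘(ℝ, E) p).right_inv hx⟩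
    have hv' : ofChart p q v ≠ 0 := ofChart_ne_zero hq hv
    have hsymm : ∀ a b, localMetric (inChart L p) (extChartAt 𝓘(ℝ, E) p q, v) a b
        = localMetric (inChart L p) (extChartAt 𝓘(ℝ, E) p q, v) b a := by
      have h1 : ContDiffAt ℝ 4 (inChart L p) (extChartAt 𝓘(ℝ, E) p q, v) :=
        (contDiffOn_inChart hL p).contDiffAt
          (((isOpen_extChartAt_target p).prod isOpen_compl_singleton).mem_nhds ⟨hx, hv⟩)
      have h2 : ContDiffAt ℝ 4 (fun u => inChart L p (extChartAt 𝓘(ℝ, E) p q, u)) v :=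
        ContDiffAt.comp v (g := inChart L p) h1 (contDiffAt_const.prodMk contDiffAt_id)
      intro a b
      exact ((h2.of_le (m := 2) (by norm_num)).isSymmSndFDerivAt (by simp)).eq a b
    obtain ⟨u, hu, hpos⟩ := hL.lorentzian q _ hv'
    obtain ⟨u, rfl⟩ : ∃ u', ofChart p q u' = u := ⟨toChart p q u, ofChart_toChart hq u⟩
    -- A vector in the kernel is orthogonal to the negative vector `u`; if it were non-zero, the
    -- form would be positive on it, yet it vanishes there.
    have hinj : Function.Injective (localMetric (inChart L p) (extChartAt 𝓘(ℝ, E) p q, v)) := by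
      rw [injective_iff_map_eq_zero]
      intro a ha
      by_contra ha0
      have hu' : localMetric (inChart L p) (extChartAt 𝓘(ℝ, E) p q, v) u a = 0 := by
        rw [hsymm, ha]
        rfl
      rw [localMetric_inChart hq] at hu'
      have h3 := hpos (ofChart p q a) (ofChart_ne_zero hq ha0) hu'
      rw [← localMetric_inChart hq, ha] at h3
      exact lt_irrefl _ h3
    have hfin : Module.finrank ℝ E = Module.finrank ℝ (E →L[ℝ] ℝ) := by
      rw [← (LinearMap.toContinuousLinearMap (𝕜 := ℝ) (E := E) (F' := ℝ)).finrank_eq]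
      exact Subspace.dual_finrank_eq.symm
    refine ⟨(LinearEquiv.ofInjectiveOfFinrankEq (localMetric (inChart L p)
      (extChartAt 𝓘(ℝ, E) p q, v)).toLinearMap hinj hfin).toContinuousLinearEquiv, ?_⟩
    ext a b
    rfl

theorem IsLocalFinsler.mono {f : E × E → ℝ} {U U' : Set E} (hf : IsLocalFinsler f U)
    (hU' : IsOpen U') (h : U' ⊆ U) : IsLocalFinsler f U' where
  isOpen := hU'
  contDiffOn := hf.contDiffOn.mono (Set.prod_mono h subset_rfl)
  homogeneous x hx := hf.homogeneous x (h hx)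
  invertible z hz := hf.invertible z ⟨h hz.1, hz.2⟩

/-- Links the varying preferred charts in which `covDeriv` is defined to the single chart in which
it is differentiated along a generator. -/
theorem isCoordChange_inChart (L : TangentBundle 𝓘(ℝ, E) M → ℝ) (p q : M) :
    IsCoordChange (inChart L p) (inChart L q) (extChartAt 𝓘(ℝ, E) p).target
      ((extChartAt 𝓘(ℝ, E) q).symm ≫ extChartAt 𝓘(ℝ, E) p).source
      (extChartAt 𝓘(ℝ, E) p ∘ (extChartAt 𝓘(ℝ, E) q).symm) where
  contDiffAt x hx := by
    have := contDiffWithinAt_ext_coord_change (I := 𝓘(ℝ, E)) (n := 3) p q hx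
    simpa [contDiffWithinAt_univ] using this
  mapsTo x hx := (extChartAt 𝓘(ℝ, E) p).map_source hx.2
  invertible x hx := by
    have h1 := hasFDerivAt_transition ((extChartAt 𝓘(ℝ, E) q).map_target hx.1) hx.2
    rw [(extChartAt 𝓘(ℝ, E) q).right_inv hx.1] at h1
    rw [h1.fderiv]
    exact tangentCoordChange_isInvertible ((extChartAt 𝓘(ℝ, E) q).map_target hx.1) hx.2
  comp x hx v := by
    have hr := (extChartAt 𝓘(ℝ, E) q).map_target hx.1
    have h1 := hasFDerivAt_transition hr hx.2
    rw [(extChartAt 𝓘(ℝ, E) q).right_inv hx.1] at h1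
    have hr' : (extChartAt 𝓘(ℝ, E) q).symm x ∈ (extChartAt 𝓘(ℝ, E) p).source := hx.2
    rw [prolong, h1.fderiv, inChart_apply, Function.comp_apply, inChart_extChartAt hr']
    exact congrArg (fun w : E => L ⟨(extChartAt 𝓘(ℝ, E) q).symm x, w⟩)
      (tangentCoordChange_comp ⟨⟨hr, hr'⟩, mem_extChartAt_source _⟩).symm

end InChart

/-! ### Null hypersurfaces in charts -/

section HypersurfaceInChart

open Filter

variable {E : Type*} [NormedAddCommGroup E] [NormedSpace ℝ E]
  {M : Type*} [TopologicalSpace M] [ChartedSpace E M] [IsManifold 𝓘(ℝ, E) ∞ M]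
  {F : Type*} [NormedAddCommGroup F] [NormedSpace ℝ F]
  {S : Type*} [TopologicalSpace S] [ChartedSpace F S] [IsManifold 𝓘(ℝ, F) 2 S]

omit [IsManifold 𝓘(ℝ, E) ∞ M] in
theorem toChart_eq_fderiv [IsManifold 𝓘(ℝ, E) 1 M] {p q r : M}
    (hp : r ∈ (extChartAt 𝓘(ℝ, E) p).source) (hq : r ∈ (extChartAt 𝓘(ℝ, E) q).source)
    (v : TangentSpace 𝓘(ℝ, E) r) :
    toChart q r v = fderiv ℝ (extChartAt 𝓘(ℝ, E) q ∘ (extChartAt 𝓘(ℝ, E) p).symm)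
      (extChartAt 𝓘(ℝ, E) p r) (toChart p r v) := by
  rw [(hasFDerivAt_transition hp hq).fderiv]
  exact (tangentCoordChange_comp ⟨⟨mem_extChartAt_source _, hp⟩, hq⟩).symm

/-- The local covariant derivative of a vector field along a map is invariant under changes of
coordinates. -/
theorem IsCoordChange.localCovDeriv_comp [FiniteDimensional ℝ E] {f f₁ : E × E → ℝ} {U U₁ : Set E}
    {φ : E → E} (h : IsCoordChange f f₁ U U₁ φ) (hf : IsLocalFinsler f U)
    (hf₁ : IsLocalFinsler f₁ U₁) {j j₁ n m : F → E} {y : F} (hy : j₁ y ∈ U₁) (hm : m y ≠ 0)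
    (hj₁d : DifferentiableAt ℝ j₁ y) (hmd : DifferentiableAt ℝ m y) (hj : j =ᶠ[𝓝 y] φ ∘ j₁)
    (hn : n =ᶠ[𝓝 y] fun y' => fderiv ℝ φ (j₁ y') (m y')) (ξ : F) :
    localCovDeriv f j n y ξ = fderiv ℝ φ (j₁ y) (localCovDeriv f₁ j₁ m y ξ) := by
  have hφ := h.contDiffAt (j₁ y) hy
  have hφ' : DifferentiableAt ℝ (fderiv ℝ φ) (j₁ y) :=
    (hφ.fderiv_right (m := 1) (by norm_num)).differentiableAt (by simp)
  have h1 : fderiv ℝ j y = (fderiv ℝ φ (j₁ y)).comp (fderiv ℝ j₁ y) := by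
    rw [hj.fderiv_eq, _root_.fderiv_comp y (hφ.differentiableAt (by simp)) hj₁d]
  have h2 : fderiv ℝ n y ξ = fderiv ℝ (fderiv ℝ φ) (j₁ y) (fderiv ℝ j₁ y ξ) (m y)
      + fderiv ℝ φ (j₁ y) (fderiv ℝ m y ξ) := by
    have h3 := (hφ'.hasFDerivAt.comp y hj₁d.hasFDerivAt).clm_apply hmd.hasFDerivAt
    rw [hn.fderiv_eq]
    refine (congrArg (fun l => l ξ) h3.fderiv).trans ?_
    simp [add_comm]
  have h3 : (j y, n y) = prolong φ (j₁ y, m y) := by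
    rw [prolong, hj.self_of_nhds, hn.self_of_nhds]
    rfl
  -- The inhomogeneous term of this law cancels the `d²φ` term of `dn`.
  have h4 := h.localConn_comp hf hf₁ (z := (j₁ y, m y)) ⟨hy, hm⟩ (fderiv ℝ j₁ y ξ)
  simp only [localCovDeriv, _root_.add_apply, ContinuousLinearMap.comp_apply, h1, h2,
    h3, map_add]
  rw [h4]
  abel

/-- The map `ι` in the preferred charts at `s₀` and `ι s₀`. -/
def mapInChart (E : Type*) [NormedAddCommGroup E] [NormedSpace ℝ E]
    {M : Type*} [TopologicalSpace M] [ChartedSpace E M] (ι : S → M) (s₀ : S) : F → E :=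
  extChartAt 𝓘(ℝ, E) (ι s₀) ∘ ι ∘ (extChartAt 𝓘(ℝ, F) s₀).symm

/-- The components of the vector field `N` in the preferred chart at `s₀`. -/
def fieldInChart (N : ∀ s : S, TangentSpace 𝓘(ℝ, F) s) (s₀ : S) (y : F) : F :=
  toChart s₀ ((extChartAt 𝓘(ℝ, F) s₀).symm y) (N ((extChartAt 𝓘(ℝ, F) s₀).symm y))

/-- The Lagrangian vanishes on lightlike vectors. -/
theorem lagrangian_eq_zero [FiniteDimensional ℝ E] {L : TangentBundle 𝓘(ℝ, E) M → ℝ}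
    (hL : IsLorentzFinsler L) {p : M} {v : TangentSpace 𝓘(ℝ, E) p} (hv : v ≠ 0)
    (h : metric L p v v v = 0) : L ⟨p, v⟩ = 0 := by
  have hf := isLocalFinsler_inChart hL p
  have hz : (extChartAt 𝓘(ℝ, E) p p, (v : E)) ∈ (extChartAt 𝓘(ℝ, E) p).target ×ˢ ({0}ᶜ : Set E) :=
    ⟨mem_extChartAt_target p, hv⟩
  have h1 := hf.localMomentum_self hz
  rw [← hf.localMetric_self hz] at h1
  rw [metric_eq_localMetric] at h
  have h2 : 2 * L ⟨p, v⟩ = 0 := by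
    rw [← inChart_self (L := L) p v]
    exact h1.symm.trans h
  linarith

/-- The fibre derivative of the Lagrangian in a chart. -/
theorem localMomentum_inChart [FiniteDimensional ℝ E] {L : TangentBundle 𝓘(ℝ, E) M → ℝ}
    (hL : IsLorentzFinsler L) {p q : M} (hq : q ∈ (extChartAt 𝓘(ℝ, E) p).source) {v : E}
    (hv : v ≠ 0) (w : E) :
    localMomentum (inChart L p) (extChartAt 𝓘(ℝ, E) p q, v) w
      = metric L q (ofChart p q v) (ofChart p q v) (ofChart p q w) := by
  rw [← (isLocalFinsler_inChart hL p).localMetric_self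
      (z := (extChartAt 𝓘(ℝ, E) p q, v)) ⟨(extChartAt 𝓘(ℝ, E) p).map_source hq, hv⟩,
    localMetric_inChart hq]

variable {L : TangentBundle 𝓘(ℝ, E) M → ℝ} {ι : S → M} {N : ∀ s : S, TangentSpace 𝓘(ℝ, F) s}

namespace IsNullHypersurface

variable (hS : IsNullHypersurface L ι N) (s₀ : S)
include hS

omit [IsManifold 𝓘(ℝ, E) ∞ M] in
theorem mdifferentiableAt (s : S) : MDifferentiableAt 𝓘(ℝ, F) 𝓘(ℝ, E) ι s :=
  (hS.contMDiff s).mdifferentiableAt (by norm_num)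

omit [IsManifold 𝓘(ℝ, E) ∞ M] in
theorem contDiffAt_mapInChart :
    ContDiffAt ℝ 2 (mapInChart E ι s₀) (extChartAt 𝓘(ℝ, F) s₀ s₀) := by
  have h := (contMDiffAt_iff.1 (hS.contMDiff s₀)).2
  rw [ModelWithCorners.range_eq_univ, contDiffWithinAt_univ] at h
  exact h

omit [IsManifold 𝓘(ℝ, E) ∞ M] in
theorem contDiffAt_fieldInChart :
    ContDiffAt ℝ 1 (fieldInChart N s₀) (extChartAt 𝓘(ℝ, F) s₀ s₀) := by
  have h := (contMDiffAt_iff.1 (hS.contMDiff_field s₀)).2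
  rw [ModelWithCorners.range_eq_univ, contDiffWithinAt_univ] at h
  exact contDiffAt_snd.comp (extChartAt 𝓘(ℝ, F) s₀ s₀) h

omit [IsManifold 𝓘(ℝ, E) ∞ M] in
theorem eventually_source : ∀ᶠ s in 𝓝 s₀, s ∈ (extChartAt 𝓘(ℝ, F) s₀).source ∧
    ι s ∈ (extChartAt 𝓘(ℝ, E) (ι s₀)).source ∧
    DifferentiableAt ℝ (mapInChart E ι s₀) (extChartAt 𝓘(ℝ, F) s₀ s) := by
  filter_upwards [extChartAt_source_mem_nhds (I := 𝓘(ℝ, F)) s₀,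
    (hS.contMDiff.continuous.continuousAt (x := s₀)).eventually
      (extChartAt_source_mem_nhds (I := 𝓘(ℝ, E)) (ι s₀)),
    (continuousAt_extChartAt (I := 𝓘(ℝ, F)) s₀).eventually
      ((hS.contDiffAt_mapInChart s₀).eventually (by simp))] with s h1 h2 h3
  exact ⟨h1, h2, h3.differentiableAt (by simp)⟩

omit hS [IsManifold 𝓘(ℝ, F) 2 S] in
/-- Transfer of a property of points near `s₀` to the chart. -/
theorem eventually_chart {P : S → Prop} (h : ∀ᶠ s in 𝓝 s₀, P s) :
    ∀ᶠ y in 𝓝 (extChartAt 𝓘(ℝ, F) s₀ s₀), ∃ s, P s ∧ extChartAt 𝓘(ℝ, F) s₀ s = y ∧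
      (extChartAt 𝓘(ℝ, F) s₀).symm y = s := by
  have h1 := (continuousAt_extChartAt_symm (I := 𝓘(ℝ, F)) s₀).tendsto
  rw [extChartAt_to_inv] at h1
  filter_upwards [h1.eventually h, extChartAt_target_mem_nhds (I := 𝓘(ℝ, F)) s₀] with y h2 h3
  exact ⟨_, h2, (extChartAt 𝓘(ℝ, F) s₀).right_inv h3, rfl⟩

theorem toChart_mfderiv_apply : ∀ᶠ s in 𝓝 s₀, ∀ X : TangentSpace 𝓘(ℝ, F) s,
    toChart (ι s₀) (ι s) (mfderiv 𝓘(ℝ, F) 𝓘(ℝ, E) ι s X)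
      = fderiv ℝ (mapInChart E ι s₀) (extChartAt 𝓘(ℝ, F) s₀ s)
          (toChart s₀ s X) := by
  filter_upwards [hS.eventually_source s₀] with s h1 X
  exact toChart_mfderiv h1.1 h1.2.1 (hS.mdifferentiableAt s) rfl h1.2.2 X

theorem toChart_push : ∀ᶠ s in 𝓝 s₀,
    toChart (ι s₀) (ι s) (push (E := E) ι N s)
      = localPush (mapInChart E ι s₀) (fieldInChart N s₀) (extChartAt 𝓘(ℝ, F) s₀ s) := by
  filter_upwards [hS.toChart_mfderiv_apply s₀, hS.eventually_source s₀] with s h1 h2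
  rw [push, h1, localPush, fieldInChart, (extChartAt 𝓘(ℝ, F) s₀).left_inv h2.1]

omit [IsManifold 𝓘(ℝ, E) ∞ M] in
theorem push_ne_zero (s : S) : push (E := E) ι N s ≠ 0 := fun h0 =>
  hS.ne_zero s (hS.immersion s (h0.trans (map_zero _).symm))

/-- Euler's relations translate the hypotheses: `g_n(n, n) = 2𝓛(n)` turns lightlike into `f = 0`,
and `g_n(n, ·)` is the momentum. -/
theorem isLocalNull [FiniteDimensional ℝ E] (hL : IsLorentzFinsler L) :
    IsLocalNull (inChart L (ι s₀)) (extChartAt 𝓘(ℝ, E) (ι s₀)).target (mapInChart E ι s₀)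
      (fieldInChart N s₀) (extChartAt 𝓘(ℝ, F) s₀ s₀) where
  isLocalFinsler := isLocalFinsler_inChart hL (ι s₀)
  mem := by
    rw [mapInChart, Function.comp_apply, Function.comp_apply, extChartAt_to_inv]
    exact mem_extChartAt_target _
  contDiffAt := hS.contDiffAt_mapInChart s₀
  contDiffAt_field := hS.contDiffAt_fieldInChart s₀
  injective := by
    filter_upwards [eventually_chart s₀ ((hS.eventually_source s₀).and
      (hS.toChart_mfderiv_apply s₀))] with y hy
    obtain ⟨s, ⟨h1, h2⟩, rfl, -⟩ := hy
    intro a b hab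
    rw [← toChart_ofChart h1.1 a, ← toChart_ofChart h1.1 b,
      ← h2, ← h2] at hab
    have h3 := hS.immersion s (toChart_injective h1.2.1 hab)
    exact ofChart_injective h1.1 h3
  ne_zero := by
    filter_upwards [eventually_chart s₀ (hS.eventually_source s₀)] with y hy
    obtain ⟨s, h1, rfl, h2⟩ := hy
    rw [fieldInChart, h2]
    exact toChart_ne_zero h1.1 (hS.ne_zero s)
  lightlike := by
    filter_upwards [eventually_chart s₀ ((hS.eventually_source s₀).and
      (hS.toChart_push s₀))] with y hy
    obtain ⟨s, ⟨h1, h2⟩, rfl, h3⟩ := hy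
    rw [← h2, mapInChart, Function.comp_apply, Function.comp_apply, h3, inChart_extChartAt h1.2.1,
      ofChart_toChart h1.2.1]
    exact lagrangian_eq_zero hL (hS.push_ne_zero s) (hS.lightlike s)
  tangent := by
    filter_upwards [eventually_chart s₀ ((hS.eventually_source s₀).and
      ((hS.toChart_push s₀).and (hS.toChart_mfderiv_apply s₀)))] with y hy w
    obtain ⟨s, ⟨h1, h2, h4⟩, rfl, h3⟩ := hy
    have h5 : mapInChart E ι s₀ (extChartAt 𝓘(ℝ, F) s₀ s) = extChartAt 𝓘(ℝ, E) (ι s₀) (ι s) := by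
      rw [mapInChart, Function.comp_apply, Function.comp_apply, h3]
    rw [← h2, h5, localMomentum_inChart hL h1.2.1 (toChart_ne_zero h1.2.1 (hS.push_ne_zero s)),
      ofChart_toChart h1.2.1]
    refine Iff.trans ?_ (hS.tangent s (ofChart (ι s₀) (ι s) w))
    constructor
    · rintro ⟨η, hη⟩
      refine ⟨ofChart s₀ s η, ?_⟩
      apply toChart_injective h1.2.1
      rw [h4, toChart_ofChart h1.1, toChart_ofChart h1.2.1, hη]
    · rintro ⟨X, hX⟩
      refine ⟨toChart s₀ s X, ?_⟩
      rw [← h4, hX, toChart_ofChart h1.2.1]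

omit hS [IsManifold 𝓘(ℝ, F) 2 S] in
omit [IsManifold 𝓘(ℝ, E) ∞ M] in
theorem mapInChart_extChartAt {s : S} (hs : s ∈ (extChartAt 𝓘(ℝ, F) s₀).source) :
    mapInChart E ι s₀ (extChartAt 𝓘(ℝ, F) s₀ s) = extChartAt 𝓘(ℝ, E) (ι s₀) (ι s) := by
  rw [mapInChart, Function.comp_apply, Function.comp_apply, (extChartAt 𝓘(ℝ, F) s₀).left_inv hs]

/-- The covariant derivative of the lightlike field, in a chart. -/
theorem toChart_covDeriv [FiniteDimensional ℝ E] (hL : IsLorentzFinsler L) :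
    ∀ᶠ s in 𝓝 s₀, ∀ X : TangentSpace 𝓘(ℝ, F) s,
    toChart (ι s₀) (ι s) (covDeriv L ι (push ι N) s X)
      = localCovDeriv (inChart L (ι s₀)) (mapInChart E ι s₀)
          (localPush (mapInChart E ι s₀) (fieldInChart N s₀)) (extChartAt 𝓘(ℝ, F) s₀ s)
          (toChart s₀ s X) := by
  have hnull := hS.isLocalNull s₀ hL
  filter_upwards [(hS.eventually_source s₀).eventually_nhds, (hS.toChart_push s₀).eventually_nhds,
    (continuousAt_extChartAt (I := 𝓘(ℝ, F)) s₀).eventually hnull.eventually_differentiableAt_push]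
    with s h1 h2 hpush X
  obtain ⟨hs, hs', hj⟩ := h1.self_of_nhds
  have hps := mem_extChartAt_source (I := 𝓘(ℝ, E)) (ι s)
  set y := extChartAt 𝓘(ℝ, F) s₀ s with hy
  have hys : (extChartAt 𝓘(ℝ, F) s₀).symm y = s := (extChartAt 𝓘(ℝ, F) s₀).left_inv hs
  have hsymm : Tendsto (extChartAt 𝓘(ℝ, F) s₀).symm (𝓝 y) (𝓝 s) := by
    have := (continuousAt_extChartAt_symm' (I := 𝓘(ℝ, F)) hs).tendsto
    rwa [hys] at this
  -- `φ` carries the covariant derivative from the preferred chart at `ι s` to the fixed one at `ι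
  -- s₀`; its inverse `ψ` serves to transfer differentiability the other way.
  set φ := extChartAt 𝓘(ℝ, E) (ι s₀) ∘ (extChartAt 𝓘(ℝ, E) (ι s)).symm with hφ
  set ψ := extChartAt 𝓘(ℝ, E) (ι s) ∘ (extChartAt 𝓘(ℝ, E) (ι s₀)).symm with hψ
  set j₁ : F → E := extChartAt 𝓘(ℝ, E) (ι s) ∘ ι ∘ (extChartAt 𝓘(ℝ, F) s₀).symm with hj₁
  set m : S → E := fun s' => toChart (ι s) (ι s') (push (E := E) ι N s') with hm
  have hev : ∀ᶠ y' in 𝓝 y, (extChartAt 𝓘(ℝ, F) s₀).symm y' ∈ (extChartAt 𝓘(ℝ, F) s₀).source ∧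
      ι ((extChartAt 𝓘(ℝ, F) s₀).symm y') ∈ (extChartAt 𝓘(ℝ, E) (ι s₀)).source ∧
      ι ((extChartAt 𝓘(ℝ, F) s₀).symm y') ∈ (extChartAt 𝓘(ℝ, E) (ι s)).source ∧
      localPush (mapInChart E ι s₀) (fieldInChart N s₀) y'
        = toChart (ι s₀) (ι ((extChartAt 𝓘(ℝ, F) s₀).symm y'))
          (push (E := E) ι N ((extChartAt 𝓘(ℝ, F) s₀).symm y')) := by
    filter_upwards [hsymm.eventually h1, hsymm.eventually h2,
      hsymm.eventually ((hS.contMDiff.continuous.continuousAt (x := s)).eventually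
        (extChartAt_source_mem_nhds (I := 𝓘(ℝ, E)) (ι s))),
      extChartAt_target_mem_nhds' (I := 𝓘(ℝ, F)) ((extChartAt 𝓘(ℝ, F) s₀).map_source hs)] with y' h3 h4 h5 h6
    refine ⟨h3.1, h3.2.1, h5, ?_⟩
    rw [h4, (extChartAt 𝓘(ℝ, F) s₀).right_inv h6]
  have hjψ : j₁ =ᶠ[𝓝 y] ψ ∘ mapInChart E ι s₀ := by
    filter_upwards [hev] with y' h3
    simp only [hj₁, hψ, mapInChart, Function.comp_apply]
    rw [(extChartAt 𝓘(ℝ, E) (ι s₀)).left_inv h3.2.1]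
  have hjφ : mapInChart E ι s₀ =ᶠ[𝓝 y] φ ∘ j₁ := by
    filter_upwards [hev] with y' h3
    simp only [hj₁, hφ, mapInChart, Function.comp_apply]
    rw [(extChartAt 𝓘(ℝ, E) (ι s)).left_inv h3.2.2.1]
  have hnφ : localPush (mapInChart E ι s₀) (fieldInChart N s₀) =ᶠ[𝓝 y]
      fun y' => fderiv ℝ φ (j₁ y') ((m ∘ (extChartAt 𝓘(ℝ, F) s₀).symm) y') := by
    filter_upwards [hev] with y' h3
    rw [h3.2.2.2]
    exact toChart_eq_fderiv h3.2.2.1 h3.2.1 _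
  have hmψ : m ∘ (extChartAt 𝓘(ℝ, F) s₀).symm =ᶠ[𝓝 y] fun y' => fderiv ℝ ψ
      (mapInChart E ι s₀ y') (localPush (mapInChart E ι s₀) (fieldInChart N s₀) y') := by
    filter_upwards [hev] with y' h3
    rw [h3.2.2.2]
    exact toChart_eq_fderiv h3.2.1 h3.2.2.1 _
  have hjy : mapInChart E ι s₀ y = extChartAt 𝓘(ℝ, E) (ι s₀) (ι s) := mapInChart_extChartAt s₀ hs
  have hj₁y : j₁ y = extChartAt 𝓘(ℝ, E) (ι s) (ι s) := by
    simp only [hj₁, Function.comp_apply, hys]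
  have hψd : ContDiffAt ℝ 3 ψ (mapInChart E ι s₀ y) := by
    refine (isCoordChange_inChart L (ι s) (ι s₀)).contDiffAt _ ?_
    rw [hjy, PartialEquiv.trans_source, PartialEquiv.symm_source]
    refine ⟨(extChartAt 𝓘(ℝ, E) (ι s₀)).map_source hs', ?_⟩
    rw [Set.mem_preimage, (extChartAt 𝓘(ℝ, E) (ι s₀)).left_inv hs']
    exact hps
  have hmd : DifferentiableAt ℝ (m ∘ (extChartAt 𝓘(ℝ, F) s₀).symm) y := by
    refine DifferentiableAt.congr_of_eventuallyEq ?_ hmψ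
    have h3 : DifferentiableAt ℝ (fderiv ℝ ψ) (mapInChart E ι s₀ y) :=
      (hψd.fderiv_right (m := 1) (by norm_num)).differentiableAt (by simp)
    exact (DifferentiableAt.comp y h3 hj).clm_apply hpush
  have hj₁d : DifferentiableAt ℝ j₁ y :=
    (DifferentiableAt.comp y (hψd.differentiableAt (by simp)) hj).congr_of_eventuallyEq hjψ
  have hU₁ : IsOpen ((extChartAt 𝓘(ℝ, E) (ι s)).symm ≫ extChartAt 𝓘(ℝ, E) (ι s₀)).source := by
    rw [PartialEquiv.trans_source, PartialEquiv.symm_source]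
    exact (continuousOn_extChartAt_symm (ι s)).isOpen_inter_preimage (isOpen_extChartAt_target _)
      (isOpen_extChartAt_source _)
  have hf₁ := (isLocalFinsler_inChart hL (ι s)).mono hU₁ (fun x hx => hx.1)
  have hmem : j₁ y ∈ ((extChartAt 𝓘(ℝ, E) (ι s)).symm ≫ extChartAt 𝓘(ℝ, E) (ι s₀)).source := by
    rw [hj₁y, PartialEquiv.trans_source, PartialEquiv.symm_source]
    refine ⟨mem_extChartAt_target _, ?_⟩
    rw [Set.mem_preimage, extChartAt_to_inv]
    exact hs'
  have hms : m s = (push (E := E) ι N s : E) := toChart_self (E := E) (ι s) (push (E := E) ι N s : E)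
  have hmy : (m ∘ (extChartAt 𝓘(ℝ, F) s₀).symm) y ≠ 0 := by
    rw [Function.comp_apply, hys, hms]
    exact hS.push_ne_zero s
  rw [(isCoordChange_inChart L (ι s₀) (ι s)).localCovDeriv_comp
    (isLocalFinsler_inChart hL (ι s₀)) hf₁ hmem hmy hj₁d hmd hjφ hnφ, hj₁y]
  refine (toChart_eq_fderiv hps hs' _).trans (congrArg _ ?_)
  have h3 := (hasMFDerivAt_of_hasFDerivAt hs hmd.hasFDerivAt).mfderiv
  have h4 := toChart_mfderiv hs hps (hS.mdifferentiableAt s) hj₁ hj₁d X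
  have h5 := (toChart_self (E := E) (ι s) (mfderiv 𝓘(ℝ, F) 𝓘(ℝ, E) ι s X : E)).symm.trans h4
  refine (toChart_self (E := E) (ι s) (covDeriv L ι (push ι N) s X : E)).trans ?_
  have h6 : ((m ∘ (extChartAt 𝓘(ℝ, F) s₀).symm) y : E) = (push (E := E) ι N s : E) := by
    rw [Function.comp_apply, hys, hms]
  rw [localCovDeriv, _root_.add_apply, ContinuousLinearMap.comp_apply, hj₁y, h6]
  exact congrArg₂ (fun a b : E => a + localConn (inChart L (ι s))
    (extChartAt 𝓘(ℝ, E) (ι s) (ι s), (push (E := E) ι N s : E)) b)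
    (congrArg (fun l => l X) h3) h5

end IsNullHypersurface
end HypersurfaceInChart

/-! ### Derivatives of tangent fields along a generator -/

section Generator

open Filter

variable {E : Type*} [NormedAddCommGroup E] [NormedSpace ℝ E]
  {F : Type*} [NormedAddCommGroup F] [NormedSpace ℝ F]

/-- A field is differentiable if its image under a differentiable field of injective maps is. -/
theorem exists_hasDerivAt_of_clm_apply [FiniteDimensional ℝ E] [FiniteDimensional ℝ F]
    {J : ℝ → F →L[ℝ] E} {J' : F →L[ℝ] E}
    {t₀ : ℝ} (hJ : HasDerivAt J J' t₀) (hinj : Function.Injective (J t₀)) {ξ : ℝ → F} {x' : E}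
    (hx : HasDerivAt (fun t => J t (ξ t)) x' t₀) : ∃ ξ', HasDerivAt ξ ξ' t₀ := by
  have : CompleteSpace F := FiniteDimensional.complete ℝ F
  obtain ⟨Q, hQ⟩ : ∃ Q : E →L[ℝ] F, Q.comp (J t₀) = ContinuousLinearMap.id ℝ F := by
    obtain ⟨Q, hQ⟩ := LinearMap.exists_leftInverse_of_injective (J t₀).toLinearMap
      (LinearMap.ker_eq_bot.2 hinj)
    exact ⟨LinearMap.toContinuousLinearMap Q, ContinuousLinearMap.ext fun ξ =>
      LinearMap.congr_fun hQ ξ⟩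
  have hQJ : HasDerivAt (fun t => Q.comp (J t)) _ t₀ := (hasDerivAt_const t₀ Q).clm_comp hJ
  have hinv : ∀ᶠ t in 𝓝 t₀, (Q.comp (J t)).IsInvertible := by
    have h1 := ContinuousLinearEquiv.nhds (ContinuousLinearEquiv.refl ℝ F)
    have h2 := hQJ.continuousAt.tendsto
    simp only [hQ] at h2
    filter_upwards [h2.eventually h1] with t ht
    exact ht
  have h1 := (hinv.self_of_nhds.contDiffAt_map_inverse (n := 1)).differentiableAt (by simp)
  obtain ⟨I', h2⟩ : ∃ I', HasDerivAt (fun t => (Q.comp (J t)).inverse) I' t₀ := by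
    have h2 := h1.hasFDerivAt.comp_hasDerivAt t₀ hQJ
    exact ⟨_, h2⟩
  refine ⟨_, (h2.clm_apply (Q.hasFDerivAt.comp_hasDerivAt t₀ hx)).congr_of_eventuallyEq ?_⟩
  filter_upwards [hinv] with t ht
  exact (ht.inverse_apply_self (ξ t)).symm

namespace IsLocalNull

variable {f : E × E → ℝ} {U : Set E} {j : F → E} {N : F → F} {y₀ : F}
  (h : IsLocalNull f U j N y₀)
  {u : ℝ → F} {t₀ : ℝ} (hu : HasDerivAt u (N (u t₀)) t₀) (hu₀ : u t₀ = y₀)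
include h hu hu₀

theorem hasDerivAt_fderiv_comp :
    HasDerivAt (fun t => fderiv ℝ j (u t)) (fderiv ℝ (fderiv ℝ j) y₀ (N y₀)) t₀ := by
  have hdj : HasFDerivAt (fderiv ℝ j) (fderiv ℝ (fderiv ℝ j) y₀) (u t₀) := by
    rw [hu₀]; exact (h.contDiffAt_fderiv.differentiableAt (by simp)).hasFDerivAt
  have := hdj.comp_hasDerivAt t₀ hu
  rwa [hu₀] at this

omit hu hu₀ in
/-- The flipped covariant derivative of a tangent field along a generator, in terms of the null
Weingarten map. -/
theorem flippedDeriv_eq {B : F →L[ℝ] F}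
    (hB : ∀ ξ, ∃ c : ℝ, localCovDeriv f j (localPush j N) y₀ ξ
      = fderiv ℝ j y₀ (B ξ + c • N y₀)) (ξ ξ' : F) :
    ∃ c : ℝ, fderiv ℝ (fderiv ℝ j) y₀ (N y₀) ξ + fderiv ℝ j y₀ ξ'
        + localConn f (j y₀, localPush j N y₀) (fderiv ℝ j y₀ ξ)
      = fderiv ℝ j y₀ (ξ' + (B - fderiv ℝ N y₀) ξ + c • N y₀) := by
  obtain ⟨c, hc⟩ := hB ξ
  refine ⟨c, ?_⟩
  have hN := (h.contDiffAt_field.differentiableAt (by simp)).hasFDerivAt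
  have hdj := (h.contDiffAt_fderiv.differentiableAt (by simp)).hasFDerivAt
  have h3 := congrArg (fun l => l ξ) (HasFDerivAt.fderiv (f := localPush j N) (hdj.clm_apply hN))
  simp only [_root_.add_apply, ContinuousLinearMap.comp_apply, ContinuousLinearMap.flip_apply] at h3
  -- Symmetry of `d²j` gives `D̃_n X = D_X n + [n, X]`, and in the chart the bracket is `ξ' - dN ξ`.
  rw [(h.contDiffAt.isSymmSndFDerivAt (by simp)).eq ξ] at h3
  rw [localCovDeriv, _root_.add_apply, ContinuousLinearMap.comp_apply, h3] at hc
  simp only [map_add, map_smul, _root_.sub_apply, map_sub] at hc ⊢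
  rw [← sub_eq_zero] at hc ⊢
  rw [← hc]
  abel

end IsLocalNull

variable {M : Type*} [TopologicalSpace M] [ChartedSpace E M] [IsManifold 𝓘(ℝ, E) ∞ M]
  {S : Type*} [TopologicalSpace S] [ChartedSpace F S] [IsManifold 𝓘(ℝ, F) 2 S]
  {L : TangentBundle 𝓘(ℝ, E) M → ℝ} {ι : S → M} {N : ∀ s : S, TangentSpace 𝓘(ℝ, F) s}

/-- The frame of `V` along the curve `γ` given by the preferred chart at `s₀`. -/
def chartFrame (N : ∀ s : S, TangentSpace 𝓘(ℝ, F) s) (γ : ℝ → S) (s₀ : S) (t : ℝ) :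
    F →ₗ[ℝ] Fibre N (γ t) :=
  (Submodule.span ℝ {N (γ t)}).mkQ ∘ₗ (ofChart s₀ (γ t)).toLinearMap

theorem chartFrame_apply (γ : ℝ → S) (s₀ : S) (t : ℝ) (ξ : F) :
    chartFrame N γ s₀ t ξ = toFibre N (γ t) (ofChart s₀ (γ t) ξ) :=
  rfl

theorem chartFrame_toChart {γ : ℝ → S} {s₀ : S} {t : ℝ}
    (ht : γ t ∈ (extChartAt 𝓘(ℝ, F) s₀).source) (X : TangentSpace 𝓘(ℝ, F) (γ t)) :
    chartFrame N γ s₀ t (toChart s₀ (γ t) X) = toFibre N (γ t) X := by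
  rw [chartFrame_apply, ofChart_toChart ht]

theorem chartFrame_eq_zero_iff {γ : ℝ → S} {s₀ : S} {t : ℝ}
    (ht : γ t ∈ (extChartAt 𝓘(ℝ, F) s₀).source) (ξ : F) :
    chartFrame N γ s₀ t ξ = 0
      ↔ ∃ c : ℝ, ξ = c • fieldInChart N s₀ (extChartAt 𝓘(ℝ, F) s₀ (γ t)) := by
  have h1 : fieldInChart N s₀ (extChartAt 𝓘(ℝ, F) s₀ (γ t)) = toChart s₀ (γ t) (N (γ t)) := by
    rw [fieldInChart, (extChartAt 𝓘(ℝ, F) s₀).left_inv ht]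
  rw [chartFrame_apply, toFibre, Submodule.Quotient.mk_eq_zero, Submodule.mem_span_singleton, h1]
  refine exists_congr fun c => ⟨fun hc => ?_, fun hc => ?_⟩
  · rw [← map_smul, hc, toChart_ofChart ht]
  · rw [hc, map_smul, ofChart_toChart ht]

/-! ### Sections of `V` in the frame of a chart -/

section Curve

variable {γ : ℝ → S} {t₀ : ℝ} (hγ : IsMIntegralCurveAt γ N t₀)
include hγ

omit [IsManifold 𝓘(ℝ, F) 2 S] in
theorem eventually_mem_source_of_isMIntegralCurveAt :
    ∀ᶠ t in 𝓝 t₀, γ t ∈ (extChartAt 𝓘(ℝ, F) (γ t₀)).source :=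
  hγ.continuousAt.eventually (extChartAt_source_mem_nhds (I := 𝓘(ℝ, F)) (γ t₀))

theorem eventually_hasDerivAt_extChartAt :
    ∀ᶠ t in 𝓝 t₀, HasDerivAt (fun t => extChartAt 𝓘(ℝ, F) (γ t₀) (γ t))
      (fieldInChart N (γ t₀) (extChartAt 𝓘(ℝ, F) (γ t₀) (γ t))) t := by
  filter_upwards [hγ.eventually_hasDerivAt, eventually_mem_source_of_isMIntegralCurveAt hγ]
    with t h1 h2
  rw [fieldInChart, (extChartAt 𝓘(ℝ, F) (γ t₀)).left_inv h2]
  exact h1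

variable [FiniteDimensional ℝ E] [FiniteDimensional ℝ F]
  (hL : IsLorentzFinsler L) (hS : IsNullHypersurface L ι N) {B : F →L[ℝ] F}
  (hB : ∀ ξ, ∃ c : ℝ, localCovDeriv (inChart L (ι (γ t₀))) (mapInChart E ι (γ t₀))
      (localPush (mapInChart E ι (γ t₀)) (fieldInChart N (γ t₀)))
      (extChartAt 𝓘(ℝ, F) (γ t₀) (γ t₀)) ξ
    = fderiv ℝ (mapInChart E ι (γ t₀)) (extChartAt 𝓘(ℝ, F) (γ t₀) (γ t₀))
      (B ξ + c • fieldInChart N (γ t₀) (extChartAt 𝓘(ℝ, F) (γ t₀) (γ t₀))))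
include hL hS hB

omit [FiniteDimensional ℝ F] hB in
-- The line of `ν = N ∘ u` is parallel: `ν' = dN(ν)` and `D = B - dN`, so `ν' + D ν = B ν = l ν`.
theorem isQuotientFrame_chartFrame {l : ℝ}
    (hl : B (fieldInChart N (γ t₀) (extChartAt 𝓘(ℝ, F) (γ t₀) (γ t₀)))
      = l • fieldInChart N (γ t₀) (extChartAt 𝓘(ℝ, F) (γ t₀) (γ t₀))) :
    IsQuotientFrame (chartFrame N γ (γ t₀))
      (fun t => fieldInChart N (γ t₀) (extChartAt 𝓘(ℝ, F) (γ t₀) (γ t)))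
      (B - fderiv ℝ (fieldInChart N (γ t₀)) (extChartAt 𝓘(ℝ, F) (γ t₀) (γ t₀))) t₀ where
  surjective := by
    filter_upwards [eventually_mem_source_of_isMIntegralCurveAt hγ] with t ht Z
    obtain ⟨X, rfl⟩ := Submodule.Quotient.mk_surjective _ Z
    exact ⟨toChart (γ t₀) (γ t) X, chartFrame_toChart ht X⟩
  ker := by
    filter_upwards [eventually_mem_source_of_isMIntegralCurveAt hγ] with t ht ξ
    exact chartFrame_eq_zero_iff ht ξ
  hasDerivAt := by
    refine ⟨l, ?_⟩
    have h1 := ((hS.contDiffAt_fieldInChart (γ t₀)).differentiableAt (by simp)).hasFDerivAt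
    have h2 := h1.comp_hasDerivAt t₀ (eventually_hasDerivAt_extChartAt hγ).self_of_nhds
    rw [_root_.sub_apply, hl, sub_sub_cancel]
    exact h2
  ne_zero := (((continuousAt_extChartAt (I := 𝓘(ℝ, F)) (γ t₀)).comp hγ.continuousAt).eventually
    (hS.isLocalNull (γ t₀) hL).ne_zero)

/-- Modulo `n`, `D̃_n (dj ξ) = dj (ξ' + D ξ)` by `flippedDeriv_eq`. The intrinsic notion asks only
that `dj ξ` be differentiable; injectivity of `dj` recovers the differentiability of `ξ`. -/
theorem hasSectionDerivAt_iff (Xbar : ∀ t, Fibre N (γ t)) (Z : Fibre N (γ t₀)) :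
    HasSectionDerivAt L ι N γ t₀ Xbar Z ↔
      HasFrameDerivAt (chartFrame N γ (γ t₀))
        (B - fderiv ℝ (fieldInChart N (γ t₀)) (extChartAt 𝓘(ℝ, F) (γ t₀) (γ t₀))) t₀ Xbar Z := by
  have hnull := hS.isLocalNull (γ t₀) hL
  have hsrc := eventually_mem_source_of_isMIntegralCurveAt hγ
  have hu := (eventually_hasDerivAt_extChartAt hγ).self_of_nhds
  have hJ := hnull.hasDerivAt_fderiv_comp hu rfl
  have hdι := hγ.continuousAt.eventually (hS.toChart_mfderiv_apply (γ t₀))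
  have hpush := (hS.toChart_push (γ t₀)).self_of_nhds
  set s₀ := γ t₀ with hs₀
  set f := inChart L (ι s₀) with hf
  set j : F → E := mapInChart E ι s₀ with hj
  set n : F → F := fieldInChart N s₀ with hn
  set y₀ := extChartAt 𝓘(ℝ, F) s₀ s₀ with hy₀
  have hdι₀ : ∀ X : F, (mfderiv 𝓘(ℝ, F) 𝓘(ℝ, E) ι s₀ X : E) = fderiv ℝ j y₀ X := fun X => by
    have h1 := (hdι.self_of_nhds X).trans
      (congrArg (fderiv ℝ j y₀) (toChart_self (E := F) s₀ X))
    exact (toChart_self (E := E) (ι s₀) (mfderiv 𝓘(ℝ, F) 𝓘(ℝ, E) ι s₀ X : E)).symm.trans h1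
  have hpush' : (push (E := E) ι N s₀ : E) = localPush j n y₀ :=
    (toChart_self (E := E) (ι s₀) (push (E := E) ι N s₀ : E)).symm.trans hpush
  have hjy : j y₀ = extChartAt 𝓘(ℝ, E) (ι s₀) (ι s₀) :=
    IsNullHypersurface.mapInChart_extChartAt s₀ (mem_extChartAt_source s₀)
  have hflip : ∀ (X : ∀ t, TangentSpace 𝓘(ℝ, F) (γ t)) (Y : F),
      HasFlippedDerivAt L (fun t => ι (γ t)) t₀ (push ι N (γ t₀))
        (fun t => mfderiv 𝓘(ℝ, F) 𝓘(ℝ, E) ι (γ t) (X t)) (mfderiv 𝓘(ℝ, F) 𝓘(ℝ, E) ι (γ t₀) Y)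
      ↔ HasDerivAt (fun t => fderiv ℝ j (extChartAt 𝓘(ℝ, F) s₀ (γ t)) (toChart s₀ (γ t) (X t)))
        (fderiv ℝ j y₀ Y - localConn f (j y₀, localPush j n y₀)
          (fderiv ℝ j y₀ (toChart s₀ s₀ (X t₀)))) t₀ := by
    intro X Y
    have h1 : (fun t => toChart (E := E) (ι s₀) (ι (γ t))
        (mfderiv 𝓘(ℝ, F) 𝓘(ℝ, E) ι (γ t) (X t))) =ᶠ[𝓝 t₀]
        fun t => fderiv ℝ j (extChartAt 𝓘(ℝ, F) s₀ (γ t)) (toChart s₀ (γ t) (X t)) := by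
      filter_upwards [hdι] with t ht
      exact ht (X t)
    rw [← h1.hasDerivAt_iff, hjy, ← hpush', ← hdι₀ Y]
    have h2 : (mfderiv 𝓘(ℝ, F) 𝓘(ℝ, E) ι s₀ (X t₀) : E) = fderiv ℝ j y₀ (toChart s₀ s₀ (X t₀)) :=
      (hdι₀ (X t₀)).trans (congrArg (fderiv ℝ j y₀) (toChart_self (E := F) s₀ (X t₀)).symm)
    rw [← h2]
    exact Iff.rfl
  have hmk : ∀ Y : F, toFibre N s₀ Y = chartFrame N γ s₀ t₀ Y := fun Y =>
    congrArg (toFibre N s₀) (ofChart_self s₀ Y).symm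
  have hker : ∀ c : ℝ, chartFrame N γ s₀ t₀ (c • n y₀) = 0 := fun c =>
    (chartFrame_eq_zero_iff hsrc.self_of_nhds _).2 ⟨c, rfl⟩
  constructor
  · rintro ⟨X, Y, hX, rfl, hd⟩
    replace hd := (hflip X Y).1 hd
    obtain ⟨ξ', hξ⟩ := exists_hasDerivAt_of_clm_apply hJ hnull.injective.self_of_nhds hd
    refine ⟨fun t => toChart s₀ (γ t) (X t), ξ', hξ, ?_, ?_⟩
    · filter_upwards [hX, hsrc] with t h1 h2
      exact h1.symm.trans (chartFrame_toChart h2 (X t)).symm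
    · obtain ⟨c, hc⟩ := hnull.flippedDeriv_eq hB (toChart s₀ s₀ (X t₀)) ξ'
      have h1 := (hJ.clm_apply hξ).unique hd
      rw [← eq_sub_iff_add_eq] at hc
      have h2 := hnull.injective.self_of_nhds (sub_left_injective (h1.symm.trans hc))
      refine (hmk Y).trans ((congrArg _ h2).trans ?_)
      rw [map_add, hker, add_zero]
  · rintro ⟨ξ, ξ', hξ, hX, rfl⟩
    obtain ⟨c, hc⟩ := hnull.flippedDeriv_eq hB (ξ t₀) ξ'
    refine ⟨fun t => ofChart s₀ (γ t) (ξ t), (ξ' + (B - fderiv ℝ n y₀) (ξ t₀) + c • n y₀ : F),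
      ?_, ?_, (hflip _ _).2 ?_⟩
    · filter_upwards [hX] with t ht using ht.symm
    · refine (hmk _).trans ?_
      rw [map_add, hker, add_zero]
    · have h1 : (fun t => fderiv ℝ j (extChartAt 𝓘(ℝ, F) s₀ (γ t)) (ξ t)) =ᶠ[𝓝 t₀]
          fun t => fderiv ℝ j (extChartAt 𝓘(ℝ, F) s₀ (γ t))
            (toChart s₀ (γ t) (ofChart s₀ (γ t) (ξ t))) := by
        filter_upwards [hsrc] with t ht
        rw [toChart_ofChart ht]
      rw [← h1.hasDerivAt_iff, toChart_ofChart (mem_extChartAt_source s₀), ← hc,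
        add_sub_cancel_right]
      exact hJ.clm_apply hξ

end Curve
end Generator

/-! ### The Riccati equation -/

section Riccati

open Filter

variable {E : Type*} [NormedAddCommGroup E] [NormedSpace ℝ E] [FiniteDimensional ℝ E]
  {F : Type*} [NormedAddCommGroup F] [NormedSpace ℝ F]
  {M : Type*} [TopologicalSpace M] [ChartedSpace E M] [IsManifold 𝓘(ℝ, E) ∞ M]
  {S : Type*} [TopologicalSpace S] [ChartedSpace F S] [IsManifold 𝓘(ℝ, F) 2 S]
  {L : TangentBundle 𝓘(ℝ, E) M → ℝ} {ι : S → M} {N : ∀ s : S, TangentSpace 𝓘(ℝ, F) s}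

namespace IsNullHypersurface

variable (hS : IsNullHypersurface L ι N) (hL : IsLorentzFinsler L)

section Pointwise

include hS

omit [FiniteDimensional ℝ E] in
theorem mfderiv_eq_fderiv (s : S) (X : F) : (mfderiv 𝓘(ℝ, F) 𝓘(ℝ, E) ι s X : E)
    = fderiv ℝ (mapInChart E ι s) (extChartAt 𝓘(ℝ, F) s s) X := by
  have h1 := ((hS.toChart_mfderiv_apply s).self_of_nhds X).trans
    (congrArg (fderiv ℝ (mapInChart E ι s) (extChartAt 𝓘(ℝ, F) s s)) (toChart_self (E := F) s X))
  exact (toChart_self (E := E) (ι s) (mfderiv 𝓘(ℝ, F) 𝓘(ℝ, E) ι s X : E)).symm.trans h1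

omit [FiniteDimensional ℝ E] in
theorem push_eq_localPush (s : S) : (push (E := E) ι N s : E)
    = localPush (mapInChart E ι s) (fieldInChart N s) (extChartAt 𝓘(ℝ, F) s s) :=
  (toChart_self (E := E) (ι s) (push (E := E) ι N s : E)).symm.trans
    (hS.toChart_push s).self_of_nhds

omit [FiniteDimensional ℝ E] in
-- The evolution equations involve the curvature only at the base point, whose preferred chart is
-- the one used in the computation, so no transformation law for the curvature is needed.
theorem curvature_eq_localCurvature (s : S) (w : E) : (curvature L (ι s) (push ι N s) w : E)
    = localCurvature (inChart L (ι s)) (mapInChart E ι s (extChartAt 𝓘(ℝ, F) s s),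
      localPush (mapInChart E ι s) (fieldInChart N s) (extChartAt 𝓘(ℝ, F) s s)) w := by
  rw [← hS.push_eq_localPush, mapInChart_extChartAt s (mem_extChartAt_source s)]
  rfl

include hL

theorem covDeriv_eq_localCovDeriv (s : S) (X : F) : (covDeriv L ι (push ι N) s X : E)
    = localCovDeriv (inChart L (ι s)) (mapInChart E ι s)
      (localPush (mapInChart E ι s) (fieldInChart N s)) (extChartAt 𝓘(ℝ, F) s s) X := by
  have h1 := ((hS.toChart_covDeriv s hL).self_of_nhds X).trans (congrArg (localCovDeriv
    (inChart L (ι s)) (mapInChart E ι s) (localPush (mapInChart E ι s) (fieldInChart N s))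
    (extChartAt 𝓘(ℝ, F) s s)) (toChart_self (E := F) s X))
  exact (toChart_self (E := E) (ι s) (covDeriv L ι (push ι N) s X : E)).symm.trans h1

/-- `D_X n` is tangent to the hypersurface. -/
theorem exists_mfderiv_eq_covDeriv (s : S) (X : TangentSpace 𝓘(ℝ, F) s) :
    ∃ Y : TangentSpace 𝓘(ℝ, F) s,
      mfderiv 𝓘(ℝ, F) 𝓘(ℝ, E) ι s Y = covDeriv L ι (push ι N) s X := by
  have : CompleteSpace E := FiniteDimensional.complete ℝ E
  obtain ⟨Y, hY⟩ := (hS.isLocalNull s hL).localCovDeriv_mem_range.self_of_nhds X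
  exact ⟨Y, (hS.mfderiv_eq_fderiv s Y).trans
    (hY.trans (hS.covDeriv_eq_localCovDeriv hL s X).symm)⟩

/-- `R_n` takes values tangent to the hypersurface. -/
theorem exists_mfderiv_eq_curvature (s : S) (w : TangentSpace 𝓘(ℝ, E) (ι s)) :
    ∃ Y : TangentSpace 𝓘(ℝ, F) s,
      mfderiv 𝓘(ℝ, F) 𝓘(ℝ, E) ι s Y = curvature L (ι s) (push ι N s) w := by
  have : CompleteSpace E := FiniteDimensional.complete ℝ E
  obtain ⟨Y, hY⟩ := (hS.isLocalNull s hL).localCurvature_mem_range.self_of_nhds w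
  exact ⟨Y, (hS.mfderiv_eq_fderiv s Y).trans (hY.trans (hS.curvature_eq_localCurvature s w).symm)⟩

omit hS hL in
omit [FiniteDimensional ℝ E] [IsManifold 𝓘(ℝ, F) 2 S] in
theorem curvature_push (s : S) : curvature L (ι s) (push ι N s) (push ι N s) = 0 :=
  IsLocalFinsler.localCurvature_self (E := E) (f := inChart L (ι s))
    (z := (extChartAt 𝓘(ℝ, E) (ι s) (ι s), (push (E := E) ι N s : E)))

theorem curvatureBar_toFibre {s : S} {X Y : TangentSpace 𝓘(ℝ, F) s}
    (hXY : mfderiv 𝓘(ℝ, F) 𝓘(ℝ, E) ι s Y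
      = curvature L (ι s) (push ι N s) (mfderiv 𝓘(ℝ, F) 𝓘(ℝ, E) ι s X)) :
    curvatureBar L ι N s (toFibre N s X) = toFibre N s Y := by
  refine inducedEnd_mk (hS.immersion s) (fun X => hS.exists_mfderiv_eq_curvature hL s _)
    ⟨0, ?_⟩ hXY
  rw [zero_smul]
  exact curvature_push s

/-- `Ric(n)` is the trace of `R̄`. -/
theorem ricci_eq_trace [FiniteDimensional ℝ F] (s : S) :
    ricci L (ι s) (push ι N s) = LinearMap.trace ℝ (Fibre N s) (curvatureBar L ι N s) := by
  let J : TangentSpace 𝓘(ℝ, F) s →ₗ[ℝ] TangentSpace 𝓘(ℝ, E) (ι s) :=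
    (mfderiv 𝓘(ℝ, F) 𝓘(ℝ, E) ι s).toLinearMap
  let R : TangentSpace 𝓘(ℝ, E) (ι s) →ₗ[ℝ] TangentSpace 𝓘(ℝ, E) (ι s) :=
    (curvature L (ι s) (push ι N s)).toLinearMap
  have : FiniteDimensional ℝ (TangentSpace 𝓘(ℝ, E) (ι s)) :=
    inferInstanceAs (FiniteDimensional ℝ E)
  have : FiniteDimensional ℝ (TangentSpace 𝓘(ℝ, F) s) := inferInstanceAs (FiniteDimensional ℝ F)
  have hJ : Function.Injective J := hS.immersion s
  obtain ⟨Q, hQ⟩ := J.exists_leftInverse_of_injective (LinearMap.ker_eq_bot.2 hJ)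
  -- `R` takes values tangent to the hypersurface. Cyclicity then moves its trace to the tangent
  -- space of `S`, and since `R` kills `n` the trace descends to the quotient.
  have hJQ : J ∘ₗ (Q ∘ₗ R) = R := by
    ext w
    obtain ⟨Y, hY⟩ := hS.exists_mfderiv_eq_curvature hL s w
    have hY' : J Y = R w := hY
    have hQY : Q (J Y) = Y := LinearMap.congr_fun hQ Y
    simp only [LinearMap.comp_apply]
    rw [← hY', hQY]
  have h1 : ricci L (ι s) (push ι N s) = LinearMap.trace ℝ _ R := rfl
  rw [h1, ← hJQ, LinearMap.trace_comp_comm']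
  refine trace_eq_of_apply_eq_zero (q := (Submodule.span ℝ {N s}).mkQ) (v := N s)
    (Submodule.mkQ_surjective _) (fun ξ => ?_) (fun ξ => ?_) ?_
  · rw [Submodule.mkQ_apply, Submodule.Quotient.mk_eq_zero, Submodule.mem_span_singleton]
    exact exists_congr fun c => eq_comm
  · exact hS.curvatureBar_toFibre hL (LinearMap.congr_fun hJQ (J ξ))
  · have h2 : R (J (N s)) = 0 := curvature_push s
    rw [LinearMap.comp_apply, LinearMap.comp_apply, h2, map_zero]

variable {κ : S → ℝ} (hκ : ∀ s, covDeriv L ι (push ι N) s (N s) = κ s • push (E := E) ι N s)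
include hκ

theorem weingarten_toFibre {s : S} {X Y : TangentSpace 𝓘(ℝ, F) s}
    (hXY : mfderiv 𝓘(ℝ, F) 𝓘(ℝ, E) ι s Y = covDeriv L ι (push ι N) s X) :
    weingarten L ι N s (toFibre N s X) = toFibre N s Y :=
  inducedEnd_mk (hS.immersion s) (fun X => hS.exists_mfderiv_eq_covDeriv hL s X)
    ⟨κ s, hκ s⟩ hXY

end Pointwise

section Curve

variable [FiniteDimensional ℝ F] {κ : S → ℝ}
  (hκ : ∀ s, covDeriv L ι (push ι N) s (N s) = κ s • push (E := E) ι N s)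
  {γ : ℝ → S} {t₀ : ℝ} (hγ : IsMIntegralCurveAt γ N t₀)
include hS hL hκ hγ

/-- Along a generator, the null Weingarten map is induced by a differentiable field of
endomorphisms, whose derivative is given by the Riccati equation. -/
theorem exists_frame : ∃ (D : F →L[ℝ] F) (β : ℝ → F →L[ℝ] F) (β' : F →L[ℝ] F),
    IsQuotientFrame (chartFrame N γ (γ t₀))
      (fun t => fieldInChart N (γ t₀) (extChartAt 𝓘(ℝ, F) (γ t₀) (γ t))) D t₀ ∧
    (∀ Xbar Z, HasSectionDerivAt L ι N γ t₀ Xbar Z ↔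
      HasFrameDerivAt (chartFrame N γ (γ t₀)) D t₀ Xbar Z) ∧
    HasDerivAt β β' t₀ ∧
    (∀ᶠ t in 𝓝 t₀, ∀ ξ, weingarten L ι N (γ t) (chartFrame N γ (γ t₀) t ξ)
      = chartFrame N γ (γ t₀) t (β t ξ)) ∧
    ∀ ξ, (- curvatureBar L ι N (γ t₀) - weingarten L ι N (γ t₀) ∘ₗ weingarten L ι N (γ t₀)
        + κ (γ t₀) • weingarten L ι N (γ t₀)) (chartFrame N γ (γ t₀) t₀ ξ)
      = chartFrame N γ (γ t₀) t₀ (β' ξ + D (β t₀ ξ) - β t₀ (D ξ)) := by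
  have hnull := hS.isLocalNull (γ t₀) hL
  have hsrc := eventually_mem_source_of_isMIntegralCurveAt hγ
  have hu := eventually_hasDerivAt_extChartAt hγ
  have hcov := hS.toChart_covDeriv (γ t₀) hL
  have hpush := hS.toChart_push (γ t₀)
  have hdι := hS.toChart_mfderiv_apply (γ t₀)
  have hsource := hS.eventually_source (γ t₀)
  have hκ' : ∀ᶠ y in 𝓝 (extChartAt 𝓘(ℝ, F) (γ t₀) (γ t₀)),
      localCovDeriv (inChart L (ι (γ t₀))) (mapInChart E ι (γ t₀))
        (localPush (mapInChart E ι (γ t₀)) (fieldInChart N (γ t₀))) y (fieldInChart N (γ t₀) y)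
      = (κ ∘ (extChartAt 𝓘(ℝ, F) (γ t₀)).symm) y
        • localPush (mapInChart E ι (γ t₀)) (fieldInChart N (γ t₀)) y := by
    filter_upwards [eventually_chart (γ t₀) (hcov.and hpush)] with y hy
    obtain ⟨s, ⟨h1, h2⟩, rfl, h3⟩ := hy
    rw [← h2, Function.comp_apply, h3, fieldInChart, h3, ← h1, hκ, map_smul]
  obtain ⟨β, β', hβ, hβcov, hric⟩ := hnull.exists_riccati hκ' hu rfl
  have hB := hβcov.self_of_nhds
  have hker : ∀ᶠ t in 𝓝 t₀, ∀ c : ℝ, chartFrame N γ (γ t₀) t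
      (c • fieldInChart N (γ t₀) (extChartAt 𝓘(ℝ, F) (γ t₀) (γ t))) = 0 := by
    filter_upwards [hsrc] with t ht c
    exact (chartFrame_eq_zero_iff ht _).2 ⟨c, rfl⟩
  have hW : ∀ᶠ t in 𝓝 t₀, ∀ ξ, weingarten L ι N (γ t) (chartFrame N γ (γ t₀) t ξ)
      = chartFrame N γ (γ t₀) t (β t ξ) := by
    filter_upwards [hβcov, hγ.continuousAt.eventually (hcov.and (hdι.and hsource)), hker]
      with t h1 h2 h3 ξ
    obtain ⟨h4, h5, h6⟩ := h2
    obtain ⟨c, hc⟩ := h1 ξ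
    rw [chartFrame_apply, hS.weingarten_toFibre hL hκ (Y := ofChart (γ t₀) (γ t)
      (β t ξ + c • fieldInChart N (γ t₀) (extChartAt 𝓘(ℝ, F) (γ t₀) (γ t)))), ← chartFrame_apply,
      map_add, h3, add_zero]
    apply toChart_injective h6.2.1
    rw [h4, h5, toChart_ofChart h6.1, toChart_ofChart h6.1, hc]
  -- From `D_n n = κ n`: the eigenvalue is `κ` minus the multiple of `n` by which `D n` and `dj ∘ β`
  -- differ.
  obtain ⟨l, hl⟩ : ∃ l : ℝ, β t₀ (fieldInChart N (γ t₀) (extChartAt 𝓘(ℝ, F) (γ t₀) (γ t₀)))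
      = l • fieldInChart N (γ t₀) (extChartAt 𝓘(ℝ, F) (γ t₀) (γ t₀)) := by
    obtain ⟨c, hc⟩ := hB (fieldInChart N (γ t₀) (extChartAt 𝓘(ℝ, F) (γ t₀) (γ t₀)))
    refine ⟨κ (γ t₀) - c, ?_⟩
    rw [hκ'.self_of_nhds, Function.comp_apply, extChartAt_to_inv, localPush, ← map_smul] at hc
    rw [sub_smul, hnull.injective.self_of_nhds hc, add_sub_cancel_right]
  refine ⟨_, β, β', isQuotientFrame_chartFrame hγ hL hS hl, hasSectionDerivAt_iff hγ hL hS hB,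
    hβ, hW, fun ξ => ?_⟩
  obtain ⟨c, hc⟩ := hric ξ
  rw [Function.comp_apply, extChartAt_to_inv] at hc
  have h1 : ∀ Y : F, toFibre N (γ t₀) Y = chartFrame N γ (γ t₀) t₀ Y := fun Y =>
    congrArg (toFibre N (γ t₀)) (ofChart_self (γ t₀) Y).symm
  have h2 : (- curvatureBar L ι N (γ t₀)) (chartFrame N γ (γ t₀) t₀ ξ) = chartFrame N γ (γ t₀) t₀
      (β' ξ - fderiv ℝ (fieldInChart N (γ t₀)) (extChartAt 𝓘(ℝ, F) (γ t₀) (γ t₀)) (β t₀ ξ)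
        + β t₀ (fderiv ℝ (fieldInChart N (γ t₀)) (extChartAt 𝓘(ℝ, F) (γ t₀) (γ t₀)) ξ)
        + β t₀ (β t₀ ξ) - κ (γ t₀) • β t₀ ξ) := by
    set W : F := β' ξ - fderiv ℝ (fieldInChart N (γ t₀)) (extChartAt 𝓘(ℝ, F) (γ t₀) (γ t₀)) (β t₀ ξ)
        + β t₀ (fderiv ℝ (fieldInChart N (γ t₀)) (extChartAt 𝓘(ℝ, F) (γ t₀) (γ t₀)) ξ)
        + β t₀ (β t₀ ξ) - κ (γ t₀) • β t₀ ξ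
    set n₀ : F := fieldInChart N (γ t₀) (extChartAt 𝓘(ℝ, F) (γ t₀) (γ t₀)) with hn₀
    rw [← neg_eq_iff_eq_neg, ← map_neg] at hc
    have h3 : curvatureBar L ι N (γ t₀) (toFibre N (γ t₀) ξ)
        = toFibre N (γ t₀) (-(W + c • n₀) : F) := 
      hS.curvatureBar_toFibre hL ((hS.mfderiv_eq_fderiv _ _).trans (hc.trans
        ((congrArg _ (hS.mfderiv_eq_fderiv (γ t₀) ξ).symm).trans
          (hS.curvature_eq_localCurvature (γ t₀) _).symm)))
    rw [h1, h1, map_neg, map_add, hker.self_of_nhds, add_zero] at h3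
    rw [LinearMap.neg_apply, h3, neg_neg]
  have hW0 := hW.self_of_nhds
  rw [LinearMap.add_apply, LinearMap.sub_apply, h2, LinearMap.smul_apply, LinearMap.comp_apply,
    hW0, hW0]
  -- Since `D = β(t₀) - dN` and `β(t₀)` commutes with itself, `[D, β]` is just `-[dN, β]`, as in the
  -- local Riccati equation.
  simp only [_root_.sub_apply, map_sub, map_add, map_smul]
  abel

end Curve

end IsNullHypersurface

omit [FiniteDimensional ℝ E] [IsManifold 𝓘(ℝ, F) 2 S] in
/-- The square of the Weingarten map in terms of the shear and of the expansion. -/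
theorem trace_weingarten_comp_self [FiniteDimensional ℝ F] {k : ℝ} {s : S}
    (hk : (Module.finrank ℝ (Fibre N s) : ℝ) = k) :
    LinearMap.trace ℝ (Fibre N s) (weingarten L ι N s ∘ₗ weingarten L ι N s)
      = shearSq L ι N k s + 1 / k * expansion L ι N s ^ 2 := by
  have : FiniteDimensional ℝ (TangentSpace 𝓘(ℝ, F) s) := inferInstanceAs (FiniteDimensional ℝ F)
  have h1 : shear L ι N k s ∘ₗ shear L ι N k s = weingarten L ι N s ∘ₗ weingarten L ι N s
      - (2 * (1 / k * expansion L ι N s)) • weingarten L ι N s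
      + (1 / k * expansion L ι N s) ^ 2 • LinearMap.id := by
    ext X
    simp only [shear, LinearMap.comp_apply, LinearMap.sub_apply, LinearMap.add_apply,
      LinearMap.smul_apply, LinearMap.id_apply, map_sub, map_smul]
    module
  rw [shearSq, h1, map_add, map_sub, map_smul, map_smul, LinearMap.trace_id, hk]
  simp only [smul_eq_mul]
  have h2 : LinearMap.trace ℝ (Fibre N s) (weingarten L ι N s) = expansion L ι N s := rfl
  rw [h2]
  -- For zero-dimensional fibres, division by zero yields 0, which is the stated convention for the
  -- factor `1/(n-1)`.
  by_cases hk0 : k = 0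
  · simp [hk0]
  · field_simp
    ring

end Riccati
end LorentzFinsler
end

open LorentzFinsler

/-! ### The three evolution equations -/

theorem mainTheorem2 {n : ℕ}
    {E : Type*} [NormedAddCommGroup E] [NormedSpace ℝ E] [FiniteDimensional ℝ E]
    (hE : Module.finrank ℝ E = n + 1)
    {M : Type*} [TopologicalSpace M] [ChartedSpace E M] [IsManifold 𝓘(ℝ, E) ∞ M]
    (L : TangentBundle 𝓘(ℝ, E) M → ℝ) (hL : IsLorentzFinsler L)
    {F : Type*} [NormedAddCommGroup F] [NormedSpace ℝ F] [FiniteDimensional ℝ F]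
    (hF : Module.finrank ℝ F = n)
    {S : Type*} [TopologicalSpace S] [ChartedSpace F S] [IsManifold 𝓘(ℝ, F) 2 S]
    (ι : S → M) (N : ∀ s : S, TangentSpace 𝓘(ℝ, F) s) (hS : IsNullHypersurface L ι N)
    (κ : S → ℝ) (hκ : ∀ s, covDeriv L ι (push ι N) s (N s) = κ s • push (E := E) ι N s) :
    -- `b` and `R̄` are well defined on `V`
    (∀ (s : S) (X : TangentSpace 𝓘(ℝ, F) s),
      (∃ Y : TangentSpace 𝓘(ℝ, F) s,
        mfderiv 𝓘(ℝ, F) 𝓘(ℝ, E) ι s Y = covDeriv L ι (push ι N) s X ∧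
        weingarten L ι N s (toFibre N s X) = toFibre N s Y) ∧
      (∃ Y : TangentSpace 𝓘(ℝ, F) s,
        mfderiv 𝓘(ℝ, F) 𝓘(ℝ, E) ι s Y =
          curvature L (ι s) (push ι N s) (mfderiv 𝓘(ℝ, F) 𝓘(ℝ, E) ι s X) ∧
        curvatureBar L ι N s (toFibre N s X) = toFibre N s Y)) ∧
    ∀ (γ : ℝ → S) (t₀ : ℝ), IsMIntegralCurveAt γ N t₀ →
      -- the derivative of sections of `V` along the generator is well defined
      (∀ Z₀ : Fibre N (γ t₀), ∃ Xbar Z, Xbar t₀ = Z₀ ∧ HasSectionDerivAt L ι N γ t₀ Xbar Z) ∧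
      (∀ Xbar Z Z', HasSectionDerivAt L ι N γ t₀ Xbar Z →
        HasSectionDerivAt L ι N γ t₀ Xbar Z' → Z = Z') ∧
      -- Riccati equation
      HasEndDerivAt L ι N γ t₀ (weingarten L ι N)
        (- curvatureBar L ι N (γ t₀) - weingarten L ι N (γ t₀) ∘ₗ weingarten L ι N (γ t₀)
          + κ (γ t₀) • weingarten L ι N (γ t₀)) ∧
      -- Raychaudhuri equation
      HasDerivAt (fun t => expansion L ι N (γ t))
        (- ricci L (ι (γ t₀)) (push ι N (γ t₀)) - shearSq L ι N ((n : ℝ) - 1) (γ t₀)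
          - 1 / ((n : ℝ) - 1) * expansion L ι N (γ t₀) ^ 2
          + κ (γ t₀) * expansion L ι N (γ t₀)) t₀ ∧
      -- shear evolution equation
      HasEndDerivAt L ι N γ t₀ (shear L ι N ((n : ℝ) - 1))
        (- weylBar L ι N ((n : ℝ) - 1) (γ t₀)
          - (shear L ι N ((n : ℝ) - 1) (γ t₀) ∘ₗ shear L ι N ((n : ℝ) - 1) (γ t₀)
            - (1 / ((n : ℝ) - 1) * shearSq L ι N ((n : ℝ) - 1) (γ t₀)) • LinearMap.id)
          - (2 / ((n : ℝ) - 1) * expansion L ι N (γ t₀)) • shear L ι N ((n : ℝ) - 1) (γ t₀)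
          + κ (γ t₀) • shear L ι N ((n : ℝ) - 1) (γ t₀)) := by
  have hfin : ∀ s : S, (Module.finrank ℝ (Fibre N s) : ℝ) = (n : ℝ) - 1 := fun s => by
    have : FiniteDimensional ℝ (TangentSpace 𝓘(ℝ, F) s) := inferInstanceAs (FiniteDimensional ℝ F)
    have h1 := finrank_quotient_line (q := (Submodule.span ℝ {N s}).mkQ) (v := N s)
      (Submodule.mkQ_surjective _) (fun ξ => by
        rw [Submodule.mkQ_apply, Submodule.Quotient.mk_eq_zero, Submodule.mem_span_singleton]
        exact exists_congr fun c => eq_comm) (hS.ne_zero s)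
    have h2 : Module.finrank ℝ (TangentSpace 𝓘(ℝ, F) s) = n := hF
    rwa [h2] at h1
  refine ⟨fun s X => ⟨?_, ?_⟩, fun γ t₀ hγ => ?_⟩
  · obtain ⟨Y, hY⟩ := hS.exists_mfderiv_eq_covDeriv hL s X
    exact ⟨Y, hY, hS.weingarten_toFibre hL hκ hY⟩
  · obtain ⟨Y, hY⟩ := hS.exists_mfderiv_eq_curvature hL s (mfderiv 𝓘(ℝ, F) 𝓘(ℝ, E) ι s X)
    exact ⟨Y, hY, hS.curvatureBar_toFibre hL hY⟩
  obtain ⟨D, β, β', hframe, hiff, hβ, hB, hB₁⟩ := hS.exists_frame hL hκ hγ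
  have hθ : HasDerivAt (fun t => expansion L ι N (γ t))
      (- ricci L (ι (γ t₀)) (push ι N (γ t₀)) - shearSq L ι N ((n : ℝ) - 1) (γ t₀)
        - 1 / ((n : ℝ) - 1) * expansion L ι N (γ t₀) ^ 2
        + κ (γ t₀) * expansion L ι N (γ t₀)) t₀ := by
    have h1 := hframe.hasDerivAt_trace hβ hB hB₁
    rw [map_add, map_sub, map_neg, map_smul, trace_weingarten_comp_self (hfin (γ t₀)),
      ← hS.ricci_eq_trace hL, ← sub_sub] at h1
    exact h1
  refine ⟨fun Z₀ => ?_, fun Xbar Z Z' h1 h2 => ?_, fun Xbar Z h1 => ?_, hθ, fun Xbar Z h1 => ?_⟩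
  · obtain ⟨X, Z, h1, h2⟩ := hframe.exists_hasFrameDerivAt Z₀
    exact ⟨X, Z, h1, (hiff X Z).2 h2⟩
  · exact hframe.hasFrameDerivAt_unique ((hiff _ _).1 h1) ((hiff _ _).1 h2)
  · exact (hiff _ _).2 (((hiff _ _).1 h1).apply_end hβ hB hB₁)
  -- The shear is induced by `β - θ/(n-1) id`. The derivative of its scalar part is given by the
  -- Raychaudhuri equation, and this part commutes with `D`.
  · refine (hiff _ _).2 (((hiff _ _).1 h1).apply_end (B := fun t => shear L ι N ((n : ℝ) - 1) (γ t))
      (hβ.sub ((hθ.const_mul (1 / ((n : ℝ) - 1))).smul_const (ContinuousLinearMap.id ℝ F)))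
      ?_ fun ξ => ?_)
    · filter_upwards [hB] with t ht ξ
      simp [shear, ht]
    · have h2 := hB₁ ξ
      -- With `Ric(n)` written as `tr R̄`, the curvature terms combine into `C̄`, and the goal is a
      -- linear consequence of the Riccati equation.
      rw [hS.ricci_eq_trace hL] at hθ ⊢
      simp only [shear, weylBar, LinearMap.add_apply, LinearMap.sub_apply, LinearMap.neg_apply,
        LinearMap.smul_apply, LinearMap.comp_apply, LinearMap.id_apply, map_add, map_sub, map_smul,
        Pi.sub_apply, sub_apply, smul_apply, ContinuousLinearMap.id_apply] at h2 ⊢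
      rw [← sub_eq_zero] at h2 ⊢
      rw [← h2]
      module
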